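/- **Setting.** Let $\Pi$ be a simply connected cell complex formed by a set of elementary squares of the lattice $\mathbb Z^2$, with even vertices $G$ ($m+n$ even) and odd vertices $G^*$ ($m+n$ odd). Two even vertices are neighbors if they are opposite corners of a square of $\Pi$; the valence $V(v)\le 4$ of $v\in G$ is the number of its neighbors $v_k$; $v$ is internal if $V(v)=4$ and a boundary vertex if $V(v)<4$. A hyperbolic ring is a pair of concentric circles $(C,c)$ in the hyperbolic plane, with outer radius $R>0$ and signed inner radius $r$, $|r|\le R$ (the inner circle is a point if $r=0$; the sign of $r$ is the orientation of the ring). Infinite radii $r=\pm\infty$, $R=\infty$ are allowed: then the ring is a pair of concentric horocycles with an orientation. A hyperbolic orthogonal ring pattern consists of rings $(C_v,c_v)$, $v\in G$, and points $\ell_w$, $w\in G^*$, of the hyperbolic plane such that 1. for neighboring $v,v'$ the circle $C_v$ intersects $c_{v'}$ orthogonally, and vice versa; 2. for each odd vertex $(m,n)$ the circles $c_{m-1,n}$, $c_{m+1,n}$, $C_{m,n-1}$, $C_{m,n+1}$ (those that belong to sides of $\Pi$ at this vertex) pass through $\ell_{m,n}$; there the two outer circles touch with centers on different sides of the common tangent,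 and the two inner circles touch with centers on different sides if their radii have the same sign and on the same side if the signs are opposite; 3. for each $v\in G$ and each square of $\Pi$ at $v$, the two points $\ell$ at the corners of the square adjacent to $v$, taken in the counterclockwise order of the lattice directions (right, up, left, down) at $v$, follow each other counterclockwise around the center of the ring if $r_v>0$ and clockwise if $r_v<0$; that is, their oriented opening angle $\theta_k\in(-\pi,\pi)$ at the center has the sign of $r_v$. (For ideal centers the order is the one along the horocycles, and $\theta_k=0$.) Put $\Theta(v)=\sum_k\theta_k$, the sum over the neighbors $v_k$ of $v$ (the total nominal angle at $v$). Let $0<q\le1$ and let $\operatorname{sn},\operatorname{cn},\operatorname{dn}$ be the Jacobi functions of modulus $q$ with quarter periods $K$ and $iK'$; for $q=1$ one has $K=\infty$ and $[0,2K]$ means $[0,\infty)$. A ring has parameter $q$ if $\cosh r=q\cosh R$, and $r=R$ in case $q=1$ (for concentric horocycles: their distance is $-\log q$, and the orientation is positive in case $q=1$). Its uniformizing variable is the number $\gamma\in[0,2K]$ with $$\cosh R=\frac1{q\operatorname{sn}\gamma},\qquad \tanh R=\operatorname{dn}\gamma,\qquad \sinh r=\frac{\operatorname{cn}\gamma}{\operatorname{sn}\gamma},$$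 where $\gamma=0$ and $\gamma=2K$ belong to $r=+\infty$ and $r=-\infty$. Let $g:\mathbb R\to\mathbb R$ be the continuous function $g(x)=\frac\pi2-\arg\operatorname{sn}\frac{x+iK'}2$ with $g(0)=0$. **Theorem.** (a) The rings of every hyperbolic orthogonal ring pattern with parameter $q$ have uniformizing variables $\gamma\in[0,2K]$. Real numbers $\gamma_v$, $v\in G$, are the uniformizing variables of the rings of some hyperbolic orthogonal ring pattern (with parameter $q$) if and only if all of them lie in $[0,2K]$ and at every internal vertex, with variable $\gamma$ and with $\gamma_1,\dots,\gamma_4$ at its neighbors, $$\sum_{k=1}^4 \bigl(g(\gamma+\gamma_k)+g(\gamma-\gamma_k)\bigr)=2\pi.$$ (b) For every such pattern and every boundary vertex $v$, with variable $\gamma$, $$\sum_k \bigl(g(\gamma-\gamma_k)+g(\gamma+\gamma_k)\bigr)=\Theta(v)\ \text{ if } r>0,\qquad \sum_k \bigl(g(\gamma-\gamma_k)+g(\gamma+\gamma_k)\bigr)=\Theta(v)+\pi V(v)\ \text{ if } r<0,$$ the sums being over the neighbors of $v$. -/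

import Mathlib

noncomputable section

namespace RingPattern

open Real

/-! ### Jacobi elliptic functions of modulus `q`, `0 ≤ q ≤ 1` -/

/-- The incomplete elliptic integral of the first kind. -/
def ellipticF (q φ : ℝ) : ℝ := ∫ θ in (0 : ℝ)..φ, 1 / √(1 - q ^ 2 * sin θ ^ 2)

/-- The quarter period `K(q)`, for `0 ≤ q < 1`  (`K = ∞` for `q = 1`). -/
def quarterK (q : ℝ) : ℝ := ellipticF q (π / 2)

/-- The complementary modulus. -/
def compl (q : ℝ) : ℝ := √(1 - q ^ 2)

/-- The quarter period `K'(q)`, for `0 < q ≤ 1`. -/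
def quarterK' (q : ℝ) : ℝ := quarterK (compl q)

/-- The Jacobi amplitude: the inverse of `φ ↦ ellipticF q φ`, a bijection of `ℝ` for
`0 ≤ q < 1`; for `q = 1` it is the Gudermann function, so that `sn = tanh`. -/
def am (q u : ℝ) : ℝ := if q = 1 then arcsin (tanh u) else Function.invFun (ellipticF q) u

def sn (q u : ℝ) : ℝ := sin (am q u)

def cn (q u : ℝ) : ℝ := cos (am q u)

def dn (q u : ℝ) : ℝ := √(1 - q ^ 2 * sn q u ^ 2)

/-- The Jacobi function `sn` at a complex argument `u + i v`, reduced to real arguments by the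
addition theorem and Jacobi's imaginary transformation. -/
def snC (q : ℝ) (z : ℂ) : ℂ :=
  ((sn q z.re * dn (compl q) z.im : ℝ) +
    (cn q z.re * dn q z.re * sn (compl q) z.im * cn (compl q) z.im : ℝ) * Complex.I) /
  ((cn (compl q) z.im ^ 2 + q ^ 2 * sn q z.re ^ 2 * sn (compl q) z.im ^ 2 : ℝ) : ℂ)

/-- `g` is the continuous branch of `x ↦ π / 2 - arg (sn ((x + i K') / 2))` with `g 0 = 0`. -/
def IsArgBranch (q : ℝ) (g : ℝ → ℝ) : Prop :=
  Continuous g ∧ g 0 = 0 ∧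
    ∀ x : ℝ, snC q ((x + quarterK' q * Complex.I) / 2) =
      (‖snC q ((x + quarterK' q * Complex.I) / 2)‖ : ℂ) *
        Complex.exp (((π / 2 - g x : ℝ) : ℂ) * Complex.I)

open Classical in
/-- The function `g(x) = π / 2 - arg (sn ((x + i K') / 2))`, continuous with `g 0 = 0`. -/
def gFun (q : ℝ) : ℝ → ℝ :=
  if h : ∃ g, IsArgBranch q g then h.choose else 0

/-- The interval `[0, 2K]`, which is `[0, ∞)` for `q = 1`. -/
def gammaInterval (q : ℝ) : Set ℝ := {γ | 0 ≤ γ ∧ (q < 1 → γ ≤ 2 * quarterK q)}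

/-! ### The combinatorics: simply connected sets of squares of the lattice `ℤ × ℤ`

A square is given by its lower left corner. -/

/-- `v` is a corner of the square `s`. -/
def IsCorner (v s : ℤ × ℤ) : Prop :=
  (v.1 = s.1 ∨ v.1 = s.1 + 1) ∧ (v.2 = s.2 ∨ v.2 = s.2 + 1)

/-- The vertices of the complex. -/
def verts (S : Set (ℤ × ℤ)) : Set (ℤ × ℤ) := {v | ∃ s ∈ S, IsCorner v s}

/-- The even vertices `G` (rings). -/
def evenVerts (S : Set (ℤ × ℤ)) : Set (ℤ × ℤ) := {v ∈ verts S | Even (v.1 + v.2)}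

/-- The odd vertices `G*` (touching points). -/
def oddVerts (S : Set (ℤ × ℤ)) : Set (ℤ × ℤ) := {v ∈ verts S | Odd (v.1 + v.2)}

/-- The 1-skeleton: the sides of the squares. -/
def skeleton (S : Set (ℤ × ℤ)) : SimpleGraph (ℤ × ℤ) where
  Adj u v := (|u.1 - v.1| + |u.2 - v.2| = 1) ∧ ∃ s ∈ S, IsCorner u s ∧ IsCorner v s
  symm := ⟨by
    rintro u v ⟨h, s, hs, hu, hv⟩
    exact ⟨by rw [abs_sub_comm v.1, abs_sub_comm v.2]; exact h, s, hs, hv, hu⟩⟩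
  loopless := ⟨by rintro u ⟨h, -⟩; simp at h⟩

/-- Edge homotopy: edge paths with common end points are identified if they differ by inserting
or deleting backtracks and by pushing two consecutive sides of a square to the two others. -/
inductive EdgeHomotopic (S : Set (ℤ × ℤ)) :
    ∀ {u v : ℤ × ℤ}, (skeleton S).Walk u v → (skeleton S).Walk u v → Prop
  | refl {u v} (w : (skeleton S).Walk u v) : EdgeHomotopic S w w
  | symm {u v} {w w' : (skeleton S).Walk u v} :
      EdgeHomotopic S w w' → EdgeHomotopic S w' w
  | trans {u v} {w w' w'' : (skeleton S).Walk u v} :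
      EdgeHomotopic S w w' → EdgeHomotopic S w' w'' → EdgeHomotopic S w w''
  | backtrack {u a b v} (p : (skeleton S).Walk u a) (h : (skeleton S).Adj a b)
      (w : (skeleton S).Walk a v) :
      EdgeHomotopic S (p.append (.cons h (.cons h.symm w))) (p.append w)
  | square {u a b c d v} (s : ℤ × ℤ) (hs : s ∈ S)
      (ha : IsCorner a s) (hb : IsCorner b s) (hc : IsCorner c s) (hd : IsCorner d s)
      (p : (skeleton S).Walk u a)
      (hab : (skeleton S).Adj a b) (hbc : (skeleton S).Adj b c)
      (had : (skeleton S).Adj a d) (hdc : (skeleton S).Adj d c)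
      (w : (skeleton S).Walk c v) :
      EdgeHomotopic S (p.append (.cons hab (.cons hbc w))) (p.append (.cons had (.cons hdc w)))

/-- The square complex is nonempty, connected, and its edge path group is trivial. -/
def IsSimplyConnected (S : Set (ℤ × ℤ)) : Prop :=
  S.Nonempty ∧
  (∀ u ∈ verts S, ∀ v ∈ verts S, (skeleton S).Reachable u v) ∧
  ∀ u : ℤ × ℤ, ∀ w : (skeleton S).Walk u u, EdgeHomotopic S w .nil

/-- The (even) vertex diagonally opposite to `v` in direction `(ε, δ)`. -/
def nbr (v : ℤ × ℤ) (d : ℤˣ × ℤˣ) : ℤ × ℤ := (v.1 + d.1, v.2 + d.2)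

/-- The vertex next to `v` in the horizontal direction `ε`. -/
def horNbr (v : ℤ × ℤ) (d : ℤˣ × ℤˣ) : ℤ × ℤ := (v.1 + d.1, v.2)

/-- The vertex next to `v` in the vertical direction `δ`. -/
def verNbr (v : ℤ × ℤ) (d : ℤˣ × ℤˣ) : ℤ × ℤ := (v.1, v.2 + d.2)

/-- The square with opposite corners `v` and `nbr v d`. -/
def cell (v : ℤ × ℤ) (d : ℤˣ × ℤˣ) : ℤ × ℤ := (min v.1 (v.1 + d.1), min v.2 (v.2 + d.2))

open Classical in
/-- The directions of the vertices neighboring to `v`, i.e. of the squares at `v`. -/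
def nbrDirs (S : Set (ℤ × ℤ)) (v : ℤ × ℤ) : Finset (ℤˣ × ℤˣ) :=
  Finset.univ.filter fun d => cell v d ∈ S

/-- The valence of an even vertex: the number of its neighboring rings. -/
def valence (S : Set (ℤ × ℤ)) (v : ℤ × ℤ) : ℕ := (nbrDirs S v).card

/-- Even vertices with four neighboring rings. -/
def internalVerts (S : Set (ℤ × ℤ)) : Set (ℤ × ℤ) := {v ∈ evenVerts S | valence S v = 4}

/-- Even vertices with less than four neighboring rings. -/
def boundaryVerts (S : Set (ℤ × ℤ)) : Set (ℤ × ℤ) := {v ∈ evenVerts S | valence S v < 4}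

/-! ### The hyperbolic plane (hyperboloid model) and hyperbolic rings -/

/-- Minkowski space `ℝ^{1,2}`. -/
abbrev Mink : Type := Fin 3 → ℝ

/-- The Lorentz product. -/
def mink (x y : Mink) : ℝ := -(x 0 * y 0) + x 1 * y 1 + x 2 * y 2

/-- The hyperbolic plane; the distance is `cosh d(x, y) = - mink x y`. -/
def hypPlane : Set Mink := {x | mink x x = -1 ∧ 0 < x 0}

/-- Representatives of the ideal points of the hyperbolic plane. -/
def idealPoints : Set Mink := {x | mink x x = 0 ∧ 0 < x 0}

def det3 (x y z : Mink) : ℝ := Matrix.det (Matrix.of ![x, y, z])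

/-- The cycle `{x | - mink x center = level}`: for `center` in the hyperbolic plane and
`level = cosh ρ` it is the circle of radius `ρ` (a point, if `ρ = 0`), for an ideal center and
`level > 0` it is a horocycle. -/
structure Cycle where
  center : Mink
  level : ℝ

/-- The points of a cycle. -/
def Cycle.points (A : Cycle) : Set Mink := {x ∈ hypPlane | -mink x A.center = A.level}

/-- A tangent vector at the point `x` that points to the center along the normal of the cycle
through `x`: the projection of the center to the tangent plane of the hyperboloid at `x`. -/
def Cycle.normal (A : Cycle) (x : Mink) : Mink := A.center + mink x A.center • x

/-- Two cycles meet, and they are orthogonal where they meet. -/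
def Cycle.Orthogonal (A B : Cycle) : Prop :=
  (A.points ∩ B.points).Nonempty ∧
    ∀ x ∈ A.points ∩ B.points, mink (A.normal x) (B.normal x) = 0

/-- Oriented touching at `x`. Here `a`, `b` are the signs of the radii: the centers lie on
different sides of the common tangent if the signs agree, and on the same side otherwise. -/
def Cycle.TouchAt (A B : Cycle) (a b : ℝ) (x : Mink) : Prop :=
  x ∈ A.points ∧ x ∈ B.points ∧ SameRay ℝ (a • A.normal x) (-(b • B.normal x))

/-- Hyperbolic rings: a pair of concentric circles with inner radius `r` (of any sign) and outer
radius `R > 0`; or, as the limiting case of the radii `r = ± ∞`, `R = ∞`, a pair of concentric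
horocycles of levels `a ≤ A` with an orientation `s`. -/
inductive HypRing
  | proper (k : Mink) (hk : k ∈ hypPlane) (r R : ℝ) (hR : 0 < R) (hr : |r| ≤ R)
  | ideal (k : Mink) (hk : k ∈ idealPoints) (a A : ℝ) (ha : 0 < a) (hA : a ≤ A) (s : ℤˣ)

namespace HypRing

def center : HypRing → Mink
  | proper k _ _ _ _ _ => k
  | ideal k _ _ _ _ _ _ => k

/-- The inner circle `c`. -/
def inner : HypRing → Cycle
  | proper k _ r _ _ _ => ⟨k, cosh r⟩
  | ideal k _ a _ _ _ _ => ⟨k, a⟩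

/-- The outer circle `C`. -/
def outer : HypRing → Cycle
  | proper k _ _ R _ _ => ⟨k, cosh R⟩
  | ideal k _ _ A _ _ _ => ⟨k, A⟩

/-- The signed inner radius. -/
def innerRadius : HypRing → EReal
  | proper _ _ r _ _ _ => (r : EReal)
  | ideal _ _ _ _ _ _ s => if s = 1 then ⊤ else ⊥

/-- The orientation: the sign of the inner radius. -/
def orientation : HypRing → ℝ
  | proper _ _ r _ _ _ => Real.sign r
  | ideal _ _ _ _ _ _ s => ((s : ℤ) : ℝ)

/-- The ring has the parameter `q`, i.e. `cosh r = q cosh R`; if `q = 1` then `r = R`. For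
concentric horocycles this says that their distance is `- log q = lim (R - r)`. -/
def HasParameter (q : ℝ) : HypRing → Prop
  | proper _ _ r R _ _ => cosh r = q * cosh R ∧ (q = 1 → r = R)
  | ideal _ _ a A _ _ s => a = q * A ∧ (q = 1 → s = 1)

/-- `γ ∈ [0, 2K]` is the uniformizing variable of the ring:
`cosh R = 1 / (q sn γ)`, `tanh R = dn γ`, `sinh r = cn γ / sn γ`. The zeros `γ = 0` and `γ = 2K`
of `sn` belong to the infinite radii `r = + ∞` and `r = - ∞`, respectively. -/
def IsUniformizedBy (q γ : ℝ) : HypRing → Prop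
  | proper _ _ r R _ _ => γ ∈ gammaInterval q ∧
      cosh R = 1 / (q * sn q γ) ∧ tanh R = dn q γ ∧ sinh r = cn q γ / sn q γ
  | ideal _ _ a A _ _ s => γ ∈ gammaInterval q ∧
      a = q * A ∧ sn q γ = 0 ∧ cn q γ = ((s : ℤ) : ℝ)

/-- The oriented angle in `(-π, π]` from `x` to `y`, seen from the center of the ring
(zero, if the center is ideal). -/
def angle (x y : Mink) : HypRing → ℝ
  | proper k _ _ _ _ _ =>
      Complex.arg ⟨mink (x + mink x k • k) (y + mink y k • k), det3 k x y⟩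
  | ideal _ _ _ _ _ _ _ => 0

end HypRing

/-- Hyperbolic orthogonal ring patterns: rings at the even vertices and points of the hyperbolic
plane at the odd vertices of the complex. (The values at the other vertices are irrelevant.) -/
structure IsRingPattern (S : Set (ℤ × ℤ)) (ring : ℤ × ℤ → HypRing) (pt : ℤ × ℤ → Mink) :
    Prop where
  /-- The points lie in the hyperbolic plane. -/
  pt_mem : ∀ w ∈ oddVerts S, pt w ∈ hypPlane
  /-- Neighboring rings intersect orthogonally. (Vice versa: exchange the two vertices.) -/
  orthogonal : ∀ v ∈ evenVerts S, ∀ d ∈ nbrDirs S v,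
    (ring v).outer.Orthogonal (ring (nbr v d)).inner
  /-- The inner circles of the horizontal neighbors and the outer circles of the vertical
  neighbors of an odd vertex pass through its point. -/
  inner_mem : ∀ v ∈ evenVerts S, ∀ d ∈ nbrDirs S v, pt (horNbr v d) ∈ (ring v).inner.points
  outer_mem : ∀ v ∈ evenVerts S, ∀ d ∈ nbrDirs S v, pt (verNbr v d) ∈ (ring v).outer.points
  /-- The inner circles of the horizontal neighbors of an odd vertex touch in its point. -/
  inner_touch : ∀ m n : ℤ, (m, n) ∈ oddVerts S →
    (skeleton S).Adj (m, n) (m - 1, n) → (skeleton S).Adj (m, n) (m + 1, n) →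
    Cycle.TouchAt (ring (m - 1, n)).inner (ring (m + 1, n)).inner
      (ring (m - 1, n)).orientation (ring (m + 1, n)).orientation (pt (m, n))
  /-- The outer circles of the vertical neighbors of an odd vertex touch in its point. -/
  outer_touch : ∀ m n : ℤ, (m, n) ∈ oddVerts S →
    (skeleton S).Adj (m, n) (m, n - 1) → (skeleton S).Adj (m, n) (m, n + 1) →
    Cycle.TouchAt (ring (m, n - 1)).outer (ring (m, n + 1)).outer 1 1 (pt (m, n))
  /-- Consecutive touching points of a ring (in the order right, up, left, down of the lattice)
  follow each other counterclockwise around its center, as seen from there, if `r > 0`, and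
  clockwise if `r < 0`. In direction `d = (ε, δ)` the horizontal touching point precedes the
  vertical one if `ε δ = 1` and follows it if `ε δ = -1`. -/
  oriented : ∀ v ∈ evenVerts S, ∀ d ∈ nbrDirs S v,
    Real.sign (((d.1 * d.2 : ℤˣ) : ℤ) *
      det3 (ring v).center (pt (horNbr v d)) (pt (verNbr v d))) = (ring v).orientation

/-- The opening angle at `v` of the quadrilateral spanned by the rings at `v` and `nbr v d`. -/
def openingAngle (ring : ℤ × ℤ → HypRing) (pt : ℤ × ℤ → Mink) (v : ℤ × ℤ) (d : ℤˣ × ℤˣ) : ℝ :=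
  ((d.1 * d.2 : ℤˣ) : ℤ) * (ring v).angle (pt (horNbr v d)) (pt (verNbr v d))

/-- The total angle `Θ(v)` at the vertex `v`. -/
def totalAngle (S : Set (ℤ × ℤ)) (ring : ℤ × ℤ → HypRing) (pt : ℤ × ℤ → Mink) (v : ℤ × ℤ) : ℝ :=
  ∑ d ∈ nbrDirs S v, openingAngle ring pt v d

/-- The sum of `g(γ + γ_k) + g(γ - γ_k)` over the neighboring rings of `v`. -/
def gammaSum (S : Set (ℤ × ℤ)) (q : ℝ) (γ : ℤ × ℤ → ℝ) (v : ℤ × ℤ) : ℝ :=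
  ∑ d ∈ nbrDirs S v, (gFun q (γ v + γ (nbr v d)) + gFun q (γ v - γ (nbr v d)))

end RingPattern

end

noncomputable section

namespace RingPattern

open Real

/-! ### The incomplete elliptic integral and the amplitude -/

/-! Scale the center of every ring so that its inner circle has level `1`. Its outer circle then has
level `1 / q`, the Lorentz square of the scaled center is `-sn² γ`, and orthogonality of neighbors
says that their scaled centers have Lorentz product `-1 / q`. Ideal rings are simply the case `sn γ
= 0`.

Two neighboring centers and the two points of their common square form a quadrilateral with right
angles at these points. For finite radii its diagonal `d` has `cosh d = 1 / (q sn γ sn γ')` and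
`tanh d = √D`, where `D = 1 - q² sn² γ sn² γ'`. The diagonal splits the angle at the center into `h`
and `β` with `cos h = tanh r / tanh d = cn γ / √D` and `cos β = tanh R / tanh d = dn γ / √D`,
suitably signed. The addition theorems identify `h` and `β` as the half sums of `am` and of `arcsin
(q sn)` at `γ ± γ'` (`am_add_am_spec`, `arcsinSn_add_arcsinSn_spec`). Since `g = (am + arcsin (q
sn)) / 2` (`gFun_eq`), the nominal angle `g (γ + γ') + g (γ - γ')` is `h + β`. It is the oriented
opening angle if `r > 0` and exceeds it by `π` if `r < 0` (`openingAngle_eq`); summation gives (b).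

At an internal vertex the directions to the four points close up, so the nominal angles add up to a
multiple of `2π`; each lies in `(0, π)`, hence the sum is `2π` (`gammaSum_of_internal`). An ideal
center is impossible there, because points moving monotonically along horocycles never return.

Conversely, the variables determine a Lorentz transformation across each square, between the frames
at its two odd corners. Around a boundary vertex these can always be fitted together; around an
internal vertex they fit because the angle sum is `2π` (`exists_isStar_of_notMem`,
`exists_isStar_of_sum_eq`). They form a flat connection on the complex, which is trivial by simple
connectivity (`exists_potential`). The resulting frames carry the points, the centers and all
touching conditions (`exists_isRingPattern`). -/

lemma one_sub_sq_mul_sin_sq_pos {q : ℝ} (hq0 : 0 ≤ q) (hq1 : q < 1) (θ : ℝ) :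
    0 < 1 - q ^ 2 * sin θ ^ 2 := by
  have h1 : q ^ 2 < 1 := by nlinarith
  have h2 : sin θ ^ 2 ≤ 1 := sin_sq_le_one θ
  nlinarith [sq_nonneg (sin θ), sq_nonneg q]

lemma continuous_ellipticF_integrand {q : ℝ} (hq0 : 0 ≤ q) (hq1 : q < 1) :
    Continuous fun θ : ℝ => 1 / √(1 - q ^ 2 * sin θ ^ 2) := by
  refine Continuous.div continuous_const (by fun_prop) fun θ => ?_
  exact (sqrt_pos.2 (one_sub_sq_mul_sin_sq_pos hq0 hq1 θ)).ne'

lemma hasDerivAt_ellipticF {q : ℝ} (hq0 : 0 ≤ q) (hq1 : q < 1) (φ : ℝ) :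
    HasDerivAt (ellipticF q) (1 / √(1 - q ^ 2 * sin φ ^ 2)) φ :=
  (continuous_ellipticF_integrand hq0 hq1).integral_hasStrictDerivAt 0 φ |>.hasDerivAt

lemma ellipticF_zero (q : ℝ) : ellipticF q 0 = 0 := by simp [ellipticF]

lemma ellipticF_neg (q φ : ℝ) : ellipticF q (-φ) = -ellipticF q φ := by
  have h := intervalIntegral.integral_comp_neg (a := 0) (b := φ)
    (f := fun θ : ℝ => 1 / √(1 - q ^ 2 * sin θ ^ 2))
  simp only [sin_neg, neg_sq, neg_zero] at h
  rw [ellipticF, ellipticF, h, intervalIntegral.integral_symm]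

lemma strictMono_ellipticF {q : ℝ} (hq0 : 0 ≤ q) (hq1 : q < 1) : StrictMono (ellipticF q) := by
  refine strictMono_of_deriv_pos fun φ => ?_
  rw [(hasDerivAt_ellipticF hq0 hq1 φ).deriv]
  exact one_div_pos.2 (sqrt_pos.2 (one_sub_sq_mul_sin_sq_pos hq0 hq1 φ))

lemma le_ellipticF {q : ℝ} (hq0 : 0 ≤ q) (hq1 : q < 1) {φ : ℝ} (hφ : 0 ≤ φ) :
    φ ≤ ellipticF q φ := by
  have h : ∫ _ in (0 : ℝ)..φ, (1 : ℝ) ≤ ellipticF q φ := by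
    refine intervalIntegral.integral_mono_on hφ (by simp)
      ((continuous_ellipticF_integrand hq0 hq1).intervalIntegrable _ _) fun θ _ => ?_
    have h1 := one_sub_sq_mul_sin_sq_pos hq0 hq1 θ
    rw [le_div_iff₀ (sqrt_pos.2 h1), one_mul]
    have : 0 ≤ q ^ 2 * sin θ ^ 2 := by positivity
    exact sqrt_le_one.2 (by linarith)
  simpa using h

lemma surjective_ellipticF {q : ℝ} (hq0 : 0 ≤ q) (hq1 : q < 1) :
    Function.Surjective (ellipticF q) := by
  have hc : Continuous (ellipticF q) :=
    continuous_iff_continuousAt.2 fun φ => (hasDerivAt_ellipticF hq0 hq1 φ).continuousAt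
  have htop : Filter.Tendsto (ellipticF q) Filter.atTop Filter.atTop :=
    Filter.tendsto_atTop_mono' _ ((Filter.eventually_ge_atTop 0).mono
      fun φ hφ => le_ellipticF hq0 hq1 hφ) Filter.tendsto_id
  refine hc.surjective htop ?_
  have h : ellipticF q = fun φ => -ellipticF q (-φ) := by
    funext φ; rw [ellipticF_neg, neg_neg]
  rw [h]
  exact Filter.tendsto_neg_atTop_atBot.comp (htop.comp Filter.tendsto_neg_atBot_atTop)

lemma ellipticF_am {q : ℝ} (hq0 : 0 ≤ q) (hq1 : q < 1) (u : ℝ) : ellipticF q (am q u) = u := by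
  rw [am, if_neg hq1.ne]
  exact Function.rightInverse_invFun (surjective_ellipticF hq0 hq1) u

lemma am_ellipticF {q : ℝ} (hq0 : 0 ≤ q) (hq1 : q < 1) (φ : ℝ) : am q (ellipticF q φ) = φ := by
  rw [am, if_neg hq1.ne]
  exact Function.leftInverse_invFun (strictMono_ellipticF hq0 hq1).injective φ

/-! ### Jacobi functions: derivatives and parity, including the degenerate modulus `q = 1`. -/

lemma tanh_sq_lt_one (u : ℝ) : tanh u ^ 2 < 1 := by
  rw [tanh_eq_sinh_div_cosh, div_pow, div_lt_one (by positivity [cosh_pos u])]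
  linarith [cosh_sq u]

lemma am_one (u : ℝ) : am 1 u = arcsin (tanh u) := by rw [am, if_pos rfl]

lemma sn_one (u : ℝ) : sn 1 u = tanh u := by
  have h := abs_lt.1 ((sq_lt_one_iff_abs_lt_one _).1 (tanh_sq_lt_one u))
  rw [sn, am_one, sin_arcsin h.1.le h.2.le]

lemma dn_sq_pos {q : ℝ} (hq0 : 0 ≤ q) (hq1 : q ≤ 1) (u : ℝ) : 0 < 1 - q ^ 2 * sn q u ^ 2 := by
  rcases hq1.lt_or_eq with h | rfl
  · exact one_sub_sq_mul_sin_sq_pos hq0 h _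
  · rw [sn_one]; linarith [tanh_sq_lt_one u]

lemma dn_pos {q : ℝ} (hq0 : 0 ≤ q) (hq1 : q ≤ 1) (u : ℝ) : 0 < dn q u :=
  sqrt_pos.2 (dn_sq_pos hq0 hq1 u)

lemma dn_sq {q : ℝ} (hq0 : 0 ≤ q) (hq1 : q ≤ 1) (u : ℝ) : dn q u ^ 2 = 1 - q ^ 2 * sn q u ^ 2 :=
  sq_sqrt (dn_sq_pos hq0 hq1 u).le

lemma cn_sq (q u : ℝ) : cn q u ^ 2 = 1 - sn q u ^ 2 := by
  rw [cn, sn, cos_sq']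

lemma am_zero {q : ℝ} (hq0 : 0 ≤ q) (hq1 : q ≤ 1) : am q 0 = 0 := by
  rcases hq1.lt_or_eq with h | rfl
  · simpa [ellipticF_zero] using am_ellipticF hq0 h 0
  · simp [am_one]

lemma am_neg {q : ℝ} (hq0 : 0 ≤ q) (hq1 : q ≤ 1) (u : ℝ) : am q (-u) = -am q u := by
  rcases hq1.lt_or_eq with h | rfl
  · apply (strictMono_ellipticF hq0 h).injective
    rw [ellipticF_am hq0 h, ellipticF_neg, ellipticF_am hq0 h]
  · rw [am_one, am_one, tanh_neg, arcsin_neg]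

lemma hasDerivAt_am {q : ℝ} (hq0 : 0 ≤ q) (hq1 : q ≤ 1) (u : ℝ) :
    HasDerivAt (am q) (dn q u) u := by
  rcases hq1.lt_or_eq with h | rfl
  · have hcont : Continuous (am q) := by
      have e : am q = ((strictMono_ellipticF hq0 h).orderIsoOfSurjective _
          (surjective_ellipticF hq0 h)).symm := by
        funext x
        rw [OrderIso.eq_symm_apply]
        exact ellipticF_am hq0 h x
      rw [e]
      exact OrderIso.continuous _
    have hd := HasDerivAt.of_local_left_inverse hcont.continuousAt
      (hasDerivAt_ellipticF hq0 h (am q u))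
      (one_div_pos.2 (sqrt_pos.2 (one_sub_sq_mul_sin_sq_pos hq0 h _))).ne'
      (Filter.Eventually.of_forall fun x => ellipticF_am hq0 h x)
    simpa [dn, sn] using hd
  · have e : am 1 = fun u => arcsin (tanh u) := funext am_one
    have hp := dn_pos zero_le_one le_rfl u
    have hsq := dn_sq zero_le_one le_rfl u
    rw [sn_one] at hsq
    have h := abs_lt.1 ((sq_lt_one_iff_abs_lt_one _).1 (tanh_sq_lt_one u))
    have h1 : HasDerivAt tanh (1 - tanh u ^ 2) u := by
      have e2 : tanh = fun x => sinh x / cosh x := funext tanh_eq_sinh_div_cosh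
      rw [e2]
      refine ((hasDerivAt_sinh u).div (hasDerivAt_cosh u) (cosh_pos u).ne').congr_deriv ?_
      have := (cosh_pos u).ne'
      field_simp
    have h2 := (hasDerivAt_arcsin h.1.ne' h.2.ne).comp u h1
    rw [e]
    refine h2.congr_deriv ?_
    have hd : √(1 - tanh u ^ 2) = dn 1 u := by rw [dn, sn_one]; simp
    rw [hd, show 1 - tanh u ^ 2 = dn 1 u ^ 2 by rw [hsq]; ring]
    field_simp

lemma hasDerivAt_sn {q : ℝ} (hq0 : 0 ≤ q) (hq1 : q ≤ 1) (u : ℝ) :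
    HasDerivAt (sn q) (cn q u * dn q u) u :=
  (hasDerivAt_am hq0 hq1 u).sin

lemma hasDerivAt_cn {q : ℝ} (hq0 : 0 ≤ q) (hq1 : q ≤ 1) (u : ℝ) :
    HasDerivAt (cn q) (-(sn q u * dn q u)) u :=
  (hasDerivAt_am hq0 hq1 u).cos.congr_deriv (by rw [sn]; ring)

lemma hasDerivAt_dn {q : ℝ} (hq0 : 0 ≤ q) (hq1 : q ≤ 1) (u : ℝ) :
    HasDerivAt (dn q) (-(q ^ 2 * sn q u * cn q u)) u := by
  have h := ((((hasDerivAt_sn hq0 hq1 u).pow 2).const_mul (q ^ 2)).const_sub 1).sqrt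
    (dn_sq_pos hq0 hq1 u).ne'
  refine h.congr_deriv ?_
  have hd : √(1 - q ^ 2 * (sn q ^ 2) u) = dn q u := rfl
  have := (dn_pos hq0 hq1 u).ne'
  simp only [hd]
  field_simp
  simp
  ring

lemma continuous_am {q : ℝ} (hq0 : 0 ≤ q) (hq1 : q ≤ 1) : Continuous (am q) :=
  continuous_iff_continuousAt.2 fun u => (hasDerivAt_am hq0 hq1 u).continuousAt

lemma strictMono_am {q : ℝ} (hq0 : 0 ≤ q) (hq1 : q ≤ 1) : StrictMono (am q) :=
  strictMono_of_deriv_pos fun u => by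
    rw [(hasDerivAt_am hq0 hq1 u).deriv]; exact dn_pos hq0 hq1 u

lemma sn_zero {q : ℝ} (hq0 : 0 ≤ q) (hq1 : q ≤ 1) : sn q 0 = 0 := by
  rw [sn, am_zero hq0 hq1, sin_zero]

lemma cn_zero {q : ℝ} (hq0 : 0 ≤ q) (hq1 : q ≤ 1) : cn q 0 = 1 := by
  rw [cn, am_zero hq0 hq1, cos_zero]

lemma dn_zero {q : ℝ} (hq0 : 0 ≤ q) (hq1 : q ≤ 1) : dn q 0 = 1 := by
  rw [dn, sn_zero hq0 hq1]; simp

lemma sn_neg {q : ℝ} (hq0 : 0 ≤ q) (hq1 : q ≤ 1) (u : ℝ) : sn q (-u) = -sn q u := by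
  rw [sn, am_neg hq0 hq1, sin_neg, sn]

lemma cn_neg {q : ℝ} (hq0 : 0 ≤ q) (hq1 : q ≤ 1) (u : ℝ) : cn q (-u) = cn q u := by
  rw [cn, am_neg hq0 hq1, cos_neg, cn]

lemma dn_neg {q : ℝ} (hq0 : 0 ≤ q) (hq1 : q ≤ 1) (u : ℝ) : dn q (-u) = dn q u := by
  rw [dn, sn_neg hq0 hq1, neg_sq, dn]

/-- The denominator `1 - q² sn² x sn² y` of the addition theorems. -/
lemma addDenom_pos {q : ℝ} (hq0 : 0 ≤ q) (hq1 : q ≤ 1) (x y : ℝ) :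
    0 < 1 - q ^ 2 * sn q x ^ 2 * sn q y ^ 2 := by
  have h1 := dn_sq_pos hq0 hq1 x
  have h2 : sn q y ^ 2 ≤ 1 := sin_sq_le_one _
  nlinarith [mul_nonneg (sq_nonneg q) (sq_nonneg (sn q x))]

/-! ### Addition theorems and the shift by `2K`. -/

/-- For a fixed sum `a` of the two arguments, the right-hand side has derivative zero in `x`, by the
differential equations and the quadratic relations between `sn`, `cn`, `dn`. Its value at `0` is `cn
a`. The same argument proves `dn_add`. -/
lemma cn_add {q : ℝ} (hq0 : 0 ≤ q) (hq1 : q ≤ 1) (x y : ℝ) :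
    cn q (x + y) = (cn q x * cn q y - sn q x * sn q y * dn q x * dn q y) /
      (1 - q ^ 2 * sn q x ^ 2 * sn q y ^ 2) := by
  have key : ∀ a u v : ℝ, (fun x => (cn q x * cn q (a - x) - sn q x * sn q (a - x) * dn q x *
      dn q (a - x)) / (1 - q ^ 2 * sn q x ^ 2 * sn q (a - x) ^ 2)) u =
      (fun x => (cn q x * cn q (a - x) - sn q x * sn q (a - x) * dn q x *
      dn q (a - x)) / (1 - q ^ 2 * sn q x ^ 2 * sn q (a - x) ^ 2)) v := by
    intro a
    have hd : ∀ x, HasDerivAt (fun x => (cn q x * cn q (a - x) - sn q x * sn q (a - x) * dn q x *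
        dn q (a - x)) / (1 - q ^ 2 * sn q x ^ 2 * sn q (a - x) ^ 2)) 0 x := by
      intro x
      have hs := hasDerivAt_sn hq0 hq1 x
      have hc := hasDerivAt_cn hq0 hq1 x
      have hd := hasDerivAt_dn hq0 hq1 x
      have hs2 := (hasDerivAt_sn hq0 hq1 (a - x)).comp_const_sub a x
      have hc2 := (hasDerivAt_cn hq0 hq1 (a - x)).comp_const_sub a x
      have hd2 := (hasDerivAt_dn hq0 hq1 (a - x)).comp_const_sub a x
      have hD := addDenom_pos hq0 hq1 x (a - x)
      have h := ((hc.mul hc2).sub (((hs.mul hs2).mul hd).mul hd2)).div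
        ((((hs.pow 2).const_mul (q ^ 2)).mul (hs2.pow 2)).const_sub 1) hD.ne'
      refine h.congr_deriv ?_
      have e1 := cn_sq q x
      have e2 := cn_sq q (a - x)
      have e3 := dn_sq hq0 hq1 x
      have e4 := dn_sq hq0 hq1 (a - x)
      rw [div_eq_zero_iff]
      left
      simp only [Pi.mul_apply, Pi.pow_apply, Pi.sub_apply]
      generalize sn q x = s at *
      generalize sn q (a - x) = s' at *
      generalize cn q x = c at *
      generalize cn q (a - x) = c' at *
      generalize dn q x = d at *
      generalize dn q (a - x) = d' at *
      clear h hs hc hd hs2 hc2 hd2 hD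
      grind
    exact is_const_of_deriv_eq_zero (fun x => (hd x).differentiableAt) fun x => (hd x).deriv
  have h := key (x + y) x 0
  simp only [add_sub_cancel_left, sub_zero, sn_zero hq0 hq1, cn_zero hq0 hq1] at h
  rw [h]; simp
lemma dn_add {q : ℝ} (hq0 : 0 ≤ q) (hq1 : q ≤ 1) (x y : ℝ) :
    dn q (x + y) = (dn q x * dn q y - q ^ 2 * sn q x * sn q y * cn q x * cn q y) /
      (1 - q ^ 2 * sn q x ^ 2 * sn q y ^ 2) := by
  have key : ∀ a u v : ℝ, (fun x => (dn q x * dn q (a - x) - q ^ 2 * sn q x * sn q (a - x) *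
      cn q x * cn q (a - x)) / (1 - q ^ 2 * sn q x ^ 2 * sn q (a - x) ^ 2)) u =
      (fun x => (dn q x * dn q (a - x) - q ^ 2 * sn q x * sn q (a - x) *
      cn q x * cn q (a - x)) / (1 - q ^ 2 * sn q x ^ 2 * sn q (a - x) ^ 2)) v := by
    intro a
    have hd : ∀ x, HasDerivAt (fun x => (dn q x * dn q (a - x) - q ^ 2 * sn q x * sn q (a - x) *
        cn q x * cn q (a - x)) / (1 - q ^ 2 * sn q x ^ 2 * sn q (a - x) ^ 2)) 0 x := by
      intro x
      have hs := hasDerivAt_sn hq0 hq1 x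
      have hc := hasDerivAt_cn hq0 hq1 x
      have hd := hasDerivAt_dn hq0 hq1 x
      have hs2 := (hasDerivAt_sn hq0 hq1 (a - x)).comp_const_sub a x
      have hc2 := (hasDerivAt_cn hq0 hq1 (a - x)).comp_const_sub a x
      have hd2 := (hasDerivAt_dn hq0 hq1 (a - x)).comp_const_sub a x
      have hD := addDenom_pos hq0 hq1 x (a - x)
      have h := ((hd.mul hd2).sub ((((hs.const_mul (q ^ 2)).mul hs2).mul hc).mul hc2)).div
        ((((hs.pow 2).const_mul (q ^ 2)).mul (hs2.pow 2)).const_sub 1) hD.ne'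
      refine h.congr_deriv ?_
      have e1 := cn_sq q x
      have e2 := cn_sq q (a - x)
      have e3 := dn_sq hq0 hq1 x
      have e4 := dn_sq hq0 hq1 (a - x)
      rw [div_eq_zero_iff]
      left
      simp only [Pi.mul_apply, Pi.pow_apply, Pi.sub_apply]
      generalize sn q x = s at *
      generalize sn q (a - x) = s' at *
      generalize cn q x = c at *
      generalize cn q (a - x) = c' at *
      generalize dn q x = d at *
      generalize dn q (a - x) = d' at *
      clear h hs hc hd hs2 hc2 hd2 hD
      grind
    exact is_const_of_deriv_eq_zero (fun x => (hd x).differentiableAt) fun x => (hd x).deriv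
  have h := key (x + y) x 0
  simp only [add_sub_cancel_left, sub_zero, sn_zero hq0 hq1, dn_zero hq0 hq1] at h
  rw [h]; simp

/-- The integrand has period `π`, so `ellipticF` gains a fixed amount over each period; oddness,
applied at `-π / 2`, shows that this amount is `2K`. -/
lemma am_add_two_quarterK {q : ℝ} (hq0 : 0 ≤ q) (hq1 : q < 1) (u : ℝ) :
    am q (u + 2 * quarterK q) = am q u + π := by
  have hint : ∀ a b : ℝ, IntervalIntegrable (fun θ : ℝ => 1 / √(1 - q ^ 2 * sin θ ^ 2))
      MeasureTheory.volume a b := fun a b =>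
    (continuous_ellipticF_integrand hq0 hq1).intervalIntegrable _ _
  have hper : Function.Periodic (fun θ : ℝ => 1 / √(1 - q ^ 2 * sin θ ^ 2)) π := by
    intro θ; simp [sin_add_pi]
  have hadd : ∀ φ, ellipticF q (φ + π) = ellipticF q φ + ellipticF q π := by
    intro φ
    have h := hper.intervalIntegral_add_eq φ 0
    rw [zero_add] at h
    rw [ellipticF, ellipticF, ellipticF, ← h,
      intervalIntegral.integral_add_adjacent_intervals (hint _ _) (hint _ _)]
  have hpi : ellipticF q π = 2 * quarterK q := by
    have h := hadd (-(π / 2))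
    rw [ellipticF_neg, show -(π / 2) + π = π / 2 by ring] at h
    rw [quarterK]; linarith
  apply (strictMono_ellipticF hq0 hq1).injective
  rw [ellipticF_am hq0 hq1, hadd, ellipticF_am hq0 hq1, hpi]

/-! ### The sum formula for the amplitude -/


/-- A planar curve `(a, b)` whose polar angle changes at the rate of `h`. -/
lemma sqrt_mul_cos_sin_eq {a b D h ρ η : ℝ → ℝ} (hD : ∀ x, D x = a x ^ 2 + b x ^ 2)
    (hpos : ∀ x, 0 < D x)
    (ha : ∀ x, HasDerivAt a (ρ x * a x - η x * b x) x)
    (hb : ∀ x, HasDerivAt b (ρ x * b x + η x * a x) x)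
    (hh : ∀ x, HasDerivAt h (η x) x) (ha0 : 0 < a 0) (hb0 : b 0 = 0) (hh0 : h 0 = 0) (x : ℝ) :
    √(D x) * cos (h x) = a x ∧ √(D x) * sin (h x) = b x := by
  have hsD : ∀ x, √(D x) ^ 2 = D x := fun x => sq_sqrt (hpos x).le
  have hder : ∀ x, HasDerivAt (fun x => √(D x)) (ρ x * √(D x)) x := by
    intro x
    have e : D = fun x => a x ^ 2 + b x ^ 2 := funext hD
    have h1 := (((ha x).pow 2).add ((hb x).pow 2)).sqrt
      (show (a ^ 2 + b ^ 2) x ≠ 0 by rw [Pi.add_apply, Pi.pow_apply, Pi.pow_apply, ← hD]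
                                     exact (hpos x).ne')
    have e2 : (fun x => √(D x)) = fun y => √((a ^ 2 + b ^ 2) y) := by
      funext y; rw [hD]; rfl
    rw [e2]
    refine h1.congr_deriv ?_
    have h2 := hsD x
    have h3 : √((a ^ 2 + b ^ 2) x) = √(D x) := by rw [hD]; rfl
    have h4 := (sqrt_pos.2 (hpos x)).ne'
    simp only [h3]
    field_simp
    rw [h2, hD]
    simp
    ring
  have hp := fun x => (sqrt_pos.2 (hpos x)).ne'
  -- This quotient and the next are the real and imaginary parts of `(a + i b) e^{-ih} / √D`. As `ρ`
  -- is the logarithmic derivative of `√D` and `η` the rate of rotation, both are constant, with the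
  -- values `1` and `0` at the origin.
  have hU : ∀ x, HasDerivAt (fun x => (a x * cos (h x) + b x * sin (h x)) / √(D x)) 0 x := by
    intro x
    refine ((((ha x).mul (hh x).cos).add ((hb x).mul (hh x).sin)).div (hder x)
      (hp x)).congr_deriv ?_
    rw [div_eq_zero_iff]
    left
    simp only [Pi.mul_apply, Pi.add_apply]
    ring
  have hV : ∀ x, HasDerivAt (fun x => (b x * cos (h x) - a x * sin (h x)) / √(D x)) 0 x := by
    intro x
    refine ((((hb x).mul (hh x).cos).sub ((ha x).mul (hh x).sin)).div (hder x)
      (hp x)).congr_deriv ?_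
    rw [div_eq_zero_iff]
    left
    simp only [Pi.mul_apply, Pi.sub_apply]
    ring
  have hU1 := is_const_of_deriv_eq_zero (fun x => (hU x).differentiableAt)
    (fun x => (hU x).deriv) x 0
  have hV1 := is_const_of_deriv_eq_zero (fun x => (hV x).differentiableAt)
    (fun x => (hV x).deriv) x 0
  have hD0 : √(D 0) = a 0 := by rw [hD, hb0]; simp [ha0.le]
  have ha0' := ha0.ne'
  simp only [hh0, hb0, hD0, cos_zero, sin_zero, mul_one, mul_zero, add_zero, sub_zero, zero_div,
    div_self ha0'] at hU1 hV1
  rw [div_eq_one_iff_eq (hp x)] at hU1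
  have hV2 := (div_eq_zero_iff.1 hV1).resolve_right (hp x)
  have hcs := sin_sq_add_cos_sq (h x)
  rw [← hU1]
  constructor
  · linear_combination (sin (h x)) * hV2 + a x * hcs
  · linear_combination (-cos (h x)) * hV2 + b x * hcs

/-- As `x` varies, the point `(cn x, sn x dn y)` has squared norm `D` and its polar angle turns at
the rate `dn x dn y / D`. By `dn_add` this is the derivative of the half sum of the amplitudes. For
a ring and its neighbor the polar angle is the part `h` of the opening angle, in the right triangle
with leg `r`. -/
lemma am_add_am_spec {q : ℝ} (hq0 : 0 ≤ q) (hq1 : q ≤ 1) (x y : ℝ) :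
    √(1 - q ^ 2 * sn q x ^ 2 * sn q y ^ 2) * cos ((am q (x + y) + am q (x - y)) / 2) = cn q x ∧
    √(1 - q ^ 2 * sn q x ^ 2 * sn q y ^ 2) * sin ((am q (x + y) + am q (x - y)) / 2) =
      sn q x * dn q y := by
  have e3 := dn_sq hq0 hq1 y
  refine sqrt_mul_cos_sin_eq (a := cn q) (b := fun x => sn q x * dn q y)
    (D := fun x => 1 - q ^ 2 * sn q x ^ 2 * sn q y ^ 2)
    (h := fun x => (am q (x + y) + am q (x - y)) / 2)
    (ρ := fun x => -(q ^ 2 * sn q y ^ 2 * sn q x * cn q x * dn q x) /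
      (1 - q ^ 2 * sn q x ^ 2 * sn q y ^ 2))
    (η := fun x => dn q x * dn q y / (1 - q ^ 2 * sn q x ^ 2 * sn q y ^ 2))
    (fun x => ?_) (fun x => addDenom_pos hq0 hq1 x y) (fun x => ?_) (fun x => ?_) (fun x => ?_)
    ?_ ?_ ?_ x
  · have e1 := cn_sq q x
    linear_combination -e1 - sn q x ^ 2 * e3
  · refine (hasDerivAt_cn hq0 hq1 x).congr_deriv ?_
    have hD := (addDenom_pos hq0 hq1 x y).ne'
    have e1 := cn_sq q x
    set E := 1 - q ^ 2 * sn q x ^ 2 * sn q y ^ 2 with hE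
    field_simp
    rw [hE]
    linear_combination (sn q x * dn q x) * (sn q y ^ 2 * q ^ 2 * e1 + e3)
  · refine ((hasDerivAt_sn hq0 hq1 x).mul_const _).congr_deriv ?_
    have hD := (addDenom_pos hq0 hq1 x y).ne'
    set E := 1 - q ^ 2 * sn q x ^ 2 * sn q y ^ 2 with hE
    field_simp
    rw [hE]
    ring
  · have h1 := (((hasDerivAt_am hq0 hq1 (x + y)).comp_add_const x y).add
      ((hasDerivAt_am hq0 hq1 (x - y)).comp_sub_const x y)).div_const 2
    refine h1.congr_deriv ?_
    rw [sub_eq_add_neg, dn_add hq0 hq1, dn_add hq0 hq1, sn_neg hq0 hq1, cn_neg hq0 hq1,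
      dn_neg hq0 hq1, neg_sq]
    have := (addDenom_pos hq0 hq1 x y).ne'
    field_simp
    ring
  · simp [cn_zero hq0 hq1]
  · simp [sn_zero hq0 hq1]
  · simp [am_neg hq0 hq1]

/-- The function `arcsin (q sn)`, a primitive of `q cn`. -/
def arcsinSn (q x : ℝ) : ℝ := arcsin (q * sn q x)

lemma hasDerivAt_arcsinSn {q : ℝ} (hq0 : 0 ≤ q) (hq1 : q ≤ 1) (x : ℝ) :
    HasDerivAt (arcsinSn q) (q * cn q x) x := by
  have h := dn_sq_pos hq0 hq1 x
  have h2 : (q * sn q x) ^ 2 < 1 := by rw [mul_pow]; linarith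
  have h3 := abs_lt.1 ((sq_lt_one_iff_abs_lt_one _).1 h2)
  have h4 := (hasDerivAt_arcsin h3.1.ne' h3.2.ne).comp x ((hasDerivAt_sn hq0 hq1 x).const_mul q)
  refine h4.congr_deriv ?_
  have h5 : √(1 - (q * sn q x) ^ 2) = dn q x := by rw [dn, mul_pow]
  have := (dn_pos hq0 hq1 x).ne'
  rw [h5]
  field_simp

lemma arcsinSn_neg {q : ℝ} (hq0 : 0 ≤ q) (hq1 : q ≤ 1) (x : ℝ) :
    arcsinSn q (-x) = -arcsinSn q x := by
  rw [arcsinSn, sn_neg hq0 hq1, mul_neg, arcsin_neg, arcsinSn]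

/-- The companion formula for the part `β` of the opening angle, in the right triangle with leg `R`:
the point `(dn x, q sn x cn y)` has the same squared norm and turns at the rate `q cn x cn y / D`,
which `cn_add` matches with the primitive of `q cn`. -/
lemma arcsinSn_add_arcsinSn_spec {q : ℝ} (hq0 : 0 ≤ q) (hq1 : q ≤ 1) (x y : ℝ) :
    √(1 - q ^ 2 * sn q x ^ 2 * sn q y ^ 2) *
      cos ((arcsinSn q (x + y) + arcsinSn q (x - y)) / 2) = dn q x ∧
    √(1 - q ^ 2 * sn q x ^ 2 * sn q y ^ 2) *
      sin ((arcsinSn q (x + y) + arcsinSn q (x - y)) / 2) = q * sn q x * cn q y := by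
  have e3 := cn_sq q y
  refine sqrt_mul_cos_sin_eq (a := dn q) (b := fun x => q * sn q x * cn q y)
    (D := fun x => 1 - q ^ 2 * sn q x ^ 2 * sn q y ^ 2)
    (h := fun x => (arcsinSn q (x + y) + arcsinSn q (x - y)) / 2)
    (ρ := fun x => -(q ^ 2 * sn q y ^ 2 * sn q x * cn q x * dn q x) /
      (1 - q ^ 2 * sn q x ^ 2 * sn q y ^ 2))
    (η := fun x => q * cn q x * cn q y / (1 - q ^ 2 * sn q x ^ 2 * sn q y ^ 2))
    (fun x => ?_) (fun x => addDenom_pos hq0 hq1 x y) (fun x => ?_) (fun x => ?_) (fun x => ?_)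
    ?_ ?_ ?_ x
  · have e1 := dn_sq hq0 hq1 x
    linear_combination -e1 - q ^ 2 * sn q x ^ 2 * e3
  · refine (hasDerivAt_dn hq0 hq1 x).congr_deriv ?_
    have hD := (addDenom_pos hq0 hq1 x y).ne'
    have e1 := dn_sq hq0 hq1 x
    set E := 1 - q ^ 2 * sn q x ^ 2 * sn q y ^ 2 with hE
    field_simp
    rw [hE]
    linear_combination (sn q x * cn q x * q ^ 2) * (sn q y ^ 2 * e1 + e3)
  · refine (((hasDerivAt_sn hq0 hq1 x).const_mul q).mul_const _).congr_deriv ?_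
    have hD := (addDenom_pos hq0 hq1 x y).ne'
    set E := 1 - q ^ 2 * sn q x ^ 2 * sn q y ^ 2 with hE
    field_simp
    rw [hE]
    ring
  · have h1 := (((hasDerivAt_arcsinSn hq0 hq1 (x + y)).comp_add_const x y).add
      ((hasDerivAt_arcsinSn hq0 hq1 (x - y)).comp_sub_const x y)).div_const 2
    refine h1.congr_deriv ?_
    rw [sub_eq_add_neg, cn_add hq0 hq1, cn_add hq0 hq1, sn_neg hq0 hq1, cn_neg hq0 hq1,
      dn_neg hq0 hq1, neg_sq]
    have := (addDenom_pos hq0 hq1 x y).ne'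
    field_simp
    ring
  · simp [dn_zero hq0 hq1]
  · simp [sn_zero hq0 hq1]
  · simp [arcsinSn_neg hq0 hq1]

end RingPattern
end
noncomputable section

namespace RingPattern

open Real

/-! ### The function `g` -/

/-- The function `f / (2π)` is continuous with integer values, hence constant. -/
lemma eq_zero_of_cos_eq_one {f : ℝ → ℝ} (hf : Continuous f) (h0 : f 0 = 0)
    (h : ∀ x, cos (f x) = 1) (x : ℝ) : f x = 0 := by
  choose n hn using fun x => (cos_eq_one_iff (f x)).1 (h x)
  have hc : Continuous fun x => ((n x : ℤ) : ℝ) := by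
    have : (fun x => ((n x : ℤ) : ℝ)) = fun x => f x / (2 * π) := by
      funext x
      rw [← hn x]
      field_simp
    rw [this]
    exact hf.div_const _
  have hn' : Continuous n := Int.isClosedEmbedding_coe_real.isInducing.continuous_iff.2 hc
  have h1 : n x = n 0 := PreconnectedSpace.constant inferInstance hn'
  rw [← hn x, h1, hn 0, h0]

/-! ### The imaginary half period and the closed form of `g`. -/

lemma compl_nonneg (q : ℝ) : 0 ≤ compl q := sqrt_nonneg _

lemma compl_lt_one {q : ℝ} (hq0 : 0 < q) : compl q < 1 := by
  rw [compl, sqrt_lt' one_pos]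
  nlinarith

lemma compl_sq {q : ℝ} (hq0 : 0 < q) (hq1 : q ≤ 1) : compl q ^ 2 = 1 - q ^ 2 :=
  sq_sqrt (by nlinarith)

lemma am_quarterK {q : ℝ} (hq0 : 0 ≤ q) (hq1 : q < 1) : am q (quarterK q) = π / 2 :=
  am_ellipticF hq0 hq1 _

lemma quarterK_pos {q : ℝ} (hq0 : 0 ≤ q) (hq1 : q < 1) : 0 < quarterK q :=
  lt_of_lt_of_le (by positivity) (le_ellipticF hq0 hq1 (by positivity))

/-- The values of the Jacobi functions of the complementary modulus at `K' / 2`. -/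
lemma jacobi_half_quarterK' {q : ℝ} (hq0 : 0 < q) (hq1 : q ≤ 1) :
    sn (compl q) (quarterK' q / 2) ^ 2 = 1 / (1 + q) ∧
    sn (compl q) (quarterK' q / 2) * cn (compl q) (quarterK' q / 2) =
      dn (compl q) (quarterK' q / 2) / (1 + q) := by
  have h0 := compl_nonneg q
  have h1 := compl_lt_one hq0
  set k := compl q with hk
  set u := quarterK' q / 2 with hu
  have hK : u + u = quarterK k := by rw [hu, quarterK']; ring
  have hKp := quarterK_pos h0 h1
  have hup : 0 < u := by linarith
  have ham0 : 0 < am k u := by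
    simpa [am_zero h0 h1.le] using strictMono_am h0 h1.le hup
  have ham1 : am k u < π / 2 := by
    rw [← am_quarterK h0 h1]
    exact strictMono_am h0 h1.le (by linarith)
  have hs : 0 < sn k u := sin_pos_of_pos_of_lt_pi ham0 (by linarith [pi_pos])
  have hc : 0 < cn k u := cos_pos_of_mem_Ioo ⟨by linarith [pi_pos], ham1⟩
  have hd := dn_pos h0 h1.le u
  -- Duplication from `K' / 2` to `K'`, where `cn` vanishes, gives `cn = sn dn` at the half period.
  -- With the quadratic relations this becomes the factored quadratic `e5` in `sn²`, whose second
  -- factor is positive because `sn² < 1`.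
  have hadd := cn_add h0 h1.le u u
  rw [hK, cn, am_quarterK h0 h1, cos_pi_div_two, eq_comm, div_eq_zero_iff] at hadd
  have e0 := hadd.resolve_right (addDenom_pos h0 h1.le u u).ne'
  have e1 := cn_sq k u
  have e2 := dn_sq h0 h1.le u
  have e3 : k ^ 2 = 1 - q ^ 2 := compl_sq hq0 hq1
  have e4 : cn k u = sn k u * dn k u := by
    have h2 : (cn k u) ^ 2 = (sn k u * dn k u) ^ 2 := by linear_combination e0
    exact (pow_left_inj₀ hc.le (mul_pos hs hd).le two_ne_zero).1 h2
  have e5 : (1 - (1 + q) * sn k u ^ 2) * (1 - (1 - q) * sn k u ^ 2) = 0 := by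
    rw [e4] at e1
    linear_combination -e1 + sn k u ^ 2 * e2 - sn k u ^ 4 * e3
  have hs1 : sn k u ^ 2 < 1 := by nlinarith
  have e6 : 1 - (1 - q) * sn k u ^ 2 ≠ 0 := by nlinarith
  have e7 := (mul_eq_zero.1 e5).resolve_right e6
  have e8 : sn k u ^ 2 = 1 / (1 + q) := by
    field_simp
    linarith
  refine ⟨e8, ?_⟩
  rw [e4, ← mul_assoc, ← sq, e8]
  ring

/-- The closed form of the function `g`. -/
def gClosed (q x : ℝ) : ℝ := (am q x + arcsinSn q x) / 2

/-- The two angles of `am_add_am_spec` and `arcsinSn_add_arcsinSn_spec` are added by multiplying the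
complex numbers `cn x + i sn x dn y` and `dn x + i q sn x cn y`, both of modulus `√D`. -/
lemma gClosed_add_add_gClosed_sub {q : ℝ} (hq0 : 0 ≤ q) (hq1 : q ≤ 1) (x y : ℝ) :
    (1 - q ^ 2 * sn q x ^ 2 * sn q y ^ 2) * cos (gClosed q (x + y) + gClosed q (x - y)) =
      cn q x * dn q x - q * sn q x ^ 2 * cn q y * dn q y ∧
    (1 - q ^ 2 * sn q x ^ 2 * sn q y ^ 2) * sin (gClosed q (x + y) + gClosed q (x - y)) =
      sn q x * (dn q x * dn q y + q * cn q x * cn q y) := by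
  have e : gClosed q (x + y) + gClosed q (x - y) = (am q (x + y) + am q (x - y)) / 2 +
      (arcsinSn q (x + y) + arcsinSn q (x - y)) / 2 := by
    rw [gClosed, gClosed]; ring
  obtain ⟨a1, a2⟩ := am_add_am_spec hq0 hq1 x y
  obtain ⟨b1, b2⟩ := arcsinSn_add_arcsinSn_spec hq0 hq1 x y
  have hD := sq_sqrt (addDenom_pos hq0 hq1 x y).le
  rw [e, cos_add, sin_add]
  set r := √(1 - q ^ 2 * sn q x ^ 2 * sn q y ^ 2)
  rw [← hD]
  constructor
  · rw [← a1, ← b1]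
    linear_combination (-(r * sin ((am q (x + y) + am q (x - y)) / 2))) * b2 -
      (q * sn q x * cn q y) * a2
  · have e1 : sn q x * (dn q x * dn q y + q * cn q x * cn q y) =
      (sn q x * dn q y) * dn q x + cn q x * (q * sn q x * cn q y) := by ring
    rw [e1, ← a1, ← b1, ← a2, ← b2]
    ring

lemma continuous_gClosed {q : ℝ} (hq0 : 0 ≤ q) (hq1 : q ≤ 1) : Continuous (gClosed q) := by
  have h : Continuous (arcsinSn q) :=
    continuous_iff_continuousAt.2 fun u => (hasDerivAt_arcsinSn hq0 hq1 u).continuousAt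
  exact ((continuous_am hq0 hq1).add h).div_const _

lemma gClosed_zero {q : ℝ} (hq0 : 0 ≤ q) (hq1 : q ≤ 1) : gClosed q 0 = 0 := by
  simp [gClosed, arcsinSn, am_zero hq0 hq1, sn_zero hq0 hq1]

/-- The sum formula with both arguments equal to `x / 2`: then `D = (1 - q s²)(1 + q s²)`, and the
first factor cancels on both sides. -/
lemma cos_sin_gClosed {q : ℝ} (hq0 : 0 ≤ q) (hq1 : q ≤ 1) (x : ℝ) :
    (1 + q * sn q (x / 2) ^ 2) * cos (gClosed q x) = cn q (x / 2) * dn q (x / 2) ∧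
    (1 + q * sn q (x / 2) ^ 2) * sin (gClosed q x) = (1 + q) * sn q (x / 2) := by
  obtain ⟨h1, h2⟩ := gClosed_add_add_gClosed_sub hq0 hq1 (x / 2) (x / 2)
  rw [add_halves, sub_self, gClosed_zero hq0 hq1, add_zero] at h1 h2
  have hD := addDenom_pos hq0 hq1 (x / 2) (x / 2)
  have e1 := cn_sq q (x / 2)
  have e2 := dn_sq hq0 hq1 (x / 2)
  set s := sn q (x / 2)
  have e3 : 1 - q ^ 2 * s ^ 2 * s ^ 2 = (1 - q * s ^ 2) * (1 + q * s ^ 2) := by ring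
  rw [e3] at h1 h2 hD
  have hp : 0 < 1 + q * s ^ 2 := by positivity
  have hm : 1 - q * s ^ 2 ≠ 0 := ((pos_iff_pos_of_mul_pos hD).2 hp).ne'
  constructor
  · apply mul_left_cancel₀ hm
    linear_combination h1
  · apply mul_left_cancel₀ hm
    linear_combination h2 + s * e2 + q * s * e1

/-- On the line with imaginary part `K' / 2` the modulus of `sn` does not depend on the real part.
The factor `1 + q sn²` of the denominator is precisely the one that normalizes the phase in
`cos_sin_gClosed`. -/
lemma snC_eq {q : ℝ} (hq0 : 0 < q) (hq1 : q ≤ 1) (x : ℝ) :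
    snC q ((x + quarterK' q * Complex.I) / 2) =
      ((dn (compl q) (quarterK' q / 2) / q : ℝ) : ℂ) *
        Complex.exp (((π / 2 - gClosed q x : ℝ) : ℂ) * Complex.I) := by
  have hz : ((x : ℂ) + quarterK' q * Complex.I) / 2 = ⟨x / 2, quarterK' q / 2⟩ := by
    apply Complex.ext <;> simp
  obtain ⟨j1, j2⟩ := jacobi_half_quarterK' hq0 hq1
  obtain ⟨g1, g2⟩ := cos_sin_gClosed hq0.le hq1 x
  have e1 := cn_sq (compl q) (quarterK' q / 2)
  rw [Complex.exp_mul_I, ← Complex.ofReal_cos, ← Complex.ofReal_sin, cos_pi_div_two_sub,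
    sin_pi_div_two_sub, hz, snC]
  simp only
  rw [e1, j1, mul_assoc _ (sn (compl q) _) (cn (compl q) _), j2]
  set s := sn q (x / 2)
  set δ := dn (compl q) (quarterK' q / 2)
  have hp : 0 < 1 + q * s ^ 2 := by positivity
  have hp' : 0 < 1 + q := by positivity
  have hD : 1 - 1 / (1 + q) + q ^ 2 * s ^ 2 * (1 / (1 + q)) = q * (1 + q * s ^ 2) / (1 + q) := by
    field_simp
    ring
  have hD0 : (((q * (1 + q * s ^ 2) / (1 + q) : ℝ)) : ℂ) ≠ 0 :=
    Complex.ofReal_ne_zero.2 (by positivity)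
  rw [hD, div_eq_iff hD0]
  have r1 : s * δ = δ / q * sin (gClosed q x) * (q * (1 + q * s ^ 2) / (1 + q)) := by
    field_simp
    linear_combination -δ * g2
  have r2 : cn q (x / 2) * dn q (x / 2) * (δ / (1 + q)) =
      δ / q * cos (gClosed q x) * (q * (1 + q * s ^ 2) / (1 + q)) := by
    field_simp
    linear_combination -δ * g1
  rw [r1, r2]
  push_cast
  ring

/-- The closed form is a continuous branch, so the choice in the definition of `gFun` is not the
default one. Two branches differ by a continuous function that vanishes at `0` and takes values in
`2πℤ`. -/
lemma gFun_eq {q : ℝ} (hq0 : 0 < q) (hq1 : q ≤ 1) (x : ℝ) : gFun q x = gClosed q x := by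
  have hδ : 0 < dn (compl q) (quarterK' q / 2) / q :=
    div_pos (dn_pos (compl_nonneg q) (compl_lt_one hq0).le _) hq0
  have hnorm : ∀ x : ℝ, ‖snC q ((x + quarterK' q * Complex.I) / 2)‖ =
      dn (compl q) (quarterK' q / 2) / q := by
    intro x
    rw [snC_eq hq0 hq1, norm_mul, Complex.norm_exp_ofReal_mul_I, mul_one, Complex.norm_real,
      norm_of_nonneg hδ.le]
  have hex : ∃ g, IsArgBranch q g := by
    refine ⟨gClosed q, continuous_gClosed hq0.le hq1, gClosed_zero hq0.le hq1, fun x => ?_⟩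
    rw [hnorm x, ← snC_eq hq0 hq1]
  obtain ⟨c1, c2, c3⟩ := hex.choose_spec
  have hg : gFun q = hex.choose := dif_pos hex
  rw [← hg] at c1 c2 c3
  have h := eq_zero_of_cos_eq_one (f := fun x => gFun q x - gClosed q x)
    (c1.sub (continuous_gClosed hq0.le hq1)) (by simp [c2, gClosed_zero hq0.le hq1])
    (fun x => ?_) x
  · linarith
  · have h1 := c3 x
    rw [hnorm x, snC_eq hq0 hq1] at h1
    have h2 := mul_left_cancel₀ (Complex.ofReal_ne_zero.2 hδ.ne') h1
    have h3 : Complex.exp (((gFun q x - gClosed q x : ℝ) : ℂ) * Complex.I) = 1 := by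
      have : (((gFun q x - gClosed q x : ℝ) : ℂ) * Complex.I) =
          ((π / 2 - gClosed q x : ℝ) : ℂ) * Complex.I -
            ((π / 2 - gFun q x : ℝ) : ℂ) * Complex.I := by push_cast; ring
      rw [this, Complex.exp_sub, h2, div_self (Complex.exp_ne_zero _)]
    have h4 := congrArg Complex.re h3
    rwa [Complex.exp_ofReal_mul_I_re, Complex.one_re] at h4

/-! ### Uniformizing variables -/

lemma am_mem_of_mem_gammaInterval {q γ : ℝ} (hq0 : 0 ≤ q) (hq1 : q ≤ 1)
    (hγ : γ ∈ gammaInterval q) : 0 ≤ am q γ ∧ am q γ ≤ π := by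
  have hm := (strictMono_am hq0 hq1).monotone
  refine ⟨by simpa [am_zero hq0 hq1] using hm hγ.1, ?_⟩
  rcases hq1.lt_or_eq with h | rfl
  · have h1 := hm (hγ.2 h)
    have h2 := am_add_two_quarterK hq0 h 0
    rw [zero_add, am_zero hq0 hq1, zero_add] at h2
    rwa [h2] at h1
  · rw [am_one]
    linarith [arcsin_le_pi_div_two (tanh γ), pi_pos]

lemma sn_nonneg_of_mem {q γ : ℝ} (hq0 : 0 ≤ q) (hq1 : q ≤ 1) (hγ : γ ∈ gammaInterval q) :
    0 ≤ sn q γ := by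
  obtain ⟨h1, h2⟩ := am_mem_of_mem_gammaInterval hq0 hq1 hγ
  exact sin_nonneg_of_nonneg_of_le_pi h1 h2

/-! ### The range of the nominal angle. -/

lemma cn_one_pos (x : ℝ) : 0 < cn 1 x := by
  have h1 : 0 ≤ cn 1 x := by rw [cn, am_one]; exact cos_arcsin_nonneg _
  have h2 := dn_sq_pos zero_le_one le_rfl x
  have h3 := cn_sq 1 x
  rcases h1.lt_or_eq with h | h
  · exact h
  · rw [← h] at h3; nlinarith

/-- Since `dn² - q cn² = (1 - q)(1 + q sn²)`, the first product dominates strictly for `q < 1`. For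
`q = 1` this difference vanishes, and positivity of `cn` is used instead. -/
lemma dn_mul_dn_add_pos {q : ℝ} (hq0 : 0 ≤ q) (hq1 : q ≤ 1) (x y : ℝ) :
    0 < dn q x * dn q y + q * cn q x * cn q y := by
  rcases hq1.lt_or_eq with h | rfl
  · have key : ∀ x, q * cn q x ^ 2 < dn q x ^ 2 := by
      intro x
      rw [dn_sq hq0 hq1, cn_sq]
      have : 0 ≤ q * sn q x ^ 2 := by positivity
      nlinarith
    have h1 : (q * cn q x * cn q y) ^ 2 < (dn q x * dn q y) ^ 2 := by
      have : (q * cn q x * cn q y) ^ 2 = (q * cn q x ^ 2) * (q * cn q y ^ 2) := by ring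
      rw [this, mul_pow]
      exact mul_lt_mul'' (key x) (key y) (by positivity) (by positivity)
    have h2 := abs_lt_of_sq_lt_sq h1 (mul_pos (dn_pos hq0 hq1 x) (dn_pos hq0 hq1 y)).le
    linarith [(abs_lt.1 h2).1]
  · have := mul_pos (dn_pos hq0 hq1 x) (dn_pos hq0 hq1 y)
    have := mul_pos (cn_one_pos x) (cn_one_pos y)
    linarith

/-- The nominal angle `g (γ + γ') + g (γ - γ')` of the ring `γ` at the neighboring ring `γ'`. -/
def nominalAngle (q γ γ' : ℝ) : ℝ := gFun q (γ + γ') + gFun q (γ - γ')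

lemma nominalAngle_spec {q : ℝ} (hq0 : 0 < q) (hq1 : q ≤ 1) (x y : ℝ) :
    (1 - q ^ 2 * sn q x ^ 2 * sn q y ^ 2) * cos (nominalAngle q x y) =
      cn q x * dn q x - q * sn q x ^ 2 * cn q y * dn q y ∧
    (1 - q ^ 2 * sn q x ^ 2 * sn q y ^ 2) * sin (nominalAngle q x y) =
      sn q x * (dn q x * dn q y + q * cn q x * cn q y) := by
  rw [nominalAngle, gFun_eq hq0 hq1, gFun_eq hq0 hq1]
  exact gClosed_add_add_gClosed_sub hq0.le hq1 x y

/-- Sine and cosine leave the nominal angle undetermined modulo `2π`; this splitting fixes the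
branch. The bounds on `h` hold because the amplitude is increasing and odd and gains `π` over `2K`,
those on `β` because it is a mean of two arcsines. -/
lemma nominalAngle_mem_aux {q γ : ℝ} (hq0 : 0 < q) (hq1 : q ≤ 1) (hγ : γ ∈ gammaInterval q)
    (y : ℝ) : ∃ h β, nominalAngle q γ y = h + β ∧ 0 ≤ h ∧ h ≤ π ∧ -(π / 2) ≤ β ∧ β ≤ π / 2 ∧
      √(1 - q ^ 2 * sn q γ ^ 2 * sn q y ^ 2) * cos h = cn q γ ∧
      √(1 - q ^ 2 * sn q γ ^ 2 * sn q y ^ 2) * sin β = q * sn q γ * cn q y := by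
  refine ⟨(am q (γ + y) + am q (γ - y)) / 2, (arcsinSn q (γ + y) + arcsinSn q (γ - y)) / 2,
    ?_, ?_, ?_, ?_, ?_, (am_add_am_spec hq0.le hq1 γ y).1,
    (arcsinSn_add_arcsinSn_spec hq0.le hq1 γ y).2⟩
  · rw [nominalAngle, gFun_eq hq0 hq1, gFun_eq hq0 hq1, gClosed, gClosed]; ring
  · have hm := (strictMono_am hq0.le hq1).monotone
    have h1 := hm (show -y ≤ γ - y by linarith [hγ.1])
    have h2 := hm (show y ≤ γ + y by linarith [hγ.1])
    rw [am_neg hq0.le hq1] at h1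
    linarith
  · rcases hq1.lt_or_eq with h | rfl
    · have hm := (strictMono_am hq0.le hq1).monotone
      have h1 := hm (show γ - y ≤ -y + 2 * quarterK q by linarith [hγ.2 h])
      have h2 := hm (show γ + y ≤ y + 2 * quarterK q by linarith [hγ.2 h])
      rw [am_add_two_quarterK hq0.le h] at h1 h2
      rw [am_neg hq0.le hq1] at h1
      linarith
    · rw [am_one, am_one]
      linarith [arcsin_le_pi_div_two (tanh (γ + y)), arcsin_le_pi_div_two (tanh (γ - y)), pi_pos]
  · have h1 : -(π / 2) ≤ arcsinSn q (γ + y) := neg_pi_div_two_le_arcsin _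
    have h2 : -(π / 2) ≤ arcsinSn q (γ - y) := neg_pi_div_two_le_arcsin _
    linarith
  · have h1 : arcsinSn q (γ + y) ≤ π / 2 := arcsin_le_pi_div_two _
    have h2 : arcsinSn q (γ - y) ≤ π / 2 := arcsin_le_pi_div_two _
    linarith

/-- The sine is positive, and `h + β` lies in `[-π / 2, 3π / 2]`; only `(0, π)` satisfies both. -/
lemma nominalAngle_mem_Ioo {q γ : ℝ} (hq0 : 0 < q) (hq1 : q ≤ 1) (hγ : γ ∈ gammaInterval q)
    (hs : 0 < sn q γ) (y : ℝ) : 0 < nominalAngle q γ y ∧ nominalAngle q γ y < π := by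
  have h1 := (nominalAngle_spec hq0 hq1 γ y).2
  have h2 : 0 < sin (nominalAngle q γ y) := by
    have h3 := mul_pos hs (dn_mul_dn_add_pos hq0.le hq1 γ y)
    rw [← h1] at h3
    exact (pos_iff_pos_of_mul_pos h3).1 (addDenom_pos hq0.le hq1 γ y)
  obtain ⟨h, β, e, a1, a2, b1, b2, -⟩ := nominalAngle_mem_aux hq0 hq1 hγ y
  constructor
  · by_contra! hn
    exact absurd (sin_nonpos_of_nonpos_of_neg_pi_le hn (by linarith [pi_pos])) (not_le.2 h2)
  · by_contra! hn
    have h4 : 0 ≤ sin (nominalAngle q γ y - π) :=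
      sin_nonneg_of_nonneg_of_le_pi (by linarith) (by linarith [pi_pos])
    rw [sin_sub_pi] at h4
    linarith

/-- At an ideal center `D = 1`, so `β = 0` and `cos h = ±1`. The value `π` for `r = -∞`, against an
opening angle `0`, is the same shift by `π` as for finite negative radii. -/
lemma nominalAngle_of_sn_eq_zero {q γ : ℝ} (hq0 : 0 < q) (hq1 : q ≤ 1)
    (hγ : γ ∈ gammaInterval q) (hs : sn q γ = 0) (y : ℝ) :
    (cn q γ = 1 → nominalAngle q γ y = 0) ∧ (cn q γ = -1 → nominalAngle q γ y = π) := by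
  obtain ⟨h, β, e, a1, a2, b1, b2, c1, c2⟩ := nominalAngle_mem_aux hq0 hq1 hγ y
  rw [hs] at c1 c2
  norm_num at c1 c2
  have hβ : β = 0 := (sin_eq_zero_iff_of_lt_of_lt (by linarith [pi_pos]) (by linarith [pi_pos])).1 c2
  rw [e, hβ, add_zero]
  constructor
  · intro hc
    rw [hc, ← cos_zero] at c1
    exact injOn_cos ⟨a1, a2⟩ ⟨le_rfl, pi_pos.le⟩ c1
  · intro hc
    rw [hc, ← cos_pi] at c1
    exact injOn_cos ⟨a1, a2⟩ ⟨pi_pos.le, le_rfl⟩ c1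

/-- Every amplitude in `[0, π]` (in `[0, π / 2)`, if `q = 1`) belongs to some `γ ∈ [0, 2K]`. -/
lemma exists_am_eq {q φ : ℝ} (hq0 : 0 ≤ q) (hq1 : q ≤ 1) (h0 : 0 ≤ φ) (hπ : φ ≤ π)
    (h1 : q = 1 → φ < π / 2) : ∃ γ ∈ gammaInterval q, am q γ = φ := by
  rcases hq1.lt_or_eq with h | rfl
  · have hm := strictMono_ellipticF hq0 h
    refine ⟨ellipticF q φ, ⟨?_, fun _ => ?_⟩, am_ellipticF hq0 h φ⟩
    · simpa [ellipticF_zero] using hm.monotone h0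
    · have h2 := am_add_two_quarterK hq0 h 0
      rw [zero_add, am_zero hq0 hq1, zero_add] at h2
      rw [← ellipticF_am hq0 h (2 * quarterK q), h2]
      exact hm.monotone hπ
  · have h2 := h1 rfl
    have hs1 : sin φ < 1 := by
      rw [← sin_pi_div_two]
      exact strictMonoOn_sin ⟨by linarith [pi_pos], h2.le⟩ ⟨by linarith [pi_pos], le_rfl⟩ h2
    have hs0 := sin_nonneg_of_nonneg_of_le_pi h0 hπ
    refine ⟨artanh (sin φ), ⟨artanh_nonneg hs0, fun h => absurd h (lt_irrefl _)⟩, ?_⟩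
    rw [am_one, tanh_artanh ⟨by linarith, hs1⟩, arcsin_sin (by linarith [pi_pos]) h2.le]

end RingPattern
end
noncomputable section

namespace RingPattern

open Real

/-! ### Minkowski geometry -/

lemma det3_eq (x y z : Mink) : det3 x y z =
    x 0 * y 1 * z 2 - x 0 * y 2 * z 1 - x 1 * y 0 * z 2 + x 1 * y 2 * z 0 + x 2 * y 0 * z 1 -
      x 2 * y 1 * z 0 := by
  simp [det3, Matrix.det_fin_three]

lemma mink_comm (x y : Mink) : mink x y = mink y x := by simp only [mink]; ring

lemma mink_smul_left (a : ℝ) (x y : Mink) : mink (a • x) y = a * mink x y := by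
  simp [mink]; ring

lemma mink_smul_right (a : ℝ) (x y : Mink) : mink x (a • y) = a * mink x y := by
  simp [mink]; ring

lemma mink_add_left (x y z : Mink) : mink (x + y) z = mink x z + mink y z := by
  simp [mink]; ring

lemma mink_add_right (x y z : Mink) : mink x (y + z) = mink x y + mink x z := by
  simp [mink]; ring

lemma det3_smul_left (a : ℝ) (x y z : Mink) : det3 (a • x) y z = a * det3 x y z := by
  simp [det3_eq]; ring

/-- The Gram determinant of two triples, one of which is `(k, k', x)` and the other
`(k, k', y)`. -/
lemma gram_det3 (k k' x y : Mink) : det3 k k' x * det3 k k' y =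
    (mink k k' ^ 2 - mink k k * mink k' k') * mink x y -
      (mink k k' * mink x k' - mink k' k' * mink x k) * mink k y -
      (mink k k' * mink x k - mink k k * mink x k') * mink k' y := by
  simp only [det3_eq, mink]; ring

/-- Here `det3 k k' x` measures the height of `x` over the line of centers. The identity recovers
the orientation of `k`, `x`, `y` from these heights and from products with the centers. -/
lemma det3_expand (k k' x y : Mink) :
    (mink k k' ^ 2 - mink k k * mink k' k') * det3 k x y =
      (mink k k' * mink x k - mink k k * mink x k') * det3 k k' y -
        (mink k k' * mink y k - mink k k * mink y k') * det3 k k' x := by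
  simp only [det3_eq, mink]; ring

/-! ### Signs, and the quadrilateral of two neighboring rings. -/

lemma eq_mul_of_sign {e c A : ℝ} (he : e ^ 2 = c ^ 2) (hA : 0 ≤ A)
    (h : sign (e * A) = sign c) : e = c := by
  rcases lt_trichotomy c 0 with hc | rfl | hc
  · rw [sign_of_neg hc] at h
    have h1 : e * A < 0 := by
      by_contra! hn
      rcases hn.lt_or_eq with h2 | h2
      · rw [sign_of_pos h2] at h; norm_num at h
      · rw [← h2, sign_zero] at h; norm_num at h
    rcases sq_eq_sq_iff_eq_or_eq_neg.1 he with h2 | h2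
    · exact h2
    · rw [h2] at h1; nlinarith
  · simpa using he
  · rw [sign_of_pos hc] at h
    have h1 : 0 < e * A := by
      by_contra! hn
      rcases hn.lt_or_eq with h2 | h2
      · rw [sign_of_neg h2] at h; norm_num at h
      · rw [h2, sign_zero] at h; norm_num at h
    rcases sq_eq_sq_iff_eq_or_eq_neg.1 he with h2 | h2
    · exact h2
    · rw [h2] at h1; nlinarith

lemma sign_mul_of_pos {a b : ℝ} (ha : 0 < a) : sign (a * b) = sign b := by
  rcases lt_trichotomy b 0 with hb | rfl | hb
  · rw [sign_of_neg hb, sign_of_neg (mul_neg_of_pos_of_neg ha hb)]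
  · simp
  · rw [sign_of_pos hb, sign_of_pos (mul_pos ha hb)]

/-- The data of two neighboring rings with the variables `γ`, `γ'`, in terms of their centers
`k`, `k'`, scaled such that the inner circles have level `1` and the outer circles `1 / q`, and
of their common points `p`, `p'`; `η` is the orientation of the quadrilateral. -/
structure IsQuad (q γ γ' η : ℝ) (k k' p p' : Mink) : Prop where
  kk : mink k k = -sn q γ ^ 2
  kk' : mink k' k' = -sn q γ' ^ 2
  cross : mink k k' = -(1 / q)
  pk : mink p k = -1
  pk' : mink p k' = -(1 / q)
  pk2 : mink p' k = -(1 / q)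
  pk2' : mink p' k' = -1
  pp : mink p p = -1
  pp' : mink p' p' = -1
  eta : η ^ 2 = 1
  sign : sign (η * det3 k p p') = sign (cn q γ)
  sign' : Real.sign (η * det3 k' p' p) = Real.sign (cn q γ')

lemma IsQuad.symm {q γ γ' η : ℝ} {k k' p p' : Mink} (h : IsQuad q γ γ' η k k' p p') :
    IsQuad q γ' γ η k' k p' p :=
  ⟨h.kk', h.kk, by rw [mink_comm]; exact h.cross, h.pk2', h.pk2, h.pk', h.pk, h.pp', h.pp, h.eta,
    h.sign', h.sign⟩

/-- The Gram determinant of the two centers and `p` factors as `cn² γ dn² γ' / q²`. It yields the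
height of `p` over the line of centers up to a sign. -/
lemma IsQuad.det_sq {q γ γ' η : ℝ} {k k' p p' : Mink} (h : IsQuad q γ γ' η k k' p p')
    (hq0 : 0 < q) (hq1 : q ≤ 1) :
    (-(q * η * det3 k k' p / dn q γ')) ^ 2 = cn q γ ^ 2 := by
  have h1 := gram_det3 k k' p p
  rw [mink_comm k p, mink_comm k' p, h.kk, h.kk', h.cross, h.pk, h.pk', h.pp] at h1
  have e1 := cn_sq q γ
  have e2 := dn_sq hq0.le hq1 γ'
  have hd := (dn_pos hq0.le hq1 γ').ne'
  have h3 := h.eta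
  rw [neg_sq, div_pow, div_eq_iff (by positivity), mul_pow, mul_pow, h3, sq (det3 k k' p), h1, e1,
    e2]
  field_simp
  ring

/-- Write the two heights through `e1 = ± cn γ` and `e2 = ± cn γ'`. By `det3_expand`, the oriented
triangle at `k` is `e1` times a nonnegative factor, and the one at `k'` is `e2` times such a factor.
The orientation conditions therefore select both signs. -/
lemma IsQuad.dets {q γ γ' η : ℝ} {k k' p p' : Mink} (h : IsQuad q γ γ' η k k' p p')
    (hq0 : 0 < q) (hq1 : q ≤ 1) :
    η * det3 k k' p = -(cn q γ * dn q γ' / q) ∧ η * det3 k k' p' = cn q γ' * dn q γ / q := by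
  have hD := addDenom_pos hq0.le hq1 γ γ'
  have hd := dn_pos hq0.le hq1 γ
  have hd' := dn_pos hq0.le hq1 γ'
  have swap : ∀ x, det3 k' k x = -det3 k k' x := fun x => by simp only [det3_eq]; ring
  set e1 := -(q * η * det3 k k' p / dn q γ') with he1
  set e2 := -(q * η * det3 k' k p' / dn q γ) with he2
  have s1 : e1 ^ 2 = cn q γ ^ 2 := h.det_sq hq0 hq1
  have s2 : e2 ^ 2 = cn q γ' ^ 2 := h.symm.det_sq hq0 hq1
  have f1 : η * det3 k k' p = -(e1 * dn q γ' / q) := by rw [he1]; field_simp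
  have f2 : η * det3 k k' p' = e2 * dn q γ / q := by rw [he2, swap]; field_simp
  have c1 := cn_sq q γ
  have c2 := cn_sq q γ'
  have c3 := dn_sq hq0.le hq1 γ
  have c4 := dn_sq hq0.le hq1 γ'
  have x1 := det3_expand k k' p p'
  rw [h.kk, h.kk', h.cross, h.pk, h.pk', h.pk2, h.pk2'] at x1
  have x2 := det3_expand k' k p' p
  rw [mink_comm k' k, h.kk, h.kk', h.cross, h.pk, h.pk', h.pk2, h.pk2', swap, swap] at x2
  have y1 : (q * (1 - q ^ 2 * sn q γ ^ 2 * sn q γ' ^ 2)) * (η * det3 k p p') =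
      dn q γ * (e1 * (dn q γ * dn q γ' + q * e1 * e2)) := by
    have : q * (1 - q ^ 2 * sn q γ ^ 2 * sn q γ' ^ 2) * (η * det3 k p p') =
        q ^ 3 * (η * (((-(1 / q)) ^ 2 - -sn q γ ^ 2 * -sn q γ' ^ 2) * det3 k p p')) := by
      field_simp
    rw [this, x1]
    have : q ^ 3 * (η * ((-(1 / q) * -1 - -sn q γ ^ 2 * -(1 / q)) * det3 k k' p' -
        (-(1 / q) * -(1 / q) - -sn q γ ^ 2 * -1) * det3 k k' p)) =
        q ^ 2 * (1 - sn q γ ^ 2) * (η * det3 k k' p') -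
          q * (1 - q ^ 2 * sn q γ ^ 2) * (η * det3 k k' p) := by
      field_simp
    rw [this, f1, f2, ← c1, ← c3, ← s1]
    field_simp
    ring
  have y2 : (q * (1 - q ^ 2 * sn q γ ^ 2 * sn q γ' ^ 2)) * (η * det3 k' p' p) =
      dn q γ' * (e2 * (dn q γ * dn q γ' + q * e1 * e2)) := by
    have : q * (1 - q ^ 2 * sn q γ ^ 2 * sn q γ' ^ 2) * (η * det3 k' p' p) =
        q ^ 3 * (η * (((-(1 / q)) ^ 2 - -sn q γ' ^ 2 * -sn q γ ^ 2) * det3 k' p' p)) := by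
      field_simp
    rw [this, x2]
    have : q ^ 3 * (η * ((-(1 / q) * -1 - -sn q γ' ^ 2 * -(1 / q)) * -det3 k k' p -
        (-(1 / q) * -(1 / q) - -sn q γ' ^ 2 * -1) * -det3 k k' p')) =
        -(q ^ 2 * (1 - sn q γ' ^ 2) * (η * det3 k k' p)) +
          q * (1 - q ^ 2 * sn q γ' ^ 2) * (η * det3 k k' p') := by
      field_simp
      ring
    rw [this, f1, f2, ← c2, ← c4, ← s2]
    field_simp
    ring
  -- Only the squares of `e1` and `e2` are known at this point, so just the weak inequality is
  -- available; it suffices for `eq_mul_of_sign`.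
  have hA : 0 ≤ dn q γ * dn q γ' + q * e1 * e2 := by
    have key : ∀ x, q * cn q x ^ 2 ≤ dn q x ^ 2 := by
      intro x
      rw [dn_sq hq0.le hq1, cn_sq]
      have : 0 ≤ q * sn q x ^ 2 := by positivity
      nlinarith
    have h1 : (q * e1 * e2) ^ 2 ≤ (dn q γ * dn q γ') ^ 2 := by
      have : (q * e1 * e2) ^ 2 = (q * cn q γ ^ 2) * (q * cn q γ' ^ 2) := by
        rw [← s1, ← s2]; ring
      rw [this, mul_pow]
      exact mul_le_mul (key γ) (key γ') (by positivity) (by positivity)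
    have h2 := abs_le_of_sq_le_sq h1 (mul_pos hd hd').le
    linarith [(abs_le.1 h2).1]
  have t1 : e1 = cn q γ := by
    apply eq_mul_of_sign s1 hA
    have z := sign_mul_of_pos (b := η * det3 k p p') (mul_pos hq0 hD)
    rwa [y1, sign_mul_of_pos hd, h.sign] at z
  have t2 : e2 = cn q γ' := by
    apply eq_mul_of_sign s2 hA
    have z := sign_mul_of_pos (b := η * det3 k' p' p) (mul_pos hq0 hD)
    rwa [y2, sign_mul_of_pos hd', h.sign'] at z
  rw [f1, f2, t1, t2]
  exact ⟨rfl, rfl⟩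

/-- The angle at the center of the ring `γ` is, up to the orientation, the nominal angle. -/
lemma IsQuad.angle {q γ γ' η : ℝ} {k k' p p' : Mink} (h : IsQuad q γ γ' η k k' p p')
    (hq0 : 0 < q) (hq1 : q ≤ 1) :
    sn q γ ^ 2 * mink p p' + mink p k * mink p' k =
      cn q γ * dn q γ / q * cos (nominalAngle q γ γ') ∧
    sn q γ * det3 k p p' = η * (cn q γ * dn q γ / q * sin (nominalAngle q γ γ')) := by
  obtain ⟨n1, n2⟩ := nominalAngle_spec hq0 hq1 γ γ'
  obtain ⟨d1, d2⟩ := h.dets hq0 hq1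
  have hD := (addDenom_pos hq0.le hq1 γ γ').ne'
  have c1 := cn_sq q γ
  have c3 := dn_sq hq0.le hq1 γ
  have c4 := dn_sq hq0.le hq1 γ'
  have hη := h.eta
  have x1 := det3_expand k k' p p'
  have x2 := gram_det3 k k' p p'
  rw [h.kk, h.kk', h.cross, h.pk, h.pk', h.pk2, h.pk2'] at x1
  rw [mink_comm k p', mink_comm k' p', h.kk, h.kk', h.cross, h.pk, h.pk', h.pk2, h.pk2'] at x2
  have x3 : det3 k k' p * det3 k k' p' = -(cn q γ * dn q γ' / q) * (cn q γ' * dn q γ / q) := by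
    rw [← d1, ← d2]; linear_combination (-(det3 k k' p * det3 k k' p')) * hη
  rw [x3] at x2
  constructor
  · apply mul_left_cancel₀ hD
    have : (1 - q ^ 2 * sn q γ ^ 2 * sn q γ' ^ 2) * (cn q γ * dn q γ / q *
        cos (nominalAngle q γ γ')) = cn q γ * dn q γ / q * ((1 - q ^ 2 * sn q γ ^ 2 *
          sn q γ' ^ 2) * cos (nominalAngle q γ γ')) := by ring
    rw [this, n1, h.pk, h.pk2]
    field_simp at x2 ⊢
    linear_combination -sn q γ ^ 2 * x2 - dn q γ ^ 2 * c1 - (1 - sn q γ ^ 2) * c3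
  · apply mul_left_cancel₀ hD
    have : (1 - q ^ 2 * sn q γ ^ 2 * sn q γ' ^ 2) * (η * (cn q γ * dn q γ / q *
        sin (nominalAngle q γ γ'))) = η * (cn q γ * dn q γ / q * ((1 - q ^ 2 * sn q γ ^ 2 *
          sn q γ' ^ 2) * sin (nominalAngle q γ γ'))) := by ring
    rw [this, n2]
    have d1' : det3 k k' p = -η * (cn q γ * dn q γ' / q) := by
      linear_combination η * d1 - det3 k k' p * hη
    have d2' : det3 k k' p' = η * (cn q γ' * dn q γ / q) := by
      linear_combination η * d2 - det3 k k' p' * hη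
    rw [d1', d2'] at x1
    have : (1 - q ^ 2 * sn q γ ^ 2 * sn q γ' ^ 2) * (sn q γ * det3 k p p') =
        sn q γ * q ^ 2 * (((-(1 / q)) ^ 2 - -sn q γ ^ 2 * -sn q γ' ^ 2) * det3 k p p') := by
      field_simp
    have e : sn q γ * q ^ 2 * ((-(1 / q) * -1 - -sn q γ ^ 2 * -(1 / q)) *
        (η * (cn q γ' * dn q γ / q)) - (-(1 / q) * -(1 / q) - -sn q γ ^ 2 * -1) *
        (-η * (cn q γ * dn q γ' / q))) = sn q γ * η * ((1 - sn q γ ^ 2) * cn q γ' * dn q γ +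
          (1 - q ^ 2 * sn q γ ^ 2) * cn q γ * dn q γ' / q) := by
      field_simp
      ring
    rw [this, x1, e, ← c1, ← c3]
    field_simp
    ring

end RingPattern
end
noncomputable section

namespace RingPattern

open Real

/-! ### Combinatorics of the squares at a vertex -/

lemma nbr_neg (v : ℤ × ℤ) (d : ℤˣ × ℤˣ) : nbr (nbr v d) (-d) = v := by
  ext <;> simp [nbr]

lemma horNbr_nbr_neg (v : ℤ × ℤ) (d : ℤˣ × ℤˣ) : horNbr (nbr v d) (-d) = verNbr v d := by
  ext <;> simp [nbr, horNbr, verNbr]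

lemma verNbr_nbr_neg (v : ℤ × ℤ) (d : ℤˣ × ℤˣ) : verNbr (nbr v d) (-d) = horNbr v d := by
  ext <;> simp [nbr, horNbr, verNbr]

lemma cell_nbr_neg (v : ℤ × ℤ) (d : ℤˣ × ℤˣ) : cell (nbr v d) (-d) = cell v d := by
  ext <;> simp [nbr, cell, min_comm]

lemma units_eq (e : ℤˣ) : ((e : ℤ) = 1) ∨ ((e : ℤ) = -1) := by
  rcases Int.units_eq_one_or e with rfl | rfl <;> simp

lemma isCorner_self (v : ℤ × ℤ) (d : ℤˣ × ℤˣ) : IsCorner v (cell v d) := by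
  rcases units_eq d.1 with h1 | h1 <;> rcases units_eq d.2 with h2 | h2 <;>
    simp only [IsCorner, cell, h1, h2] <;> omega

lemma isCorner_nbr (v : ℤ × ℤ) (d : ℤˣ × ℤˣ) : IsCorner (nbr v d) (cell v d) := by
  rw [← cell_nbr_neg]; exact isCorner_self _ _

lemma isCorner_horNbr (v : ℤ × ℤ) (d : ℤˣ × ℤˣ) : IsCorner (horNbr v d) (cell v d) := by
  rcases units_eq d.1 with h1 | h1 <;> rcases units_eq d.2 with h2 | h2 <;>
    simp only [IsCorner, cell, horNbr, h1, h2] <;> omega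

lemma isCorner_verNbr (v : ℤ × ℤ) (d : ℤˣ × ℤˣ) : IsCorner (verNbr v d) (cell v d) := by
  rcases units_eq d.1 with h1 | h1 <;> rcases units_eq d.2 with h2 | h2 <;>
    simp only [IsCorner, cell, verNbr, h1, h2] <;> omega

lemma mem_nbrDirs {S : Set (ℤ × ℤ)} {v : ℤ × ℤ} {d : ℤˣ × ℤˣ} :
    d ∈ nbrDirs S v ↔ cell v d ∈ S := by
  simp [nbrDirs]

lemma neg_mem_nbrDirs_nbr {S : Set (ℤ × ℤ)} {v : ℤ × ℤ} {d : ℤˣ × ℤˣ} :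
    -d ∈ nbrDirs S (nbr v d) ↔ d ∈ nbrDirs S v := by
  rw [mem_nbrDirs, mem_nbrDirs, cell_nbr_neg]

lemma nbr_mem_evenVerts {S : Set (ℤ × ℤ)} {v : ℤ × ℤ} {d : ℤˣ × ℤˣ} (hv : v ∈ evenVerts S)
    (hd : d ∈ nbrDirs S v) : nbr v d ∈ evenVerts S := by
  refine ⟨⟨_, mem_nbrDirs.1 hd, isCorner_nbr v d⟩, ?_⟩
  have h := hv.2
  rw [Int.even_iff] at h ⊢
  rcases units_eq d.1 with h1 | h1 <;> rcases units_eq d.2 with h2 | h2 <;>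
    simp only [nbr, h1, h2] <;> omega

lemma skeleton_adj_of_isCorner {S : Set (ℤ × ℤ)} {u v s : ℤ × ℤ} (hs : s ∈ S)
    (hu : IsCorner u s) (hv : IsCorner v s) (h : |u.1 - v.1| + |u.2 - v.2| = 1) :
    (skeleton S).Adj u v := ⟨h, s, hs, hu, hv⟩

lemma nbrDirs_eq_univ {S : Set (ℤ × ℤ)} {v : ℤ × ℤ} (hv : v ∈ internalVerts S) :
    nbrDirs S v = Finset.univ :=
  Finset.eq_univ_of_card _ (by have := hv.2; rw [valence] at this; rw [this]; rfl)

lemma sum_dirs (f : ℤˣ × ℤˣ → ℝ) :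
    ∑ d, f d = f (1, 1) + f (-1, 1) + f (-1, -1) + f (1, -1) := by
  rw [Fintype.sum_prod_type]
  simp only [UnitsInt.univ]
  simp
  ring

/-! ### The rings of a pattern -/

/-- The scaling of the center of a ring with the variable `γ` that makes the level of the inner
circle `1` and the level of the outer circle `1 / q`. -/
lemma HypRing.IsUniformizedBy.exists_scale {q γ : ℝ} (hq0 : 0 < q) {ρ : HypRing}
    (h : ρ.IsUniformizedBy q γ) : ∃ m : ℝ, 0 < m ∧ mink (m • ρ.center) (m • ρ.center) =
      -sn q γ ^ 2 ∧ m * ρ.inner.level = 1 ∧ m * ρ.outer.level = 1 / q ∧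
      ρ.orientation = sign (cn q γ) := by
  cases ρ with
  | proper k hk r R hR hr =>
    obtain ⟨-, h1, h2, h3⟩ := h
    have hs : 0 < sn q γ := by
      have h4 := cosh_pos R
      rw [h1, one_div_pos] at h4
      exact (pos_iff_pos_of_mul_pos h4).1 hq0
    have hcosh : cosh r = 1 / sn q γ := by
      have e : cosh r ^ 2 = (1 / sn q γ) ^ 2 := by
        rw [cosh_sq, h3, div_pow, cn_sq]
        field_simp
        ring
      exact (pow_left_inj₀ (cosh_pos r).le (by positivity) two_ne_zero).1 e
    refine ⟨sn q γ, hs, ?_, ?_, ?_, ?_⟩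
    · rw [mink_smul_left, mink_smul_right, HypRing.center, hk.1]; ring
    · simp only [HypRing.inner, hcosh]; field_simp
    · simp only [HypRing.outer, h1]; field_simp
    · have h5 : cn q γ = sn q γ * sinh r := by rw [h3]; field_simp
      rw [h5, sign_mul_of_pos hs, HypRing.orientation]
      rcases lt_trichotomy r 0 with h6 | rfl | h6
      · rw [sign_of_neg h6, sign_of_neg (sinh_neg_iff.2 h6)]
      · simp
      · rw [sign_of_pos h6, sign_of_pos (sinh_pos_iff.2 h6)]
  | ideal k hk a A ha hA s =>
    obtain ⟨-, h1, h2, h3⟩ := h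
    refine ⟨1 / a, by positivity, ?_, ?_, ?_, ?_⟩
    · rw [mink_smul_left, mink_smul_right, HypRing.center, hk.1, h2]; simp
    · simp only [HypRing.inner]; field_simp
    · simp only [HypRing.outer]
      have hA0 : A ≠ 0 := (lt_of_lt_of_le ha hA).ne'
      rw [h1]; field_simp
    · rw [h3, HypRing.orientation]
      rcases Int.units_eq_one_or s with rfl | rfl
      · simp
      · simp [Real.sign]

lemma HypRing.IsUniformizedBy.sn_pos {q γ : ℝ} (hq0 : 0 < q) {k : Mink} {hk : k ∈ hypPlane}
    {r R : ℝ} {hR : 0 < R} {hr : |r| ≤ R}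
    (h : (HypRing.proper k hk r R hR hr).IsUniformizedBy q γ) : 0 < sn q γ := by
  have h4 := cosh_pos R
  rw [h.2.1, one_div_pos] at h4
  exact (pos_iff_pos_of_mul_pos h4).1 hq0

lemma HypRing.IsUniformizedBy.mem {q γ : ℝ} {ρ : HypRing} (h : ρ.IsUniformizedBy q γ) :
    γ ∈ gammaInterval q := by
  cases ρ <;> exact h.1

section Pattern

variable {S : Set (ℤ × ℤ)} {q : ℝ} {γ : ℤ × ℤ → ℝ} {ring : ℤ × ℤ → HypRing}
  {pt : ℤ × ℤ → Mink}

/-- The scaled center of the ring at `v`. -/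
def scaledCenter (ring : ℤ × ℤ → HypRing) (v : ℤ × ℤ) : Mink :=
  (1 / (ring v).inner.level) • (ring v).center

lemma inner_level_pos (ρ : HypRing) : 0 < ρ.inner.level := by
  cases ρ with
  | proper k hk r R hR hr => exact cosh_pos r
  | ideal k hk a A ha hA s => exact ha

lemma scaledCenter_spec (hq0 : 0 < q) {v : ℤ × ℤ} (hu : (ring v).IsUniformizedBy q (γ v)) :
    mink (scaledCenter ring v) (scaledCenter ring v) = -sn q (γ v) ^ 2 ∧
    (ring v).outer.level = (ring v).inner.level / q ∧
    (ring v).orientation = sign (cn q (γ v)) := by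
  obtain ⟨m, h1, h2, h3, h4, h5⟩ := hu.exists_scale hq0
  have hl := inner_level_pos (ring v)
  have hm : m = 1 / (ring v).inner.level := by field_simp; exact h3
  refine ⟨by rw [scaledCenter, ← hm]; exact h2, ?_, h5⟩
  rw [hm] at h4
  field_simp at h4 ⊢
  linarith

lemma mink_scaledCenter_of_mem_inner {v : ℤ × ℤ} {x : Mink} (hx : x ∈ (ring v).inner.points) :
    mink x (scaledCenter ring v) = -1 := by
  have h : -mink x (ring v).center = (ring v).inner.level := by
    have := hx.2
    revert this
    cases ring v <;> exact id
  have hl := (inner_level_pos (ring v)).ne'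
  rw [scaledCenter, mink_smul_right, ← neg_eq_iff_eq_neg.2 h.symm]
  rw [← h] at hl ⊢
  have : mink x (ring v).center ≠ 0 := by simpa using hl
  field_simp

lemma mink_scaledCenter_of_mem_outer (hq0 : 0 < q) {v : ℤ × ℤ}
    (hu : (ring v).IsUniformizedBy q (γ v)) {x : Mink} (hx : x ∈ (ring v).outer.points) :
    mink x (scaledCenter ring v) = -(1 / q) := by
  have h : -mink x (ring v).center = (ring v).outer.level := by
    have := hx.2
    revert this
    cases ring v <;> exact id
  have hl := (inner_level_pos (ring v)).ne'
  rw [(scaledCenter_spec hq0 hu).2.1] at h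
  rw [scaledCenter, mink_smul_right, neg_eq_iff_eq_neg.1 h]
  field_simp

lemma isQuad_of_isRingPattern (hq0 : 0 < q)
    (hp : IsRingPattern S ring pt)
    (hu : ∀ v ∈ evenVerts S, (ring v).IsUniformizedBy q (γ v))
    {v : ℤ × ℤ} (hv : v ∈ evenVerts S) {d : ℤˣ × ℤˣ} (hd : d ∈ nbrDirs S v) :
    IsQuad q (γ v) (γ (nbr v d)) (((d.1 * d.2 : ℤˣ) : ℤ) : ℝ) (scaledCenter ring v)
      (scaledCenter ring (nbr v d)) (pt (horNbr v d)) (pt (verNbr v d)) := by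
  have hv' := nbr_mem_evenVerts hv hd
  have hd' := neg_mem_nbrDirs_nbr.2 hd
  have uv := hu v hv
  have uv' := hu _ hv'
  have i1 := hp.inner_mem v hv d hd
  have o1 := hp.outer_mem v hv d hd
  have i2 := hp.inner_mem _ hv' _ hd'
  have o2 := hp.outer_mem _ hv' _ hd'
  rw [horNbr_nbr_neg] at i2
  rw [verNbr_nbr_neg] at o2
  have l1 := inner_level_pos (ring v)
  have l2 := inner_level_pos (ring (nbr v d))
  have s1 := hp.oriented v hv d hd
  have s2 := hp.oriented _ hv' _ hd'
  rw [horNbr_nbr_neg, verNbr_nbr_neg] at s2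
  have m1 := mink_scaledCenter_of_mem_outer hq0 uv o1
  have m2 := mink_scaledCenter_of_mem_inner i2
  refine ⟨(scaledCenter_spec hq0 uv).1, (scaledCenter_spec hq0 uv').1, ?_,
    mink_scaledCenter_of_mem_inner i1, mink_scaledCenter_of_mem_outer hq0 uv' o2, m1, m2,
    i1.1.1, o1.1.1, ?_, ?_, ?_⟩
  · have ho := (hp.orthogonal v hv d hd).2 _ ⟨o1, i2⟩
    have c1 : (ring v).outer.center = (ring v).center := by cases ring v <;> rfl
    have c2 : (ring (nbr v d)).inner.center = (ring (nbr v d)).center := by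
      cases ring (nbr v d) <;> rfl
    have hx := o1.1.1
    rw [Cycle.normal, Cycle.normal, c1, c2] at ho
    simp only [mink_add_left, mink_add_right, mink_smul_left, mink_smul_right, hx,
      mink_comm (ring v).center (pt _)] at ho
    -- For a point `x` with `⟨x, x⟩ = -1`, orthogonality of the normals at `x` reads `⟨c, c'⟩ + ⟨x,
    -- c⟩⟨x, c'⟩ = 0`. At the common point on the outer circle of `v` the two factors are `-1 / q`
    -- and `-1` after scaling.
    have e : mink (scaledCenter ring v) (scaledCenter ring (nbr v d)) =
        -(mink (pt (verNbr v d)) (scaledCenter ring v) *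
          mink (pt (verNbr v d)) (scaledCenter ring (nbr v d))) := by
      simp only [scaledCenter, mink_smul_left, mink_smul_right]
      linear_combination (1 / (ring v).inner.level) * (1 / (ring (nbr v d)).inner.level) * ho
    rw [e, m1, m2]
    ring
  · rcases Int.units_eq_one_or (d.1 * d.2) with h | h <;> rw [h] <;> norm_num
  · rw [← (scaledCenter_spec hq0 uv).2.2, ← s1, scaledCenter, det3_smul_left, mul_left_comm,
      sign_mul_of_pos (by positivity)]
  · rw [← (scaledCenter_spec hq0 uv').2.2, ← s2, scaledCenter, det3_smul_left, mul_left_comm,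
      sign_mul_of_pos (by positivity)]
    simp

end Pattern

end RingPattern
end
noncomputable section

namespace RingPattern

open Real

/-! ### Angles at the center of a ring -/

/-- The complex number whose argument is the oriented angle from `x` to `y` at `k`. -/
def angleNum (k x y : Mink) : ℂ := ⟨mink x y + mink x k * mink y k, det3 k x y⟩

lemma HypRing.angle_proper {k : Mink} {hk : k ∈ hypPlane} {r R : ℝ} {hR : 0 < R} {hr : |r| ≤ R}
    (x y : Mink) : (HypRing.proper k hk r R hR hr).angle x y = Complex.arg (angleNum k x y) := by
  rw [HypRing.angle, angleNum]
  congr 2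
  simp only [mink_add_left, mink_add_right, mink_smul_left, mink_smul_right, hk.1,
    mink_comm k y]
  ring

/-- The component of `x` orthogonal to `k` as a complex number. -/
def tangentNum (k x : Mink) : ℂ :=
  ⟨x 1 - k 1 * x 0 + k 1 * (k 1 * x 1 + k 2 * x 2) / (1 + k 0),
    x 2 - k 2 * x 0 + k 2 * (k 1 * x 1 + k 2 * x 2) / (1 + k 0)⟩

/-- `tangentNum k` is the spatial part after the boost that moves `k` to the base point. The boost
preserves products and determinants, and at the base point these become the real and imaginary parts
of a product in `ℂ`. -/
lemma angleNum_eq {k : Mink} (hk : k ∈ hypPlane) (x y : Mink) :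
    angleNum k x y = (starRingEnd ℂ) (tangentNum k x) * tangentNum k y := by
  have h1 := hk.1
  have h2 : (1 + k 0) ≠ 0 := by linarith [hk.2]
  simp only [mink] at h1
  have h3 : k 1 * k 1 + k 2 * k 2 = (k 0 - 1) * (1 + k 0) := by linear_combination h1
  have h4 : k 1 * k 1 = (k 0 - 1) * (1 + k 0) - k 2 * k 2 := by linear_combination h3
  apply Complex.ext
  · simp only [angleNum, tangentNum, mink, Complex.mul_re, Complex.conj_re, Complex.conj_im]
    field_simp
    grind
  · simp only [angleNum, tangentNum, det3_eq, Complex.mul_im, Complex.conj_re, Complex.conj_im]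
    field_simp
    grind

lemma tangentNum_add (k x y : Mink) : tangentNum k (x + y) = tangentNum k x + tangentNum k y := by
  apply Complex.ext <;> simp [tangentNum] <;> ring

lemma tangentNum_smul (a : ℝ) (k x : Mink) : tangentNum k (a • x) = a * tangentNum k x := by
  apply Complex.ext <;> simp [tangentNum] <;> ring

lemma tangentNum_self {k : Mink} (hk : k ∈ hypPlane) : tangentNum k k = 0 := by
  have h1 := hk.1
  have h2 : (1 + k 0) ≠ 0 := by linarith [hk.2]
  simp only [mink] at h1
  have h3 : k 1 * k 1 + k 2 * k 2 = (k 0 - 1) * (1 + k 0) := by linear_combination h1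
  apply Complex.ext
  · simp only [tangentNum, Complex.zero_re, h3]; field_simp; ring
  · simp only [tangentNum, Complex.zero_im, h3]; field_simp; ring

lemma eq_of_mink_eq_neg_one {x k : Mink} (hx : x ∈ hypPlane) (hk : k ∈ hypPlane)
    (h : mink x k = -1) : x = k := by
  have h1 := hx.1
  have h2 := hk.1
  have p1 := hx.2
  have p2 := hk.2
  simp only [mink] at h h1 h2
  -- The equality case of the reversed Cauchy–Schwarz inequality, written as a vanishing sum of
  -- squares.
  have e : (x 1 - k 1) ^ 2 + (x 2 - k 2) ^ 2 + (x 1 * k 2 - x 2 * k 1) ^ 2 = 0 := by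
    linear_combination (k 0 * k 0) * h1 + (x 1 * x 1 + x 2 * x 2 + 1) * h2 -
      (x 0 * k 0 + (x 1 * k 1 + x 2 * k 2 + 1)) * h
  have e1 : x 1 - k 1 = 0 := by
    by_contra hn
    have := pow_pos (abs_pos.2 hn) 2
    rw [sq_abs] at this
    nlinarith [sq_nonneg (x 2 - k 2), sq_nonneg (x 1 * k 2 - x 2 * k 1)]
  have e2 : x 2 - k 2 = 0 := by
    by_contra hn
    have := pow_pos (abs_pos.2 hn) 2
    rw [sq_abs] at this
    nlinarith [sq_nonneg (x 1 - k 1), sq_nonneg (x 1 * k 2 - x 2 * k 1)]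
  have f1 : x 1 = k 1 := by linarith
  have f2 : x 2 = k 2 := by linarith
  have f0 : x 0 = k 0 := by
    have : x 0 ^ 2 = k 0 ^ 2 := by rw [f1, f2] at h1; linarith
    exact (pow_left_inj₀ p1.le p2.le two_ne_zero).1 this
  ext i
  fin_cases i
  · exact f0
  · exact f1
  · exact f2

/-! ### Opening angles of a pattern. -/

section Pattern

variable {S : Set (ℤ × ℤ)} {q : ℝ} {γ : ℤ × ℤ → ℝ} {ring : ℤ × ℤ → HypRing}
  {pt : ℤ × ℤ → Mink}

lemma scaledCenter_proper (hq0 : 0 < q) {v : ℤ × ℤ}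
    (hu : (ring v).IsUniformizedBy q (γ v)) {k : Mink} {hk : k ∈ hypPlane} {r R : ℝ}
    {hR : 0 < R} {hr : |r| ≤ R} (hv : ring v = .proper k hk r R hR hr) :
    0 < sn q (γ v) ∧ scaledCenter ring v = sn q (γ v) • k := by
  have h1 := (scaledCenter_spec hq0 hu).1
  rw [scaledCenter]
  rw [scaledCenter, mink_smul_left, mink_smul_right] at h1
  rw [hv] at hu h1 ⊢
  have hs := hu.sn_pos hq0
  refine ⟨hs, ?_⟩
  simp only [HypRing.center, HypRing.inner, hk.1] at h1 ⊢
  congr 1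
  have h2 : (1 / cosh r) ^ 2 = sn q (γ v) ^ 2 := by linarith
  exact (pow_left_inj₀ (by positivity [cosh_pos r]) hs.le two_ne_zero).1 h2

/-- The real factor has the sign of `cn γ`, hence of `r`: for negative radius the direction is
reversed, which accounts for the difference `π` between nominal and oriented angle. -/
lemma IsQuad.angleNum {γ γ' η : ℝ} {k k' p p' : Mink}
    (h : IsQuad q γ γ' η (sn q γ • k) k' p p') (hq0 : 0 < q) (hq1 : q ≤ 1)
    (hs : 0 < sn q γ) :
    angleNum k p p' = ((cn q γ * dn q γ / (q * sn q γ ^ 2) : ℝ) : ℂ) *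
      (cos (nominalAngle q γ γ') + (η * sin (nominalAngle q γ γ') : ℝ) * Complex.I) := by
  obtain ⟨h1, h2⟩ := h.angle hq0 hq1
  rw [mink_smul_right, mink_smul_right] at h1
  rw [det3_smul_left] at h2
  apply Complex.ext
  · rw [Complex.re_ofReal_mul, RingPattern.angleNum]
    simp only [Complex.add_re, Complex.ofReal_re, Complex.re_ofReal_mul, Complex.I_re, mul_zero,
      add_zero]
    have : mink p p' + mink p k * mink p' k = (sn q γ ^ 2 * mink p p' + sn q γ * mink p k *
      (sn q γ * mink p' k)) / sn q γ ^ 2 := by field_simp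
    rw [this, h1]
    field_simp
  · rw [Complex.im_ofReal_mul, RingPattern.angleNum]
    simp only [Complex.add_im, Complex.ofReal_im, Complex.im_ofReal_mul, Complex.I_im, mul_one,
      zero_add]
    have : det3 k p p' = (sn q γ * (sn q γ * det3 k p p')) / sn q γ ^ 2 := by field_simp
    rw [this, h2]
    field_simp

lemma arg_real_mul_cos_add_sin {l θ η : ℝ} (hη : η = 1 ∨ η = -1) (h0 : 0 < θ) (hπ : θ < π) :
    (0 < l → η * Complex.arg (l * (cos θ + (η * sin θ : ℝ) * Complex.I)) = θ) ∧
    (l < 0 → η * Complex.arg (l * (cos θ + (η * sin θ : ℝ) * Complex.I)) = θ - π) := by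
  have key : ∀ {t φ : ℝ}, 0 < t → φ ∈ Set.Ioc (-π) π →
      Complex.arg (t * (cos φ + (sin φ : ℝ) * Complex.I)) = φ := by
    intro t φ ht hφ
    rw [Complex.ofReal_cos, Complex.ofReal_sin]
    exact Complex.arg_mul_cos_add_sin_mul_I ht hφ
  constructor
  · intro hl
    rcases hη with rfl | rfl
    · rw [one_mul, one_mul, key hl ⟨by linarith, by linarith⟩]
    · have := key (φ := -θ) hl ⟨by linarith, by linarith⟩
      rw [cos_neg, sin_neg] at this
      rw [neg_one_mul, neg_one_mul, this, neg_neg]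
  · intro hl
    rcases hη with rfl | rfl
    · have := key (t := -l) (φ := θ - π) (by linarith) ⟨by linarith, by linarith⟩
      rw [cos_sub_pi, sin_sub_pi] at this
      rw [one_mul, one_mul, ← this]
      congr 1
      push_cast
      ring
    · have := key (t := -l) (φ := π - θ) (by linarith) ⟨by linarith, by linarith⟩
      rw [cos_pi_sub, sin_pi_sub] at this
      have h2 : (l : ℂ) * (cos θ + (-1 * sin θ : ℝ) * Complex.I) =
          ((-l : ℝ) : ℂ) * (((-cos θ : ℝ) : ℂ) + (sin θ : ℝ) * Complex.I) := by
        push_cast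
        ring
      rw [h2, this]
      ring

lemma units_cast_eq (e : ℤˣ) : ((e : ℤ) : ℝ) = 1 ∨ ((e : ℤ) : ℝ) = -1 := by
  rcases Int.units_eq_one_or e with rfl | rfl <;> simp

lemma openingAngle_eq (hq0 : 0 < q) (hq1 : q ≤ 1) (hp : IsRingPattern S ring pt)
    (hu : ∀ v ∈ evenVerts S, (ring v).IsUniformizedBy q (γ v))
    {v : ℤ × ℤ} (hv : v ∈ evenVerts S) {d : ℤˣ × ℤˣ} (hd : d ∈ nbrDirs S v) :
    (0 < (ring v).innerRadius →
      openingAngle ring pt v d = nominalAngle q (γ v) (γ (nbr v d))) ∧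
    ((ring v).innerRadius < 0 →
      openingAngle ring pt v d = nominalAngle q (γ v) (γ (nbr v d)) - π) := by
  have hQ := isQuad_of_isRingPattern hq0 hp hu hv hd
  have huv := hu v hv
  cases hr : ring v with
  | proper k hk r R hR hr' =>
    obtain ⟨hs, hK⟩ := scaledCenter_proper hq0 huv hr
    rw [hK] at hQ
    have hA := hQ.angleNum hq0 hq1 hs
    obtain ⟨n1, n2⟩ := nominalAngle_mem_Ioo hq0 hq1 huv.mem hs (γ (nbr v d))
    have hd := dn_pos hq0.le hq1 (γ v)
    have hc : sinh r = cn q (γ v) / sn q (γ v) := by rw [hr] at huv; exact huv.2.2.2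
    rw [openingAngle, hr, HypRing.angle_proper, hA]
    obtain ⟨a1, a2⟩ := arg_real_mul_cos_add_sin (l := cn q (γ v) * dn q (γ v) /
      (q * sn q (γ v) ^ 2)) (units_cast_eq (d.1 * d.2)) n1 n2
    constructor
    · intro h
      have h1 : 0 < r := by simpa [HypRing.innerRadius] using h
      have h2 := sinh_pos_iff.2 h1
      rw [hc] at h2
      have h3 : 0 < cn q (γ v) := by rwa [div_pos_iff_of_pos_right hs] at h2
      exact a1 (by positivity)
    · intro h
      have h1 : r < 0 := by simpa [HypRing.innerRadius] using h
      have h2 := sinh_neg_iff.2 h1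
      rw [hc] at h2
      have h3 : cn q (γ v) < 0 := by
        by_contra! hn
        exact absurd h2 (not_lt.2 (by positivity))
      exact a2 (div_neg_of_neg_of_pos (mul_neg_of_neg_of_pos h3 hd) (by positivity))
  | ideal k hk a A ha hA s =>
    have huv' := huv
    rw [hr] at huv'
    obtain ⟨-, -, h2, h3⟩ := huv'
    obtain ⟨n1, n2⟩ := nominalAngle_of_sn_eq_zero hq0 hq1 huv.mem h2 (γ (nbr v d))
    rw [openingAngle, hr, HypRing.angle, mul_zero, h3] at *
    rcases Int.units_eq_one_or s with rfl | rfl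
    · constructor
      · intro _; rw [n1 (by simp)]
      · intro h; simp [HypRing.innerRadius] at h
    · constructor
      · intro h; simp [HypRing.innerRadius] at h
      · intro _; rw [n2 (by simp)]; ring

lemma gammaSum_eq_sum_nominalAngle (S : Set (ℤ × ℤ)) (q : ℝ) (γ : ℤ × ℤ → ℝ) (v : ℤ × ℤ) :
    gammaSum S q γ v = ∑ d ∈ nbrDirs S v, nominalAngle q (γ v) (γ (nbr v d)) := rfl

lemma gammaSum_eq_totalAngle (hq0 : 0 < q) (hq1 : q ≤ 1) (hp : IsRingPattern S ring pt)
    (hu : ∀ v ∈ evenVerts S, (ring v).IsUniformizedBy q (γ v))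
    {v : ℤ × ℤ} (hv : v ∈ evenVerts S) :
    (0 < (ring v).innerRadius → gammaSum S q γ v = totalAngle S ring pt v) ∧
    ((ring v).innerRadius < 0 →
      gammaSum S q γ v = totalAngle S ring pt v + π * valence S v) := by
  rw [gammaSum_eq_sum_nominalAngle, totalAngle, valence]
  constructor
  · intro h
    exact Finset.sum_congr rfl fun d hd => ((openingAngle_eq hq0 hq1 hp hu hv hd).1 h).symm
  · intro h
    rw [Finset.sum_congr rfl fun d hd => (openingAngle_eq hq0 hq1 hp hu hv hd).2 h,
      Finset.sum_sub_distrib, Finset.sum_const, nsmul_eq_mul]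
    ring

end Pattern

end RingPattern
end
noncomputable section

namespace RingPattern

open Real

/-! ### The angles at an internal vertex -/

/-- A multiple of `2π` strictly between `0` and `4π`. -/
lemma sum_eq_two_pi {l r θ : ℝ} (hl : 0 < l) (hr : 0 < r) (h0 : 0 < θ) (h4 : θ < 4 * π)
    (h : (l : ℂ) * Complex.exp (θ * Complex.I) = r) : θ = 2 * π := by
  have h1 := congrArg Complex.im h
  have h2 := congrArg Complex.re h
  rw [Complex.im_ofReal_mul, Complex.exp_ofReal_mul_I_im, Complex.ofReal_im] at h1
  rw [Complex.re_ofReal_mul, Complex.exp_ofReal_mul_I_re, Complex.ofReal_re] at h2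
  have hs := (mul_eq_zero.1 h1).resolve_left hl.ne'
  have hc : 0 < cos θ := (pos_iff_pos_of_mul_pos (by rw [h2]; exact hr)).1 hl
  have hc1 : cos θ = 1 := by nlinarith [sin_sq_add_cos_sq θ]
  obtain ⟨n, hn⟩ := (cos_eq_one_iff θ).1 hc1
  have n0 : (0 : ℝ) < n := by
    by_contra! hh
    nlinarith [pi_pos]
  have n2 : (n : ℝ) < 2 := by
    by_contra! hh
    nlinarith [pi_pos]
  have e : n = 1 := by
    have a1 : 0 < n := by exact_mod_cast n0
    have a2 : n < 2 := by exact_mod_cast n2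
    omega
  rw [← hn, e]
  simp

lemma conj_mul_conj_eq {η : ℝ} {z : ℂ} {l θ : ℝ} (hη : η = -1)
    (h : z = (l : ℂ) * (cos θ + (η * sin θ : ℝ) * Complex.I)) :
    (starRingEnd ℂ) z = l * Complex.exp (θ * Complex.I) := by
  rw [h, hη, Complex.exp_mul_I]
  simp only [map_mul, map_add, Complex.conj_ofReal, Complex.conj_I]
  push_cast
  ring

lemma eq_mul_exp {η : ℝ} {z : ℂ} {l θ : ℝ} (hη : η = 1)
    (h : z = (l : ℂ) * (cos θ + (η * sin θ : ℝ) * Complex.I)) :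
    z = l * Complex.exp (θ * Complex.I) := by
  rw [h, hη, Complex.exp_mul_I]
  push_cast
  ring

lemma conj_mul_self_eq (z : ℂ) : (starRingEnd ℂ) z * z = ((‖z‖ ^ 2 : ℝ) : ℂ) := by
  rw [mul_comm, Complex.mul_conj, Complex.normSq_eq_norm_sq]

/-- The defect of this identity for general `k` is `det3 x y z` times `⟨k, k⟩`. For ideal `k`,
division by the products with `k`, where nonzero, shows that `det3 k x y / (⟨x, k⟩⟨y, k⟩)` is an
additive displacement along the horocycles. -/
lemma ideal_det3_add {k : Mink} (hk : mink k k = 0) (x y z : Mink) :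
    det3 k x y * mink z k + det3 k y z * mink x k = det3 k x z * mink y k := by
  have h : det3 k x y * mink z k - det3 k x z * mink y k + det3 k y z * mink x k =
      det3 x y z * mink k k := by
    simp only [det3_eq, mink]; ring
  rw [hk] at h
  linear_combination h

/-! ### The four nominal angles at an internal vertex close up. -/

section Pattern

variable {S : Set (ℤ × ℤ)} {q : ℝ} {γ : ℤ × ℤ → ℝ} {ring : ℤ × ℤ → HypRing}
  {pt : ℤ × ℤ → Mink}

lemma horNbr_eq (v : ℤ × ℤ) (e f f' : ℤˣ) : horNbr v (e, f) = horNbr v (e, f') := rfl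

lemma verNbr_eq (v : ℤ × ℤ) (e e' f : ℤˣ) : verNbr v (e, f) = verNbr v (e', f) := rfl

/-- At an ideal center the four displacements right–up–left–down–right along the horocycles all have
the same strict sign. By additivity, the displacements from right to left and from left to right
would then have equal signs, although they are opposite. -/
lemma sn_ne_zero_of_internal (hq0 : 0 < q) (hp : IsRingPattern S ring pt)
    (hu : ∀ v ∈ evenVerts S, (ring v).IsUniformizedBy q (γ v))
    {v : ℤ × ℤ} (hv : v ∈ internalVerts S) : sn q (γ v) ≠ 0 := by
  intro hs
  have hQ := fun d => isQuad_of_isRingPattern hq0 hp hu hv.1 (d := d)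
    (by rw [nbrDirs_eq_univ hv]; exact Finset.mem_univ _)
  have h1 := hQ (1, 1)
  have h2 := hQ (-1, 1)
  have h3 := hQ (-1, -1)
  have h4 := hQ (1, -1)
  have hc := cn_sq q (γ v)
  rw [verNbr_eq v (-1) 1 1, horNbr_eq v (-1) 1 (-1)] at h2
  rw [verNbr_eq v (-1) 1 (-1)] at h3
  rw [horNbr_eq v 1 (-1) 1] at h4
  set k := scaledCenter ring v
  have hk : mink k k = 0 := by rw [h1.kk, hs]; simp
  have a1 := ideal_det3_add hk (pt (horNbr v (1, 1))) (pt (verNbr v (1, 1)))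
    (pt (horNbr v (-1, -1)))
  have a2 := ideal_det3_add hk (pt (horNbr v (-1, -1))) (pt (verNbr v (1, -1)))
    (pt (horNbr v (1, 1)))
  rw [h1.pk, h2.pk, h1.pk2] at a1
  rw [h1.pk, h2.pk, h4.pk2] at a2
  have s1 := h1.sign
  have s2 := h2.sign
  have s3 := h3.sign
  have s4 := h4.sign
  have sw : ∀ x y, det3 k x y = -det3 k y x := fun x y => by simp only [det3_eq]; ring
  rw [sw (pt (verNbr v (1, 1)))] at a1
  rw [sw (pt (verNbr v (1, -1))), sw (pt (horNbr v (-1, -1))) (pt (horNbr v (1, 1)))] at a2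
  norm_num at s1 s2 s3 s4
  have sgn : ∀ {x y : ℝ}, sign x = sign y → 0 < y → 0 < x := by
    intro x y hxy hy
    rw [sign_of_pos hy] at hxy
    by_contra! hn
    rcases hn.lt_or_eq with h | h
    · rw [sign_of_neg h] at hxy; norm_num at hxy
    · rw [h, sign_zero] at hxy; norm_num at hxy
  have sgn' : ∀ {x y : ℝ}, sign x = sign y → y < 0 → x < 0 := by
    intro x y hxy hy
    rw [sign_of_neg hy] at hxy
    by_contra! hn
    rcases hn.lt_or_eq with h | h
    · rw [sign_of_pos h] at hxy; norm_num at hxy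
    · rw [← h, sign_zero] at hxy; norm_num at hxy
  have hc0 : cn q (γ v) ≠ 0 := by
    intro h; rw [h, hs] at hc; norm_num at hc
  rcases hc0.lt_or_gt with h | h
  · have b1 := sgn' s1 h
    have b2 := sgn' s2 h
    have b3 := sgn' s3 h
    have b4 := sgn' s4 h
    rw [neg_mul, neg_lt_zero] at *
    nlinarith
  · have b1 := sgn s1 h
    have b2 := sgn s2 h
    have b3 := sgn s3 h
    have b4 := sgn s4 h
    nlinarith

lemma adj_of_internal {v : ℤ × ℤ} (hv : v ∈ internalVerts S) (e f : ℤˣ) :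
    (skeleton S).Adj (horNbr v (e, f)) (nbr v (e, f)) ∧ horNbr v (e, f) ∈ oddVerts S := by
  have hd : cell v (e, f) ∈ S := by
    rw [← mem_nbrDirs, nbrDirs_eq_univ hv]; exact Finset.mem_univ _
  refine ⟨skeleton_adj_of_isCorner hd (isCorner_horNbr _ _) (isCorner_nbr _ _) ?_,
    ⟨_, hd, isCorner_horNbr _ _⟩, ?_⟩
  · rcases units_eq f with h | h <;> simp [horNbr, nbr, h]
  · have h := hv.1.2
    rw [Int.odd_iff]
    rw [Int.even_iff] at h
    rcases units_eq e with h1 | h1 <;> simp only [horNbr, h1] <;> omega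

/-- If the inner circle degenerates to a point, the horizontal touching points coincide with the
center and have no direction from it. The touching of the outer circles of the neighbors at this
point serves as a substitute: their centers are seen in opposite directions. -/
lemma outer_touch_tangentNum {v : ℤ × ℤ} (hp : IsRingPattern S ring pt)
    (hv : v ∈ internalVerts S) {k : Mink} (hk : k ∈ hypPlane) (e : ℤˣ)
    (hpt : pt (horNbr v (e, 1)) = k)
    (h1 : tangentNum k (scaledCenter ring (nbr v (e, 1))) ≠ 0)
    (h2 : tangentNum k (scaledCenter ring (nbr v (e, -1))) ≠ 0) :
    ∃ t : ℝ, 0 < t ∧ tangentNum k (scaledCenter ring (nbr v (e, 1))) =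
      -(t * tangentNum k (scaledCenter ring (nbr v (e, -1)))) := by
  obtain ⟨a1, o1⟩ := adj_of_internal hv e 1
  obtain ⟨a2, -⟩ := adj_of_internal hv e (-1)
  have hh : horNbr v (e, 1) = (v.1 + e, v.2) := rfl
  have hh' : horNbr v (e, -1) = (v.1 + e, v.2) := rfl
  have n1 : nbr v (e, 1) = (v.1 + e, v.2 + 1) := rfl
  have n2 : nbr v (e, -1) = (v.1 + e, v.2 - 1) := rfl
  rw [hh, n1] at a1
  rw [hh', n2] at a2
  rw [hh] at o1 hpt
  have ht := (hp.outer_touch _ _ o1 a2 a1).2.2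
  rw [hpt, one_smul, one_smul] at ht
  rw [← n1, ← n2] at ht
  have cc : ∀ ρ : HypRing, ρ.outer.center = ρ.center := fun ρ => by cases ρ <;> rfl
  have l1 := inner_level_pos (ring (nbr v (e, 1)))
  have l2 := inner_level_pos (ring (nbr v (e, -1)))
  have tn : ∀ ρ : HypRing, tangentNum k (ρ.outer.normal k) =
      ρ.inner.level * tangentNum k ((1 / ρ.inner.level) • ρ.center) := by
    intro ρ
    have l : (ρ.inner.level : ℂ) ≠ 0 := Complex.ofReal_ne_zero.2 (inner_level_pos ρ).ne'
    rw [Cycle.normal, tangentNum_add, tangentNum_smul, tangentNum_self hk, cc, tangentNum_smul]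
    push_cast
    field_simp
    simp
  -- `SameRay` holds trivially for a zero vector; both normals must be nonzero to extract positive
  -- factors.
  have nz1 : (ring (nbr v (e, 1))).outer.normal k ≠ 0 := by
    intro h
    have := tn (ring (nbr v (e, 1)))
    rw [h, show (0 : Mink) = (0 : ℝ) • (0 : Mink) by simp, tangentNum_smul] at this
    simp only [Complex.ofReal_zero, zero_mul, zero_eq_mul] at this
    rcases this with h3 | h3
    · exact l1.ne' (Complex.ofReal_eq_zero.1 h3)
    · exact h1 h3
  have nz2 : (ring (nbr v (e, -1))).outer.normal k ≠ 0 := by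
    intro h
    have := tn (ring (nbr v (e, -1)))
    rw [h, show (0 : Mink) = (0 : ℝ) • (0 : Mink) by simp, tangentNum_smul] at this
    simp only [Complex.ofReal_zero, zero_mul, zero_eq_mul] at this
    rcases this with h3 | h3
    · exact l2.ne' (Complex.ofReal_eq_zero.1 h3)
    · exact h2 h3
  obtain ⟨r1, r2, p1, p2, hr⟩ := ht.exists_pos nz2 (neg_ne_zero.2 nz1)
  have hz := congrArg (tangentNum k) hr
  rw [tangentNum_smul, tn (ring (nbr v (e, -1))), ← neg_one_smul ℝ (Cycle.normal _ _), smul_smul,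
    tangentNum_smul (r2 * -1), tn (ring (nbr v (e, 1)))] at hz
  refine ⟨r1 * (ring (nbr v (e, -1))).inner.level / (r2 * (ring (nbr v (e, 1))).inner.level),
    by positivity, ?_⟩
  have e1 : (r2 : ℂ) ≠ 0 := Complex.ofReal_ne_zero.2 p2.ne'
  have e2 : ((ring (nbr v (e, 1))).inner.level : ℂ) ≠ 0 := Complex.ofReal_ne_zero.2 l1.ne'
  rw [scaledCenter, scaledCenter]
  push_cast at hz ⊢
  field_simp
  field_simp at hz
  linear_combination hz

lemma gammaSum_of_internal (hq0 : 0 < q) (hq1 : q ≤ 1) (hp : IsRingPattern S ring pt)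
    (hu : ∀ v ∈ evenVerts S, (ring v).IsUniformizedBy q (γ v))
    {v : ℤ × ℤ} (hv : v ∈ internalVerts S) : gammaSum S q γ v = 2 * π := by
  have hs0 := sn_ne_zero_of_internal hq0 hp hu hv
  have huv := hu v hv.1
  have hs : 0 < sn q (γ v) :=
    lt_of_le_of_ne (sn_nonneg_of_mem hq0.le hq1 huv.mem) hs0.symm
  rw [gammaSum_eq_sum_nominalAngle, nbrDirs_eq_univ hv, sum_dirs]
  have hQ := fun d => isQuad_of_isRingPattern hq0 hp hu hv.1 (d := d)
    (by rw [nbrDirs_eq_univ hv]; exact Finset.mem_univ _)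
  have hn := fun d => nominalAngle_mem_Ioo hq0 hq1 huv.mem hs (γ (nbr v d))
  have b1 := hn (1, 1)
  have b2 := hn (-1, 1)
  have b3 := hn (-1, -1)
  have b4 := hn (1, -1)
  obtain ⟨k, hk, hK⟩ : ∃ k ∈ hypPlane, scaledCenter ring v = sn q (γ v) • k := by
    cases hr : ring v with
    | proper k hk r R hR hr' => exact ⟨k, hk, (scaledCenter_proper hq0 huv hr).2⟩
    | ideal k hk a A ha hA s =>
      rw [hr] at huv
      exact absurd huv.2.2.1 hs0
  simp only [hK] at hQ
  have hd := dn_pos hq0.le hq1 (γ v)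
  set θ := fun d => nominalAngle q (γ v) (γ (nbr v d)) with hθ
  change θ (1, 1) + θ (-1, 1) + θ (-1, -1) + θ (1, -1) = 2 * π
  -- The case `r = 0`, where directions to the horizontal points are replaced by directions to the
  -- neighboring centers. Here `h = π / 2`, so the direction to a neighboring center and that to the
  -- vertical point enclose `β = θ - π / 2`.
  by_cases hc : cn q (γ v) = 0
  · have hs1 : sn q (γ v) = 1 := by
      have := cn_sq q (γ v)
      rw [hc] at this
      nlinarith
    rw [hs1] at hQ
    simp only [one_smul] at hQ
    have hd2 := dn_sq hq0.le hq1 (γ v)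
    rw [hs1] at hd2
    have hptR : ∀ e : ℤˣ, pt (horNbr v (e, 1)) = k := by
      intro e
      have hm : (e, (1 : ℤˣ)) ∈ nbrDirs S v := by
        rw [nbrDirs_eq_univ hv]; exact Finset.mem_univ _
      exact eq_of_mink_eq_neg_one (hp.inner_mem v hv.1 _ hm).1 hk (hQ (e, 1)).pk
    have key : ∀ d : ℤˣ × ℤˣ, (starRingEnd ℂ) (tangentNum k (scaledCenter ring (nbr v d))) *
        tangentNum k (pt (verNbr v d)) =
        ((dn q (γ v) * dn q (γ (nbr v d)) / q ^ 2 : ℝ) : ℂ) * (cos (θ d - π / 2) +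
          ((((d.1 * d.2 : ℤˣ) : ℤ) : ℝ) * sin (θ d - π / 2) : ℝ) * Complex.I) := by
      intro d
      have h := hQ d
      have hη := h.eta
      obtain ⟨-, d2⟩ := h.dets hq0 hq1
      obtain ⟨n1, n2⟩ := nominalAngle_spec hq0 hq1 (γ v) (γ (nbr v d))
      rw [hs1, hc] at n1 n2
      have hd' := dn_pos hq0.le hq1 (γ (nbr v d))
      have hd2' := dn_sq hq0.le hq1 (γ (nbr v d))
      have e1 : 1 - q ^ 2 * 1 ^ 2 * sn q (γ (nbr v d)) ^ 2 = dn q (γ (nbr v d)) ^ 2 := by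
        rw [hd2']; ring
      rw [e1] at n1 n2
      have f1 : dn q (γ (nbr v d)) * sin (θ d) = dn q (γ v) := by
        apply mul_left_cancel₀ hd'.ne'
        linear_combination n2
      have f2 : dn q (γ (nbr v d)) * cos (θ d) = -(q * cn q (γ (nbr v d))) := by
        apply mul_left_cancel₀ hd'.ne'
        linear_combination n1
      have d2' : det3 k (scaledCenter ring (nbr v d)) (pt (verNbr v d)) =
          (((d.1 * d.2 : ℤˣ) : ℤ) : ℝ) * (cn q (γ (nbr v d)) * dn q (γ v) / q) := by
        linear_combination (((d.1 * d.2 : ℤˣ) : ℤ) : ℝ) * d2 -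
          det3 k (scaledCenter ring (nbr v d)) (pt (verNbr v d)) * hη
      rw [← angleNum_eq hk, cos_sub_pi_div_two, sin_sub_pi_div_two]
      apply Complex.ext
      · rw [Complex.re_ofReal_mul, angleNum]
        simp only [Complex.add_re, Complex.ofReal_re, Complex.re_ofReal_mul, Complex.I_re,
          mul_zero, add_zero]
        rw [mink_comm _ (pt (verNbr v d)), h.pk2', mink_comm _ k, h.cross, h.pk2]
        have : dn q (γ v) * dn q (γ (nbr v d)) / q ^ 2 * sin (θ d) =
            dn q (γ v) / q ^ 2 * (dn q (γ (nbr v d)) * sin (θ d)) := by ring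
        rw [this, f1]
        field_simp
        linear_combination -hd2
      · rw [Complex.im_ofReal_mul, angleNum]
        simp only [Complex.add_im, Complex.ofReal_im, Complex.im_ofReal_mul, Complex.I_im,
          mul_one, zero_add]
        rw [d2']
        have : ∀ e : ℝ, dn q (γ v) * dn q (γ (nbr v d)) / q ^ 2 * (e * -cos (θ d)) =
            -(e * dn q (γ v) / q ^ 2 * (dn q (γ (nbr v d)) * cos (θ d))) := by intro e; ring
        rw [this, f2]
        field_simp
    have lpos : ∀ d, 0 < dn q (γ v) * dn q (γ (nbr v d)) / q ^ 2 := by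
      intro d
      have := dn_pos hq0.le hq1 (γ (nbr v d))
      positivity
    have nz : ∀ d : ℤˣ × ℤˣ, tangentNum k (scaledCenter ring (nbr v d)) ≠ 0 ∧
        tangentNum k (pt (verNbr v d)) ≠ 0 := by
      intro d
      have h1 : (starRingEnd ℂ) (tangentNum k (scaledCenter ring (nbr v d))) *
        tangentNum k (pt (verNbr v d)) ≠ 0 := by
        rw [key d]
        refine mul_ne_zero (Complex.ofReal_ne_zero.2 (lpos d).ne') ?_
        intro h0
        have g1 := congrArg Complex.re h0
        simp only [Complex.add_re, Complex.ofReal_re, Complex.re_ofReal_mul, Complex.I_re,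
          mul_zero, add_zero, Complex.zero_re] at g1
        rw [cos_sub_pi_div_two] at g1
        have := sin_pos_of_pos_of_lt_pi (hn d).1 (hn d).2
        exact this.ne' g1
      exact ⟨fun h => h1 (by rw [h]; simp), fun h => h1 (by rw [h]; simp)⟩
    have k1 := eq_mul_exp (by simp) (key (1, 1))
    have k2 := conj_mul_conj_eq (by simp) (key (-1, 1))
    have k3 := eq_mul_exp (by simp) (key (-1, -1))
    have k4 := conj_mul_conj_eq (by simp) (key (1, -1))
    rw [map_mul, Complex.conj_conj, verNbr_eq v (-1) 1 1] at k2
    rw [map_mul, Complex.conj_conj] at k4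
    rw [verNbr_eq v (-1) 1 (-1)] at k3
    -- On either side the neighboring centers are opposite up to a positive factor. The two minus
    -- signs cancel in the product of the four relations.
    obtain ⟨t, ht, T1⟩ := outer_touch_tangentNum hp hv hk 1 (hptR 1) (nz _).1 (nz _).1
    obtain ⟨t', ht', T2⟩ := outer_touch_tangentNum hp hv hk (-1) (hptR (-1)) (nz _).1 (nz _).1
    rw [T1] at k1
    rw [T2] at k2
    have z3 := (nz (-1, -1)).1
    have z4 := (nz (1, -1)).1
    have zU := (nz (1, 1)).2
    have zD := (nz (1, -1)).2
    set w3 := tangentNum k (scaledCenter ring (nbr v (-1, -1)))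
    set w4 := tangentNum k (scaledCenter ring (nbr v (1, -1)))
    set U := tangentNum k (pt (verNbr v (1, 1)))
    set D := tangentNum k (pt (verNbr v (1, -1)))
    -- The four corrections `-π / 2` amount to one full period.
    have hexp : Complex.exp (((θ (1, 1) + θ (-1, 1) + θ (-1, -1) + θ (1, -1) : ℝ) : ℂ) *
        Complex.I) = Complex.exp ((θ (1, 1) - π / 2 : ℝ) * Complex.I) *
        Complex.exp ((θ (-1, 1) - π / 2 : ℝ) * Complex.I) *
        Complex.exp ((θ (-1, -1) - π / 2 : ℝ) * Complex.I) *
        Complex.exp ((θ (1, -1) - π / 2 : ℝ) * Complex.I) := by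
      rw [← Complex.exp_add, ← Complex.exp_add, ← Complex.exp_add,
        ← Complex.exp_periodic.int_mul (-1)]
      congr 1
      push_cast
      ring
    refine sum_eq_two_pi (mul_pos (mul_pos (mul_pos (lpos (1, 1)) (lpos (-1, 1)))
      (lpos (-1, -1))) (lpos (1, -1)))
      (show 0 < t * t' * (‖w3‖ ^ 2 * ‖w4‖ ^ 2 * (‖U‖ ^ 2 * ‖D‖ ^ 2)) by
        have := norm_pos_iff.2 z3
        have := norm_pos_iff.2 z4
        have := norm_pos_iff.2 zU
        have := norm_pos_iff.2 zD
        positivity) (by linarith) (by linarith) ?_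
    rw [hexp]
    push_cast [← conj_mul_self_eq]
    have nn := fun z : ℂ => conj_mul_self_eq z
    push_cast at nn k1 k2 k3 k4 ⊢
    rw [← nn, ← nn, ← nn, ← nn]
    simp only [map_neg, map_mul, Complex.conj_ofReal] at k1 k2 k3 k4
    calc _ = _ := by
          rw [show ∀ a b c d e f g h : ℂ, a * b * c * d * (e * f * g * h) =
            (a * e) * (b * f) * (c * g) * (d * h) by intros; ring]
      _ = _ := by
          rw [← k1, ← k2, ← k3, ← k4]
          ring
  · have key : ∀ d : ℤˣ × ℤˣ, (starRingEnd ℂ) (tangentNum k (pt (horNbr v d))) *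
        tangentNum k (pt (verNbr v d)) = _ := fun d => by
      rw [← angleNum_eq hk, (hQ d).angleNum hq0 hq1 hs]
    set l := cn q (γ v) * dn q (γ v) / (q * sn q (γ v) ^ 2) with hl
    have hl0 : l ≠ 0 := by
      rw [hl]
      have := hd.ne'
      have := hs.ne'
      positivity
    -- Conjugating every second relation orders the directions as right, up, left, down. The product
    -- of the four relations then pairs each direction with its conjugate and is a positive number.
    have k1 := eq_mul_exp (by simp) (key (1, 1))
    have k2 := conj_mul_conj_eq (by simp) (key (-1, 1))
    have k3 := eq_mul_exp (by simp) (key (-1, -1))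
    have k4 := conj_mul_conj_eq (by simp) (key (1, -1))
    rw [map_mul, Complex.conj_conj, verNbr_eq v (-1) 1 1, horNbr_eq v (-1) 1 (-1)] at k2
    rw [map_mul, Complex.conj_conj, horNbr_eq v 1 (-1) 1] at k4
    rw [verNbr_eq v (-1) 1 (-1)] at k3
    set R := tangentNum k (pt (horNbr v (1, 1)))
    set L := tangentNum k (pt (horNbr v (-1, -1)))
    set U := tangentNum k (pt (verNbr v (1, 1)))
    set D := tangentNum k (pt (verNbr v (1, -1)))
    have ne0 : ∀ x : ℝ, (l : ℂ) * Complex.exp (x * Complex.I) ≠ 0 := fun x =>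
      mul_ne_zero (Complex.ofReal_ne_zero.2 hl0) (Complex.exp_ne_zero _)
    have zR : R ≠ 0 := fun h => ne0 (θ (1, 1)) (by rw [← k1, h]; simp)
    have zU : U ≠ 0 := fun h => ne0 (θ (1, 1)) (by rw [← k1, h]; simp)
    have zL : L ≠ 0 := fun h => ne0 (θ (-1, -1)) (by rw [← k3, h]; simp)
    have zD : D ≠ 0 := fun h => ne0 (θ (-1, -1)) (by rw [← k3, h]; simp)
    -- The fourth power is positive for either sign of `r`: four reversals by `π` make a multiple of
    -- `2π`.
    refine sum_eq_two_pi (l := l ^ 4) (by positivity)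
      (show 0 < (‖R‖ ^ 2 * ‖L‖ ^ 2 * (‖U‖ ^ 2 * ‖D‖ ^ 2)) by
        have := norm_pos_iff.2 zR
        have := norm_pos_iff.2 zL
        have := norm_pos_iff.2 zU
        have := norm_pos_iff.2 zD
        positivity) (by linarith) (by linarith) ?_
    have hexp : Complex.exp (((θ (1, 1) + θ (-1, 1) + θ (-1, -1) + θ (1, -1) : ℝ) : ℂ) *
        Complex.I) = Complex.exp ((θ (1, 1) : ℝ) * Complex.I) *
        Complex.exp ((θ (-1, 1) : ℝ) * Complex.I) *
        Complex.exp ((θ (-1, -1) : ℝ) * Complex.I) *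
        Complex.exp ((θ (1, -1) : ℝ) * Complex.I) := by
      rw [← Complex.exp_add, ← Complex.exp_add, ← Complex.exp_add]
      congr 1
      push_cast
      ring
    have nn := fun z : ℂ => conj_mul_self_eq z
    rw [hexp]
    push_cast at nn ⊢
    rw [← nn, ← nn, ← nn, ← nn]
    calc _ = (l * Complex.exp ((θ (1, 1) : ℝ) * Complex.I)) *
        (l * Complex.exp ((θ (-1, 1) : ℝ) * Complex.I)) *
        (l * Complex.exp ((θ (-1, -1) : ℝ) * Complex.I)) *
        (l * Complex.exp ((θ (1, -1) : ℝ) * Complex.I)) := by ring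
      _ = _ := by
          rw [← k1, ← k2, ← k3, ← k4]
          ring

end Pattern

end RingPattern
end
noncomputable section

namespace RingPattern

open Real

/-! ### Integration of flat connections on simply connected square complexes -/

section Holonomy

variable {S : Set (ℤ × ℤ)} {G : Type*} [Group G]

/-- The product of the transitions `h` along a walk. -/
def walkProd (h : ℤ × ℤ → ℤ × ℤ → G) :
    ∀ {u v : ℤ × ℤ}, (skeleton S).Walk u v → G
  | _, _, .nil => 1
  | u, _, .cons (v := v) _ p => h u v * walkProd h p

lemma walkProd_append (h : ℤ × ℤ → ℤ × ℤ → G) {u v w : ℤ × ℤ} (p : (skeleton S).Walk u v)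
    (r : (skeleton S).Walk v w) : walkProd h (p.append r) = walkProd h p * walkProd h r := by
  induction p with
  | nil => simp [walkProd]
  | cons a p ih => simp [walkProd, ih, mul_assoc]

lemma walkProd_mem {h : ℤ × ℤ → ℤ × ℤ → G} {H : Subgroup G} (hH : ∀ u v, h u v ∈ H)
    {u v : ℤ × ℤ} (p : (skeleton S).Walk u v) : walkProd h p ∈ H := by
  induction p with
  | nil => exact H.one_mem
  | cons a p ih => exact H.mul_mem (hH _ _) ih

lemma walkProd_eq_of_edgeHomotopic {h : ℤ × ℤ → ℤ × ℤ → G}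
    (hinv : ∀ u v, (skeleton S).Adj u v → h u v * h v u = 1)
    (hsq : ∀ s ∈ S, ∀ a b c d, IsCorner a s → IsCorner b s → IsCorner c s → IsCorner d s →
      (skeleton S).Adj a b → (skeleton S).Adj b c → (skeleton S).Adj a d →
      (skeleton S).Adj d c → h a b * h b c = h a d * h d c)
    {u v : ℤ × ℤ} {p r : (skeleton S).Walk u v} (hpr : EdgeHomotopic S p r) :
    walkProd h p = walkProd h r := by
  induction hpr with
  | refl => rfl
  | symm _ ih => exact ih.symm
  | trans _ _ ih1 ih2 => exact ih1.trans ih2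
  | backtrack p hab w =>
    simp only [walkProd_append, walkProd]
    rw [← mul_assoc (h _ _), hinv _ _ hab, one_mul]
  | square s hs ha hb hc hd p hab hbc had hdc w =>
    simp only [walkProd_append, walkProd]
    rw [← mul_assoc (h _ _), hsq s hs _ _ _ _ ha hb hc hd hab hbc had hdc, mul_assoc]

/-- A flat connection on a simply connected complex is trivial. -/
theorem exists_potential (hS : IsSimplyConnected S) {h : ℤ × ℤ → ℤ × ℤ → G} {H : Subgroup G}
    (hH : ∀ u v, h u v ∈ H)
    (hinv : ∀ u v, (skeleton S).Adj u v → h u v * h v u = 1)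
    (hsq : ∀ s ∈ S, ∀ a b c d, IsCorner a s → IsCorner b s → IsCorner c s → IsCorner d s →
      (skeleton S).Adj a b → (skeleton S).Adj b c → (skeleton S).Adj a d →
      (skeleton S).Adj d c → h a b * h b c = h a d * h d c) :
    ∃ f : ℤ × ℤ → G, (∀ v, f v ∈ H) ∧ ∀ u v, (skeleton S).Adj u v → f v = f u * h u v := by
  classical
  obtain ⟨⟨s, hs⟩, hconn, hpi⟩ := hS
  have hb : s ∈ verts S := ⟨s, hs, Or.inl rfl, Or.inl rfl⟩
  have hvert : ∀ {u v}, (skeleton S).Adj u v → u ∈ verts S := fun hh =>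
    let ⟨s, hs, hu, _⟩ := hh.2
    ⟨s, hs, hu⟩
  have key : ∀ {v} (p r : (skeleton S).Walk s v), walkProd h p = walkProd h r := by
    intro v p r
    have rev : walkProd h r * walkProd h r.reverse = 1 := by
      clear p hs hb
      induction r with
      | nil => simp [walkProd]
      | cons a p ih =>
        rw [SimpleGraph.Walk.reverse_cons, walkProd_append]
        simp only [walkProd, mul_one]
        rw [mul_assoc, ← mul_assoc (walkProd h p), ih, one_mul, hinv _ _ a]
    have h1 := walkProd_eq_of_edgeHomotopic hinv hsq (hpi s (p.append r.reverse))
    rw [walkProd_append] at h1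
    exact mul_right_cancel (h1.trans rev.symm)
  refine ⟨fun v => if hv : (skeleton S).Reachable s v then walkProd h hv.some else 1, ?_, ?_⟩
  · intro v
    beta_reduce
    split_ifs
    · exact walkProd_mem hH _
    · exact H.one_mem
  · intro u v huv
    have r1 := hconn s hb u (hvert huv)
    have r2 := hconn s hb v (hvert huv.symm)
    beta_reduce
    rw [dif_pos r1, dif_pos r2, key r2.some (r1.some.append (.cons huv .nil)), walkProd_append]
    simp [walkProd]

end Holonomy

/-! ### The Lorentz group -/

open Matrix

/-- The action of the special linear group on Minkowski space. -/
def act (A : SpecialLinearGroup (Fin 3) ℝ) (x : Mink) : Mink :=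
  (A : Matrix (Fin 3) (Fin 3) ℝ) *ᵥ x

lemma act_mul (A B : SpecialLinearGroup (Fin 3) ℝ) (x : Mink) :
    act (A * B) x = act A (act B x) :=
  (mulVec_mulVec x (A : Matrix (Fin 3) (Fin 3) ℝ) (B : Matrix (Fin 3) (Fin 3) ℝ)).symm

lemma act_one (x : Mink) : act 1 x = x := one_mulVec x

lemma exists_act_eq {M : Matrix (Fin 3) (Fin 3) ℝ} (hM : M.det = 1) :
    ∃ A : SpecialLinearGroup (Fin 3) ℝ, ∀ x, act A x = M *ᵥ x :=
  ⟨⟨M, hM⟩, fun _ => rfl⟩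

lemma act_inv_act (A : SpecialLinearGroup (Fin 3) ℝ) (x : Mink) : act A⁻¹ (act A x) = x := by
  rw [← act_mul, inv_mul_cancel, act_one]

lemma act_act_inv (A : SpecialLinearGroup (Fin 3) ℝ) (x : Mink) : act A (act A⁻¹ x) = x := by
  rw [← act_mul, mul_inv_cancel, act_one]

lemma act_add (A : SpecialLinearGroup (Fin 3) ℝ) (x y : Mink) :
    act A (x + y) = act A x + act A y := mulVec_add _ _ _

lemma act_smul (A : SpecialLinearGroup (Fin 3) ℝ) (a : ℝ) (x : Mink) :
    act A (a • x) = a • act A x := mulVec_smul _ _ _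

lemma act_neg (A : SpecialLinearGroup (Fin 3) ℝ) (x : Mink) : act A (-x) = -act A x :=
  mulVec_neg _ _

/-- The proper orthochronous Lorentz group. -/
def lorentz : Subgroup (SpecialLinearGroup (Fin 3) ℝ) where
  carrier := {A | (∀ x y : Mink, mink (act A x) (act A y) = mink x y) ∧
    ∀ x ∈ hypPlane, act A x ∈ hypPlane}
  mul_mem' := by
    rintro A B ⟨h1, h2⟩ ⟨h3, h4⟩
    refine ⟨fun x y => ?_, fun x hx => ?_⟩
    · rw [act_mul, act_mul, h1, h3]
    · rw [act_mul]
      exact h2 _ (h4 _ hx)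
  one_mem' := by simp [act_one]
  inv_mem' := by
    rintro A ⟨h1, h2⟩
    have e := act_act_inv A
    have h3 : ∀ x y : Mink, mink (act A⁻¹ x) (act A⁻¹ y) = mink x y := by
      intro x y
      rw [← h1, e, e]
    refine ⟨h3, fun x hx => ?_⟩
    have h4 : mink (act A⁻¹ x) (act A⁻¹ x) = -1 := by rw [h3, hx.1]
    refine ⟨h4, ?_⟩
    -- If the preimage of `x` were in the past, its negative would be a point of the hyperbolic
    -- plane that `A` sends to `-x`.
    by_contra! hn
    have h5 : (act A⁻¹ x) 0 < 0 := by
      rcases hn.lt_or_eq with h | h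
      · exact h
      · simp only [mink, h] at h4
        nlinarith [sq_nonneg ((act A⁻¹ x) 1), sq_nonneg ((act A⁻¹ x) 2)]
    have h6 : -(act A⁻¹ x) ∈ hypPlane := by
      refine ⟨?_, ?_⟩
      · rw [← h4]; simp [mink]
      · simpa using h5
    have h7 := (h2 _ h6).2
    rw [act_neg, e, Pi.neg_apply] at h7
    linarith [hx.2]

lemma det3_act (A : SpecialLinearGroup (Fin 3) ℝ) (x y z : Mink) :
    det3 (act A x) (act A y) (act A z) = det3 x y z := by
  have h : Matrix.of ![act A x, act A y, act A z] = Matrix.of ![x, y, z] * A.1ᵀ := by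
    ext i j
    fin_cases i <;> simp [act, Matrix.mul_apply, Matrix.mulVec, dotProduct, mul_comm]
  rw [det3, h, det_mul, det_transpose, A.2, mul_one, det3]

/-- Lagrange's identity for the spatial parts gives the reversed Cauchy–Schwarz inequality between a
timelike and a causal future vector. -/
lemma mink_neg_of_future {x n : Mink} (hx : x ∈ hypPlane) (hn : mink n n ≤ 0) (h0 : 0 < n 0) :
    mink x n < 0 := by
  have h1 := hx.1
  have h2 := hx.2
  simp only [mink] at *
  have h3 : (x 1 * n 1 + x 2 * n 2) ^ 2 < (x 0 * n 0) ^ 2 := by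
    have : (x 1 * n 1 + x 2 * n 2) ^ 2 + (x 1 * n 2 - x 2 * n 1) ^ 2 =
      (x 0 * x 0 - 1) * (n 1 * n 1 + n 2 * n 2) := by
      linear_combination (n 1 * n 1 + n 2 * n 2) * h1
    have h4 : 1 ≤ x 0 * x 0 := by nlinarith [sq_nonneg (x 1), sq_nonneg (x 2)]
    have h5 : (x 0 * x 0 - 1) * (n 1 * n 1 + n 2 * n 2) ≤ (x 0 * x 0 - 1) * (n 0 * n 0) :=
      mul_le_mul_of_nonneg_left (by linarith) (by linarith)
    nlinarith [sq_nonneg (x 1 * n 2 - x 2 * n 1), mul_pos h0 h0]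
  have := abs_lt_of_sq_lt_sq h3 (by positivity)
  linarith [(abs_lt.1 this).2]

lemma mem_hypPlane_of_mink_neg {x n : Mink} (hx : mink x x = -1) (hn : mink n n ≤ 0)
    (h0 : 0 < n 0) (h : mink x n < 0) : x ∈ hypPlane := by
  refine ⟨hx, ?_⟩
  by_contra! hh
  have h5 : x 0 < 0 := by
    rcases hh.lt_or_eq with h | h
    · exact h
    · simp only [mink, h] at hx
      nlinarith [sq_nonneg (x 1), sq_nonneg (x 2)]
  have h6 : -x ∈ hypPlane := by
    refine ⟨?_, ?_⟩
    · rw [← hx]; simp [mink]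
    · simpa using h5
  have h7 := mink_neg_of_future h6 hn h0
  have h8 : mink (-x) n = -mink x n := by simp [mink]; ring
  rw [h8] at h7
  linarith

/-- For an isometry, preservation of the time orientation can be tested on a single future vector
that is timelike or isotropic. The isotropic case is needed for ideal centers. -/
lemma mem_lorentz_of_future {A : SpecialLinearGroup (Fin 3) ℝ}
    (hA : ∀ x y : Mink, mink (act A x) (act A y) = mink x y) {n : Mink}
    (hn : mink n n ≤ 0) (h0 : 0 < n 0) (h1 : 0 < (act A n) 0) : A ∈ lorentz := by
  refine ⟨hA, fun x hx => ?_⟩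
  refine mem_hypPlane_of_mink_neg (by rw [hA, hx.1]) (n := act A n) (by rw [hA]; exact hn) h1 ?_
  rw [hA]
  exact mink_neg_of_future hx hn h0

/-- The Lorentzian cross product. -/
def crossM (x y : Mink) : Mink :=
  ![-(x 1 * y 2 - x 2 * y 1), x 2 * y 0 - x 0 * y 2, x 0 * y 1 - x 1 * y 0]

/-- The matrix with the columns `x`, `y` and their cross product. -/
def crossMatrix (x y : Mink) : Matrix (Fin 3) (Fin 3) ℝ := (Matrix.of ![x, y, crossM x y])ᵀ

lemma det_crossMatrix (x y : Mink) :
    (crossMatrix x y).det = mink x y ^ 2 - mink x x * mink y y := by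
  rw [crossMatrix, det_transpose]
  change det3 x y (crossM x y) = _
  simp [det3_eq, crossM, mink]
  ring

lemma crossMatrix_mulVec (x y u : Mink) :
    crossMatrix x y *ᵥ u = u 0 • x + u 1 • y + u 2 • crossM x y := by
  ext i
  simp [crossMatrix, mulVec, dotProduct, Fin.sum_univ_three]
  ring

lemma mink_crossMatrix_mulVec (x y u w : Mink) :
    mink (crossMatrix x y *ᵥ u) (crossMatrix x y *ᵥ w) =
      u 0 * w 0 * mink x x + (u 0 * w 1 + u 1 * w 0) * mink x y + u 1 * w 1 * mink y y +
        u 2 * w 2 * (mink x y ^ 2 - mink x x * mink y y) := by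
  rw [crossMatrix_mulVec, crossMatrix_mulVec]
  simp [mink, crossM]
  ring

/-- Two pairs of vectors with the same Gram matrix are related by a Lorentz transformation. -/
lemma exists_lorentz {k k' n n' : Mink} (h1 : mink k k = mink n n) (h2 : mink k k' = mink n n')
    (h3 : mink k' k' = mink n' n') (hΔ : 0 < mink k k' ^ 2 - mink k k * mink k' k')
    (hk : mink k k ≤ 0) (hk0 : 0 < k 0) (hn0 : 0 < n 0) :
    ∃ A ∈ lorentz, act A k = n ∧ act A k' = n' := by
  have hu : IsUnit (crossMatrix k k').det := by
    rw [det_crossMatrix]; exact hΔ.ne'.isUnit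
  have e : ∀ u, (crossMatrix n n' * (crossMatrix k k')⁻¹) *ᵥ (crossMatrix k k' *ᵥ u) =
      crossMatrix n n' *ᵥ u := by
    intro u
    rw [mulVec_mulVec, mul_assoc, nonsing_inv_mul _ hu, mul_one]
  have e' : ∀ x : Mink, ∃ u, x = crossMatrix k k' *ᵥ u := fun x =>
    ⟨(crossMatrix k k')⁻¹ *ᵥ x, by rw [mulVec_mulVec, mul_nonsing_inv _ hu, one_mulVec]⟩
  have ek : crossMatrix k k' *ᵥ ![1, 0, 0] = k := by rw [crossMatrix_mulVec]; simp
  have ek' : crossMatrix k k' *ᵥ ![0, 1, 0] = k' := by rw [crossMatrix_mulVec]; simp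
  have en : crossMatrix n n' *ᵥ ![1, 0, 0] = n := by rw [crossMatrix_mulVec]; simp
  have en' : crossMatrix n n' *ᵥ ![0, 1, 0] = n' := by rw [crossMatrix_mulVec]; simp
  -- The determinants of the two matrices are functions of the Gram matrices, which agree.
  have hdet : (crossMatrix n n' * (crossMatrix k k')⁻¹).det = 1 := by
    rw [det_mul, det_crossMatrix, ← h1, ← h2, ← h3, ← det_crossMatrix, ← det_mul,
      mul_nonsing_inv _ hu, det_one]
  have f1 : (crossMatrix n n' * (crossMatrix k k')⁻¹) *ᵥ k = n := by
    have := e ![1, 0, 0]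
    rwa [ek, en] at this
  have f2 : (crossMatrix n n' * (crossMatrix k k')⁻¹) *ᵥ k' = n' := by
    have := e ![0, 1, 0]
    rwa [ek', en'] at this
  obtain ⟨A, hA⟩ := exists_act_eq hdet
  refine ⟨A, mem_lorentz_of_future (n := k) ?_ hk hk0 ?_, (hA k).trans f1, (hA k').trans f2⟩
  · intro x y
    obtain ⟨u, rfl⟩ := e' x
    obtain ⟨w, rfl⟩ := e' y
    rw [hA, hA, e, e, mink_crossMatrix_mulVec, mink_crossMatrix_mulVec, h1, h2, h3]
  · rw [hA, f1]
    exact hn0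

/-- Proper Lorentz transformations commute with the cross product, as it represents the invariant
determinant. The images of `k` and `k'` therefore fix that of a third basis vector. -/
lemma lorentz_eq {A B : SpecialLinearGroup (Fin 3) ℝ} (hA : A ∈ lorentz) (hB : B ∈ lorentz)
    {k k' : Mink} (hΔ : 0 < mink k k' ^ 2 - mink k k * mink k' k')
    (h1 : act A k = act B k) (h2 : act A k' = act B k') : A = B := by
  have hu : IsUnit (crossMatrix k k').det := by
    rw [det_crossMatrix]; exact hΔ.ne'.isUnit
  have cross : ∀ C ∈ lorentz, act C (crossM k k') = crossM (act C k) (act C k') := by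
    intro C hC
    have nd : ∀ x y : Mink, (∀ z, mink x (act C z) = mink y (act C z)) → x = y := by
      intro x y h
      have h' : ∀ z, mink x z = mink y z := by
        intro z
        have := h (act C⁻¹ z)
        rwa [act_act_inv] at this
      ext i
      have g0 := h' ![1, 0, 0]
      have g1 := h' ![0, 1, 0]
      have g2 := h' ![0, 0, 1]
      simp [mink] at g0 g1 g2
      fin_cases i
      · exact g0
      · exact g1
      · exact g2
    have md : ∀ x y z : Mink, mink (crossM x y) z = det3 x y z := by
      intro x y z
      simp [mink, crossM, det3_eq]
      ring
    apply nd
    intro z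
    rw [hC.1, md, md, det3_act]
  have key : ∀ x : Mink, act A x = act B x := by
    intro x
    have e : x = crossMatrix k k' *ᵥ ((crossMatrix k k')⁻¹ *ᵥ x) := by
      rw [mulVec_mulVec, mul_nonsing_inv _ hu, one_mulVec]
    rw [e, crossMatrix_mulVec]
    simp only [act_add, act_smul]
    rw [cross A hA, cross B hB, h1, h2]
  apply Subtype.ext
  exact Matrix.ext_of_mulVec_single fun i => key _

end RingPattern
end
noncomputable section

namespace RingPattern

open Real Matrix

/-! ### Frames along the square complex -/

/-- The scaled center of the ring `γ`, seen from a touching point on its inner circle. -/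
def horVec (q γ ε : ℝ) : Mink := ![1, -(ε * cn q γ), 0]

/-- The scaled center of the ring `γ`, seen from a touching point on its outer circle. -/
def verVec (q γ δ : ℝ) : Mink := ![1 / q, 0, -(δ * dn q γ / q)]

lemma mink_horVec_self (q γ : ℝ) {ε : ℝ} (hε : ε = 1 ∨ ε = -1) :
    mink (horVec q γ ε) (horVec q γ ε) = -sn q γ ^ 2 := by
  have := cn_sq q γ
  rcases hε with rfl | rfl <;> simp [mink, horVec] <;> linarith

lemma mink_verVec_self {q : ℝ} (hq0 : 0 < q) (hq1 : q ≤ 1) (γ : ℝ) {δ : ℝ}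
    (hδ : δ = 1 ∨ δ = -1) : mink (verVec q γ δ) (verVec q γ δ) = -sn q γ ^ 2 := by
  have := dn_sq hq0.le hq1 γ
  rcases hδ with rfl | rfl <;> simp [mink, verVec] <;> field_simp <;> linarith

lemma mink_horVec_verVec (q γ γ' ε δ : ℝ) :
    mink (horVec q γ ε) (verVec q γ' δ) = -(1 / q) := by
  simp [mink, horVec, verVec]

lemma verVec_horVec_gram {q : ℝ} (hq0 : 0 < q) (hq1 : q ≤ 1) (γ γ' : ℝ) {ε δ : ℝ}
    (hε : ε = 1 ∨ ε = -1) (hδ : δ = 1 ∨ δ = -1) :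
    0 < mink (verVec q γ δ) (horVec q γ' ε) ^ 2 -
      mink (verVec q γ δ) (verVec q γ δ) * mink (horVec q γ' ε) (horVec q γ' ε) := by
  rw [mink_comm, mink_horVec_verVec, mink_verVec_self hq0 hq1 γ hδ, mink_horVec_self q γ' hε]
  have h := addDenom_pos hq0.le hq1 γ γ'
  have e : (-(1 / q)) ^ 2 - -sn q γ ^ 2 * -sn q γ' ^ 2 =
      (1 - q ^ 2 * sn q γ ^ 2 * sn q γ' ^ 2) / q ^ 2 := by field_simp
  rw [e]
  positivity

/-- The two vectors are the scaled centers of the two rings of a square, described in the frame at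
one touching point and in the frame at the other. The Gram matrix is the same in both descriptions.
-/
lemma exists_transition {q : ℝ} (hq0 : 0 < q) (hq1 : q ≤ 1) (γ γ' : ℝ) (d : ℤˣ × ℤˣ) :
    ∃ A ∈ lorentz, act A (verVec q γ ((d.2 : ℤ) : ℝ)) = horVec q γ ((d.1 : ℤ) : ℝ) ∧
      act A (horVec q γ' (-((d.1 : ℤ) : ℝ))) = verVec q γ' (-((d.2 : ℤ) : ℝ)) := by
  have h1 := units_cast_eq d.1
  have h2 := units_cast_eq d.2
  have h1' : -((d.1 : ℤ) : ℝ) = 1 ∨ -((d.1 : ℤ) : ℝ) = -1 := by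
    rcases h1 with h | h <;> simp [h]
  have h2' : -((d.2 : ℤ) : ℝ) = 1 ∨ -((d.2 : ℤ) : ℝ) = -1 := by
    rcases h2 with h | h <;> simp [h]
  refine exists_lorentz ?_ ?_ ?_ (verVec_horVec_gram hq0 hq1 γ γ' h1' h2) ?_ ?_ ?_
  · rw [mink_verVec_self hq0 hq1 γ h2, mink_horVec_self q γ h1]
  · rw [mink_comm, mink_horVec_verVec, mink_horVec_verVec]
  · rw [mink_verVec_self hq0 hq1 γ' h2', mink_horVec_self q γ' h1']
  · rw [mink_verVec_self hq0 hq1 γ h2]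
    nlinarith [sq_nonneg (sn q γ)]
  · simp [verVec, hq0]
  · simp [horVec]

open Classical in
/-- The transition in the square between the rings `γ` and `γ'`, from the frame at the vertical
touching point of `γ` to the frame at the horizontal one. -/
def transition (q γ γ' : ℝ) (d : ℤˣ × ℤˣ) : SpecialLinearGroup (Fin 3) ℝ :=
  if h : 0 < q ∧ q ≤ 1 then (exists_transition h.1 h.2 γ γ' d).choose else 1

lemma transition_spec {q : ℝ} (hq0 : 0 < q) (hq1 : q ≤ 1) (γ γ' : ℝ) (d : ℤˣ × ℤˣ) :
    transition q γ γ' d ∈ lorentz ∧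
      act (transition q γ γ' d) (verVec q γ ((d.2 : ℤ) : ℝ)) = horVec q γ ((d.1 : ℤ) : ℝ) ∧
      act (transition q γ γ' d) (horVec q γ' (-((d.1 : ℤ) : ℝ))) =
        verVec q γ' (-((d.2 : ℤ) : ℝ)) := by
  rw [transition, dif_pos ⟨hq0, hq1⟩]
  exact (exists_transition hq0 hq1 γ γ' d).choose_spec

lemma eq_transition {q : ℝ} (hq0 : 0 < q) (hq1 : q ≤ 1) {γ γ' : ℝ} {d : ℤˣ × ℤˣ}
    {A : SpecialLinearGroup (Fin 3) ℝ} (hA : A ∈ lorentz)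
    (h1 : act A (verVec q γ ((d.2 : ℤ) : ℝ)) = horVec q γ ((d.1 : ℤ) : ℝ))
    (h2 : act A (horVec q γ' (-((d.1 : ℤ) : ℝ))) = verVec q γ' (-((d.2 : ℤ) : ℝ))) :
    A = transition q γ γ' d := by
  obtain ⟨t1, t2, t3⟩ := transition_spec hq0 hq1 γ γ' d
  have h1' : -((d.1 : ℤ) : ℝ) = 1 ∨ -((d.1 : ℤ) : ℝ) = -1 := by
    rcases units_cast_eq d.1 with h | h <;> simp [h]
  exact lorentz_eq hA t1 (verVec_horVec_gram hq0 hq1 γ γ' h1' (units_cast_eq d.2))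
    (h1.trans t2.symm) (h2.trans t3.symm)

/-- From the opposite even corner the horizontal and vertical touching points are interchanged, and
the inverse satisfies the characterizing equations. -/
lemma transition_neg {q : ℝ} (hq0 : 0 < q) (hq1 : q ≤ 1) (γ γ' : ℝ) (d : ℤˣ × ℤˣ) :
    transition q γ' γ (-d) = (transition q γ γ' d)⁻¹ := by
  obtain ⟨t1, t2, t3⟩ := transition_spec hq0 hq1 γ γ' d
  symm
  apply eq_transition hq0 hq1 (lorentz.inv_mem t1)
  · have e1 : (((-d).1 : ℤ) : ℝ) = -((d.1 : ℤ) : ℝ) := by simp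
    have e2 : (((-d).2 : ℤ) : ℝ) = -((d.2 : ℤ) : ℝ) := by simp
    rw [e1, e2, ← t3, act_inv_act]
  · have e1 : -(((-d).1 : ℤ) : ℝ) = ((d.1 : ℤ) : ℝ) := by simp
    have e2 : -(((-d).2 : ℤ) : ℝ) = ((d.2 : ℤ) : ℝ) := by simp
    rw [e1, e2, ← t2, act_inv_act]

/-- The frames at the four vertices next to an even vertex. -/
structure IsStar (q γ : ℝ) (γ' : ℤˣ × ℤˣ → ℝ) (D : Set (ℤˣ × ℤˣ))
    (hor ver : ℤˣ → SpecialLinearGroup (Fin 3) ℝ) (K : Mink) : Prop where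
  hor_mem : ∀ e, hor e ∈ lorentz
  ver_mem : ∀ e, ver e ∈ lorentz
  act_hor : ∀ e : ℤˣ, act (hor e) (horVec q γ ((e : ℤ) : ℝ)) = K
  act_ver : ∀ e : ℤˣ, act (ver e) (verVec q γ ((e : ℤ) : ℝ)) = K
  eq : ∀ d ∈ D, ver d.2 = hor d.1 * transition q γ (γ' d) d

/-- With one square missing the cycle of four frames is cut to a chain. Starting from the identity
at the horizontal vertex of the missing square, three transitions define the other frames, and
nothing remains to be checked at the cut. -/
lemma exists_isStar_of_notMem {q : ℝ} (hq0 : 0 < q) (hq1 : q ≤ 1) (γ : ℝ) (γ' : ℤˣ × ℤˣ → ℝ)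
    {D : Set (ℤˣ × ℤˣ)} {d₀ : ℤˣ × ℤˣ} (hd : d₀ ∉ D) :
    ∃ hor ver K, IsStar q γ γ' D hor ver K := by
  set T := fun d => transition q γ (γ' d) d with hT
  have ts := fun d => transition_spec hq0 hq1 γ (γ' d) d
  obtain ⟨e, f⟩ := d₀
  have ne : ∀ x : ℤˣ, x ≠ -x := fun x => by
    rcases Int.units_eq_one_or x with rfl | rfl <;> decide
  have cases_eq : ∀ x y : ℤˣ, y = x ∨ y = -x := fun x y => by
    rcases Int.units_eq_one_or x with rfl | rfl <;>
      rcases Int.units_eq_one_or y with rfl | rfl <;> simp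
  set V1 := T (e, -f) with hV1
  set H2 := V1 * (T (-e, -f))⁻¹ with hH2
  set V2 := H2 * T (-e, f) with hV2
  have mV1 : V1 ∈ lorentz := (ts _).1
  have mH2 : H2 ∈ lorentz := lorentz.mul_mem mV1 (lorentz.inv_mem (ts _).1)
  have mV2 : V2 ∈ lorentz := lorentz.mul_mem mH2 (ts _).1
  have aV1 : act V1 (verVec q γ (((-f : ℤˣ) : ℤ) : ℝ)) = horVec q γ ((e : ℤ) : ℝ) := (ts (e, -f)).2.1
  have aH2 : act H2 (horVec q γ (((-e : ℤˣ) : ℤ) : ℝ)) = horVec q γ ((e : ℤ) : ℝ) := by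
    rw [hH2, act_mul, ← aV1]
    congr 1
    have := (ts (-e, -f)).2.1
    simp only at this
    rw [← this, act_inv_act]
  have aV2 : act V2 (verVec q γ ((f : ℤ) : ℝ)) = horVec q γ ((e : ℤ) : ℝ) := by
    rw [hV2, act_mul, ← aH2]
    congr 1
    exact (ts (-e, f)).2.1
  refine ⟨fun x => if x = e then 1 else H2, fun x => if x = f then V2 else V1,
    horVec q γ ((e : ℤ) : ℝ), ⟨?_, ?_, ?_, ?_, ?_⟩⟩
  · intro x
    split_ifs
    · exact lorentz.one_mem
    · exact mH2
  · intro x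
    split_ifs
    · exact mV2
    · exact mV1
  · intro x
    rcases cases_eq e x with rfl | rfl
    · rw [if_pos rfl, act_one]
    · rw [if_neg (ne e).symm, aH2]
  · intro x
    rcases cases_eq f x with rfl | rfl
    · rw [if_pos rfl, aV2]
    · rw [if_neg (ne f).symm, aV1]
  · rintro ⟨x, y⟩ hxy
    rcases cases_eq e x with rfl | rfl <;> rcases cases_eq f y with rfl | rfl
    · exact absurd hxy hd
    · rw [if_pos rfl, if_neg (ne f).symm, one_mul]
    · rw [if_pos rfl, if_neg (ne e).symm]
    · rw [if_neg (ne f).symm, if_neg (ne e).symm, hH2]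
      simp only [hT]
      group

/-! ### The star of an internal vertex -/

/-- The rotations about the base point of the hyperbolic plane. -/
lemma exists_rotation (φ : ℝ) : ∃ A ∈ lorentz, ∀ x : Mink, act A x =
    ![x 0, cos φ * x 1 - sin φ * x 2, sin φ * x 1 + cos φ * x 2] := by
  have h := sin_sq_add_cos_sq φ
  obtain ⟨A, hA⟩ := exists_act_eq (M := !![1, 0, 0; 0, cos φ, -sin φ; 0, sin φ, cos φ])
    (by simp [det_fin_three]; linarith)
  have hA' : ∀ x : Mink, act A x =
      ![x 0, cos φ * x 1 - sin φ * x 2, sin φ * x 1 + cos φ * x 2] := by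
    intro x
    rw [hA]
    ext i
    fin_cases i <;> simp [mulVec, dotProduct, Fin.sum_univ_three]
    ring
  refine ⟨A, mem_lorentz_of_future (n := ![1, 0, 0]) (fun x y => ?_) (by simp [mink]) (by simp)
    (by rw [hA']; simp), hA'⟩
  rw [hA', hA']
  simp [mink]
  linear_combination (x 1 * y 1 + x 2 * y 2) * h

/-- The translation that centers the ring `γ`, seen from a point of the inner circle. -/
lemma exists_horBoost {q γ ε : ℝ} (hs : 0 < sn q γ) (hε : ε = 1 ∨ ε = -1) :
    ∃ A ∈ lorentz, ∀ x : Mink, act A x = ![(x 0 + ε * cn q γ * x 1) / sn q γ,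
      (ε * cn q γ * x 0 + x 1) / sn q γ, x 2] := by
  have hc := cn_sq q γ
  have hs0 := hs.ne'
  have hε2 : ε ^ 2 = 1 := by rcases hε with rfl | rfl <;> norm_num
  obtain ⟨A, hA⟩ := exists_act_eq (M := !![1 / sn q γ, ε * cn q γ / sn q γ, 0;
    ε * cn q γ / sn q γ, 1 / sn q γ, 0; 0, 0, 1])
    (by simp [det_fin_three]; field_simp; rw [hε2, hc]; ring)
  have hA' : ∀ x : Mink, act A x = ![(x 0 + ε * cn q γ * x 1) / sn q γ,
      (ε * cn q γ * x 0 + x 1) / sn q γ, x 2] := by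
    intro x
    rw [hA]
    ext i
    fin_cases i <;> simp [mulVec, dotProduct, Fin.sum_univ_three] <;> ring
  refine ⟨A, mem_lorentz_of_future (n := ![1, 0, 0]) (fun x y => ?_) (by simp [mink]) (by simp)
    (by rw [hA']; simp [hs]), hA'⟩
  rw [hA', hA']
  simp [mink]
  field_simp
  linear_combination (x 0 * y 0 - x 1 * y 1) * cn q γ ^ 2 * hε2 + (x 0 * y 0 - x 1 * y 1) * hc

/-- The translation that centers the ring `γ`, seen from a point of the outer circle. -/
lemma exists_verBoost {q γ δ : ℝ} (hq0 : 0 < q) (hq1 : q ≤ 1) (hs : 0 < sn q γ)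
    (hδ : δ = 1 ∨ δ = -1) :
    ∃ A ∈ lorentz, ∀ x : Mink, act A x = ![(x 0 + δ * dn q γ * x 2) / (q * sn q γ), x 1,
      (δ * dn q γ * x 0 + x 2) / (q * sn q γ)] := by
  have hd := dn_sq hq0.le hq1 γ
  have hs0 := hs.ne'
  have hδ2 : δ ^ 2 = 1 := by rcases hδ with rfl | rfl <;> norm_num
  obtain ⟨A, hA⟩ := exists_act_eq (M := !![1 / (q * sn q γ), 0, δ * dn q γ / (q * sn q γ);
    0, 1, 0; δ * dn q γ / (q * sn q γ), 0, 1 / (q * sn q γ)])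
    (by simp [det_fin_three]; field_simp; rw [hδ2, hd]; ring)
  have hA' : ∀ x : Mink, act A x = ![(x 0 + δ * dn q γ * x 2) / (q * sn q γ), x 1,
      (δ * dn q γ * x 0 + x 2) / (q * sn q γ)] := by
    intro x
    rw [hA]
    ext i
    fin_cases i <;> simp [mulVec, dotProduct, Fin.sum_univ_three] <;> field_simp
  refine ⟨A, mem_lorentz_of_future (n := ![1, 0, 0]) (fun x y => ?_) (by simp [mink]) (by simp)
    (by rw [hA']; simp; positivity), hA'⟩
  rw [hA', hA']
  simp [mink]
  field_simp
  linear_combination (x 0 * y 0 - x 2 * y 2) * dn q γ ^ 2 * hδ2 + (x 0 * y 0 - x 2 * y 2) * hd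

/-- The direction of the neighboring ring, seen from the two touching points. -/
lemma rotation_direction {q γ γ' ε δ : ℝ} (hq0 : 0 < q) (hq1 : q ≤ 1) (hs : 0 < sn q γ)
    (hε : ε = 1 ∨ ε = -1) (hδ : δ = 1 ∨ δ = -1) :
    cos (ε * δ * (nominalAngle q γ γ' - π / 2)) * (ε * cn q γ') -
      sin (ε * δ * (nominalAngle q γ γ' - π / 2)) * (δ * dn q γ / (q * sn q γ)) =
      ε * cn q γ / (q * sn q γ) ∧
    sin (ε * δ * (nominalAngle q γ γ' - π / 2)) * (ε * cn q γ') +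
      cos (ε * δ * (nominalAngle q γ γ' - π / 2)) * (δ * dn q γ / (q * sn q γ)) =
      δ * dn q γ' / q := by
  obtain ⟨n1, n2⟩ := nominalAngle_spec hq0 hq1 γ γ'
  have hD := (addDenom_pos hq0.le hq1 γ γ').ne'
  have hs0 := hs.ne'
  have c2 := cn_sq q γ'
  have d1 := dn_sq hq0.le hq1 γ
  set θ := nominalAngle q γ γ'
  set D := 1 - q ^ 2 * sn q γ ^ 2 * sn q γ' ^ 2 with hDdef
  have hcs : cos (ε * δ * (θ - π / 2)) = sin θ ∧
      sin (ε * δ * (θ - π / 2)) = -(ε * δ * cos θ) := by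
    rcases hε with rfl | rfl <;> rcases hδ with rfl | rfl <;>
      simp [cos_sub_pi_div_two, sin_sub_pi_div_two, cos_pi_div_two_sub, sin_pi_div_two_sub]
  have hε2 : ε ^ 2 = 1 := by rcases hε with rfl | rfl <;> norm_num
  have hδ2 : δ ^ 2 = 1 := by rcases hδ with rfl | rfl <;> norm_num
  rw [hcs.1, hcs.2]
  have g1 : sin θ * cn q γ' * (q * sn q γ) + cos θ * dn q γ = cn q γ := by
    apply mul_left_cancel₀ hD
    linear_combination (cn q γ' * (q * sn q γ)) * n2 + dn q γ * n1 +
      (q ^ 2 * sn q γ ^ 2 * cn q γ) * c2 + cn q γ * d1 - cn q γ * hDdef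
  have g2 : -cos θ * cn q γ' * (q * sn q γ) + sin θ * dn q γ = dn q γ' * sn q γ := by
    apply mul_left_cancel₀ hD
    linear_combination -(cn q γ' * (q * sn q γ)) * n1 + dn q γ * n2 +
      (q ^ 2 * sn q γ ^ 3 * dn q γ') * c2 + sn q γ * dn q γ' * d1 - sn q γ * dn q γ' * hDdef
  constructor
  · field_simp
    rw [hδ2]
    linear_combination ε * g1
  · field_simp
    rw [hε2]
    linear_combination δ * g2

/-- The boosts `X` and `Y` move the center of the ring to the base point, leaving a rotation free
for each of the four frames. The relation on a square fixes the difference of two rotation angles as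
`±(θ - π / 2)`, because the axes of the two frames already differ by a right angle. The four
differences are compatible exactly when the angles add up to `2π`. -/
lemma exists_isStar_of_sum_eq {q : ℝ} (hq0 : 0 < q) (hq1 : q ≤ 1) {γ : ℝ} {γ' : ℤˣ × ℤˣ → ℝ}
    (hs : 0 < sn q γ) (hsum : ∑ d, nominalAngle q γ (γ' d) = 2 * π) (D : Set (ℤˣ × ℤˣ)) :
    ∃ hor ver K, IsStar q γ γ' D hor ver K := by
  rw [sum_dirs] at hsum
  choose X X_mem hX using fun e : ℤˣ => exists_horBoost hs (units_cast_eq e)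
  choose Y Y_mem hY using fun e : ℤˣ => exists_verBoost hq0 hq1 hs (units_cast_eq e)
  choose R R_mem hR using exists_rotation
  have hs0 := hs.ne'
  have hc := cn_sq q γ
  have hd := dn_sq hq0.le hq1 γ
  have X_hor : ∀ e : ℤˣ, act (X e) (horVec q γ ((e : ℤ) : ℝ)) = ![sn q γ, 0, 0] := by
    intro e
    rw [hX]
    ext i
    fin_cases i
    · rcases units_cast_eq e with h | h <;> simp [horVec, h] <;> field_simp <;> linarith
    · simp [horVec]
    · simp [horVec]
  have Y_ver : ∀ e : ℤˣ, act (Y e) (verVec q γ ((e : ℤ) : ℝ)) = ![sn q γ, 0, 0] := by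
    intro e
    rw [hY]
    ext i
    fin_cases i
    · rcases units_cast_eq e with h | h <;> simp [verVec, h] <;> field_simp <;> linarith
    · simp [verVec]
    · simp [verVec]
      field_simp
      simp
  have R_fix : ∀ φ, act (R φ) ![sn q γ, 0, 0] = ![sn q γ, 0, 0] := by
    intro φ
    rw [hR]
    simp
  have R_add : ∀ φ ψ x, act (R (φ + ψ)) x = act (R φ) (act (R ψ) x) := by
    intro φ ψ x
    rw [hR, hR, hR, cos_add, sin_add]
    ext i
    fin_cases i <;> simp <;> ring
  set θ := fun d => nominalAngle q γ (γ' d) with hθ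
  -- Normalized by `ρ 1 = 0`, the squares `(1, 1)`, `(1, -1)` and `(-1, 1)` determine all angles;
  -- the angle sum is used for `(-1, -1)`.
  obtain ⟨ρ, hρ⟩ : ∃ ρ : ℤˣ → ℝ, ρ 1 = 0 ∧ ρ (-1) = θ (1, 1) + θ (-1, 1) - π :=
    ⟨fun e => if e = 1 then 0 else θ (1, 1) + θ (-1, 1) - π, if_pos rfl, if_neg (by decide)⟩
  obtain ⟨σ, hσ⟩ : ∃ σ : ℤˣ → ℝ, σ 1 = θ (1, 1) - π / 2 ∧ σ (-1) = π / 2 - θ (1, -1) :=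
    ⟨fun e => if e = 1 then θ (1, 1) - π / 2 else π / 2 - θ (1, -1), if_pos rfl,
      if_neg (by decide)⟩
  have hσρ : ∀ d : ℤˣ × ℤˣ, σ d.2 = ρ d.1 + ((d.1 : ℤ) : ℝ) * ((d.2 : ℤ) : ℝ) *
      (θ d - π / 2) := by
    rintro ⟨e, f⟩
    change θ (1, 1) + θ (-1, 1) + θ (-1, -1) + θ (1, -1) = 2 * π at hsum
    rcases Int.units_eq_one_or e with rfl | rfl <;>
      rcases Int.units_eq_one_or f with rfl | rfl <;>
      simp only [hρ.1, hρ.2, hσ.1, hσ.2] <;> push_cast <;> linarith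
  refine ⟨fun e => R (ρ e) * X e, fun e => R (σ e) * Y e, ![sn q γ, 0, 0], ⟨?_, ?_, ?_, ?_, ?_⟩⟩
  · exact fun e => lorentz.mul_mem (R_mem _) (X_mem _)
  · exact fun e => lorentz.mul_mem (R_mem _) (Y_mem _)
  · intro e
    rw [act_mul, X_hor, R_fix]
  · intro e
    rw [act_mul, Y_ver, R_fix]
  · intro d _
    -- By uniqueness it suffices to follow two vectors: the ring's own center, which both frames
    -- send to the base axis, and the center of the neighbor, covered by `rotation_direction`.
    have : (R (ρ d.1) * X d.1)⁻¹ * (R (σ d.2) * Y d.2) = transition q γ (γ' d) d := by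
      apply eq_transition hq0 hq1 (lorentz.mul_mem (lorentz.inv_mem
        (lorentz.mul_mem (R_mem _) (X_mem _))) (lorentz.mul_mem (R_mem _) (Y_mem _)))
      · have keyX : act (R (ρ d.1) * X d.1) (horVec q γ ((d.1 : ℤ) : ℝ)) = ![sn q γ, 0, 0] := by
          rw [act_mul, X_hor, R_fix]
        have keyY : act (R (σ d.2) * Y d.2) (verVec q γ ((d.2 : ℤ) : ℝ)) = ![sn q γ, 0, 0] := by
          rw [act_mul, Y_ver, R_fix]
        rw [act_mul, keyY, ← keyX, act_inv_act]
      · obtain ⟨r1, r2⟩ := rotation_direction (γ' := γ' d) hq0 hq1 hs (units_cast_eq d.1)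
          (units_cast_eq d.2)
        have key : act (R (σ d.2) * Y d.2) (horVec q (γ' d) (-((d.1 : ℤ) : ℝ))) =
            act (R (ρ d.1) * X d.1) (verVec q (γ' d) (-((d.2 : ℤ) : ℝ))) := by
          rw [act_mul, act_mul, hσρ, R_add]
          congr 1
          rw [hR, hX, hY]
          ext i
          fin_cases i
          · simp [horVec, verVec]
            field_simp
          · simp only [horVec, verVec]
            simp
            simp only [hθ]
            convert r1 using 1
            · ring
          · simp only [horVec, verVec]
            simp
            simp only [hθ]
            convert r2 using 1
            ring
        rw [act_mul, key, act_inv_act]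
    rw [← this, mul_inv_cancel_left]

end RingPattern
end
noncomputable section

namespace RingPattern

open Real Matrix

/-! ### The frames of a ring pattern -/

section Connection

variable {G : Type*}

/-- The frame at `w`, relative to the frame at the vertex `v` next to it. -/
def edgeFrame (hor ver : ℤ × ℤ → ℤˣ → G) (v w : ℤ × ℤ) : G :=
  if w.2 = v.2 then hor v (if w.1 = v.1 + 1 then 1 else -1)
  else ver v (if w.2 = v.2 + 1 then 1 else -1)

lemma edgeFrame_horNbr (hor ver : ℤ × ℤ → ℤˣ → G) (v : ℤ × ℤ) (d : ℤˣ × ℤˣ) :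
    edgeFrame hor ver v (horNbr v d) = hor v d.1 := by
  rcases Int.units_eq_one_or d.1 with h | h <;> simp [edgeFrame, horNbr, h]

lemma edgeFrame_verNbr (hor ver : ℤ × ℤ → ℤˣ → G) (v : ℤ × ℤ) (d : ℤˣ × ℤˣ) :
    edgeFrame hor ver v (verNbr v d) = ver v d.2 := by
  rcases Int.units_eq_one_or d.2 with h | h <;> simp [edgeFrame, verNbr, h]

variable [Group G]

/-- The transition between the frames at adjacent vertices. -/
def connection (hor ver : ℤ × ℤ → ℤˣ → G) (u v : ℤ × ℤ) : G :=
  if Even (u.1 + u.2) then edgeFrame hor ver u v else (edgeFrame hor ver v u)⁻¹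

lemma abs_add_abs_eq_one {x y : ℤ} (h : |x| + |y| = 1) :
    (y = 0 ∧ (x = 1 ∨ x = -1)) ∨ (x = 0 ∧ (y = 1 ∨ y = -1)) := by
  rcases abs_cases x with hx | hx <;> rcases abs_cases y with hy | hy <;> omega

lemma even_iff_not_even_of_adj {S : Set (ℤ × ℤ)} {u v : ℤ × ℤ} (h : (skeleton S).Adj u v) :
    Even (u.1 + u.2) ↔ ¬ Even (v.1 + v.2) := by
  have := abs_add_abs_eq_one h.1
  rw [Int.even_iff, Int.even_iff]
  omega

lemma connection_mul_connection {S : Set (ℤ × ℤ)} (hor ver : ℤ × ℤ → ℤˣ → G) {u v : ℤ × ℤ}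
    (h : (skeleton S).Adj u v) : connection hor ver u v * connection hor ver v u = 1 := by
  have := even_iff_not_even_of_adj h
  by_cases hu : Even (u.1 + u.2)
  · rw [connection, connection, if_pos hu, if_neg (this.1 hu), mul_inv_cancel]
  · rw [connection, connection, if_neg hu, if_pos (not_not.1 (mt this.2 hu)), inv_mul_cancel]

lemma exists_cell_eq {a s : ℤ × ℤ} (h : IsCorner a s) : ∃ d, cell a d = s := by
  obtain ⟨h1, h2⟩ := h
  refine ⟨(if a.1 = s.1 then 1 else -1, if a.2 = s.2 then 1 else -1), ?_⟩
  ext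
  · rcases h1 with h | h <;> simp [cell, h]
  · rcases h2 with h | h <;> simp [cell, h]

lemma eq_horNbr_or_eq_verNbr {a b : ℤ × ℤ} {d : ℤˣ × ℤˣ} (hb : IsCorner b (cell a d))
    (h : |a.1 - b.1| + |a.2 - b.2| = 1) : b = horNbr a d ∨ b = verNbr a d := by
  have := abs_add_abs_eq_one h
  simp only [IsCorner, cell] at hb
  simp only [horNbr, verNbr, Prod.ext_iff]
  rcases units_eq d.1 with h1 | h1 <;> rcases units_eq d.2 with h2 | h2 <;>
    rw [h1, h2] at hb ⊢ <;> omega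

lemma eq_or_eq_nbr {a b c : ℤ × ℤ} {d : ℤˣ × ℤˣ} (hc : IsCorner c (cell a d))
    (hb : b = horNbr a d ∨ b = verNbr a d) (h : |b.1 - c.1| + |b.2 - c.2| = 1) :
    c = a ∨ c = nbr a d := by
  have := abs_add_abs_eq_one h
  simp only [IsCorner, cell] at hc
  simp only [horNbr, verNbr, Prod.ext_iff] at hb
  simp only [nbr, Prod.ext_iff]
  rcases units_eq d.1 with h1 | h1 <;> rcases units_eq d.2 with h2 | h2 <;>
    rw [h1, h2] at hb hc ⊢ <;> omega

lemma adj_horNbr {S : Set (ℤ × ℤ)} {v : ℤ × ℤ} {d : ℤˣ × ℤˣ} (hd : cell v d ∈ S) :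
    (skeleton S).Adj v (horNbr v d) :=
  skeleton_adj_of_isCorner hd (isCorner_self v d) (isCorner_horNbr v d) (by
    rcases units_eq d.1 with h | h <;> simp [horNbr, h])

lemma adj_verNbr {S : Set (ℤ × ℤ)} {v : ℤ × ℤ} {d : ℤˣ × ℤˣ} (hd : cell v d ∈ S) :
    (skeleton S).Adj v (verNbr v d) :=
  skeleton_adj_of_isCorner hd (isCorner_self v d) (isCorner_verNbr v d) (by
    rcases units_eq d.2 with h | h <;> simp [verNbr, h])

/-- Flatness of a connection has to be checked on the squares seen from their even corners. -/
lemma connection_flat {S : Set (ℤ × ℤ)} {hor ver : ℤ × ℤ → ℤˣ → G}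
    (hflat : ∀ v ∈ evenVerts S, ∀ d ∈ nbrDirs S v,
      hor v d.1 * (ver (nbr v d) (-d.2))⁻¹ = ver v d.2 * (hor (nbr v d) (-d.1))⁻¹)
    {s : ℤ × ℤ} (hs : s ∈ S) {a b c d : ℤ × ℤ} (ha : IsCorner a s) (hb : IsCorner b s)
    (hc : IsCorner c s) (hd : IsCorner d s) (hab : (skeleton S).Adj a b)
    (hbc : (skeleton S).Adj b c) (had : (skeleton S).Adj a d) (hdc : (skeleton S).Adj d c) :
    connection hor ver a b * connection hor ver b c =
      connection hor ver a d * connection hor ver d c := by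
  have inv := fun {u v : ℤ × ℤ} (h : (skeleton S).Adj u v) => connection_mul_connection hor ver h
  have even_core : ∀ v e, cell v e ∈ S → Even (v.1 + v.2) →
      connection hor ver v (horNbr v e) * connection hor ver (horNbr v e) (nbr v e) =
        connection hor ver v (verNbr v e) * connection hor ver (verNbr v e) (nbr v e) := by
    intro v e hs hv
    have h1 := (even_iff_not_even_of_adj (adj_horNbr hs)).1 hv
    have h2 := (even_iff_not_even_of_adj (adj_verNbr hs)).1 hv
    have := hflat v ⟨⟨_, hs, isCorner_self v e⟩, hv⟩ e (mem_nbrDirs.2 hs)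
    rw [connection, connection, connection, connection, if_pos hv, if_neg h1, if_pos hv,
      if_neg h2, edgeFrame_horNbr, edgeFrame_verNbr, ← verNbr_nbr_neg, edgeFrame_verNbr,
      ← horNbr_nbr_neg, edgeFrame_horNbr]
    exact this
  have core : ∀ v e, cell v e ∈ S →
      connection hor ver v (horNbr v e) * connection hor ver (horNbr v e) (nbr v e) =
        connection hor ver v (verNbr v e) * connection hor ver (verNbr v e) (nbr v e) := by
    intro v e hs
    by_cases hv : Even (v.1 + v.2)
    · exact even_core v e hs hv
    -- At an odd corner the relation is obtained from that at the adjacent even corner `u` by moving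
    -- one edge to the other side.
    set u := horNbr v e with hu
    have e1 : cell u (-e.1, e.2) = cell v e := by ext <;> simp [cell, hu, horNbr, min_comm]
    have e2 : horNbr u (-e.1, e.2) = v := by ext <;> simp [hu, horNbr]
    have e3 : verNbr u (-e.1, e.2) = nbr v e := by ext <;> simp [hu, horNbr, verNbr, nbr]
    have e4 : nbr u (-e.1, e.2) = verNbr v e := by ext <;> simp [hu, horNbr, verNbr, nbr]
    have hs' : cell u (-e.1, e.2) ∈ S := e1 ▸ hs
    have h1 := even_core u _ hs' (by
      have := even_iff_not_even_of_adj (adj_horNbr hs)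
      tauto)
    have a1 := adj_horNbr hs
    have a2 : (skeleton S).Adj (verNbr v e) (nbr v e) := by
      have := adj_horNbr (S := S) (v := nbr v e) (d := -e) (by rwa [cell_nbr_neg])
      rw [horNbr_nbr_neg] at this
      exact this.symm
    rw [e2, e3, e4] at h1
    have i1 := inv a1
    have i2 := inv a2.symm
    rw [← mul_left_cancel_iff (a := connection hor ver u v), ← mul_assoc, inv a1.symm, one_mul,
      ← mul_assoc, h1, mul_assoc, i2, mul_one]
  obtain ⟨e, rfl⟩ := exists_cell_eq ha
  have hb' := eq_horNbr_or_eq_verNbr hb hab.1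
  have hd' := eq_horNbr_or_eq_verNbr hd had.1
  rcases eq_or_eq_nbr hc hb' hbc.1 with rfl | rfl
  · rw [inv hab, inv had]
  rcases hb' with rfl | rfl <;> rcases hd' with rfl | rfl
  · rfl
  · exact core a e hs
  · exact (core a e hs).symm
  · rfl

end Connection

/-! ### From uniformizing variables to a global system of frames. -/

/-- If `sn γ = 0`, the four nominal angles are all `0` or all `π`, with sum `0` or `4π`. -/
lemma sn_pos_of_gammaSum_eq {S : Set (ℤ × ℤ)} {q : ℝ} (hq0 : 0 < q) (hq1 : q ≤ 1)
    {γ : ℤ × ℤ → ℝ} {v : ℤ × ℤ} (hγ : γ v ∈ gammaInterval q) (hv : v ∈ internalVerts S)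
    (hsum : gammaSum S q γ v = 2 * π) : 0 < sn q (γ v) := by
  refine (sn_nonneg_of_mem hq0.le hq1 hγ).lt_of_ne fun hs => ?_
  have hang := nominalAngle_of_sn_eq_zero hq0 hq1 hγ hs.symm
  rw [gammaSum_eq_sum_nominalAngle, nbrDirs_eq_univ hv] at hsum
  have hc : cn q (γ v) ^ 2 = 1 := by rw [cn_sq, ← hs]; norm_num
  have hπ := pi_pos
  rcases sq_eq_one_iff.1 hc with h | h
  · simp [(hang _).1 h] at hsum
  · simp [(hang _).2 h] at hsum

/-- The scaled centers of the rings with given variables, seen from the touching points. -/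
theorem exists_frames {S : Set (ℤ × ℤ)} (hS : IsSimplyConnected S) {q : ℝ} (hq0 : 0 < q)
    (hq1 : q ≤ 1) {γ : ℤ × ℤ → ℝ} (hγ : ∀ v ∈ evenVerts S, γ v ∈ gammaInterval q)
    (hsum : ∀ v ∈ internalVerts S, gammaSum S q γ v = 2 * π) :
    ∃ (F : ℤ × ℤ → SpecialLinearGroup (Fin 3) ℝ) (K : ℤ × ℤ → Mink), (∀ w, F w ∈ lorentz) ∧
      ∀ v ∈ evenVerts S, ∀ d,
        ((skeleton S).Adj v (horNbr v d) →
          act (F (horNbr v d)) (horVec q (γ v) ((d.1 : ℤ) : ℝ)) = K v) ∧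
        ((skeleton S).Adj v (verNbr v d) →
          act (F (verNbr v d)) (verVec q (γ v) ((d.2 : ℤ) : ℝ)) = K v) := by
  have star : ∀ v, ∃ (hor ver : ℤˣ → SpecialLinearGroup (Fin 3) ℝ) (K : Mink),
      (∀ e, hor e ∈ lorentz ∧ ver e ∈ lorentz) ∧ (v ∈ evenVerts S →
        IsStar q (γ v) (fun d => γ (nbr v d)) {d | d ∈ nbrDirs S v} hor ver K) := by
    intro v
    by_cases hv : v ∈ evenVerts S
    · obtain ⟨hor, ver, K, h⟩ : ∃ hor ver K,
          IsStar q (γ v) (fun d => γ (nbr v d)) {d | d ∈ nbrDirs S v} hor ver K := by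
        by_cases hD : nbrDirs S v = Finset.univ
        · have hi : v ∈ internalVerts S := ⟨hv, by rw [valence, hD]; rfl⟩
          have hs := hsum v hi
          have hp := sn_pos_of_gammaSum_eq hq0 hq1 (hγ v hv) hi hs
          rw [gammaSum_eq_sum_nominalAngle, hD] at hs
          exact exists_isStar_of_sum_eq hq0 hq1 hp hs _
        · obtain ⟨d, hd⟩ : ∃ d, d ∉ nbrDirs S v := by
            by_contra! h
            exact hD (Finset.eq_univ_of_forall h)
          exact exists_isStar_of_notMem hq0 hq1 (d₀ := d) _ _ hd
      exact ⟨hor, ver, K, fun e => ⟨h.hor_mem e, h.ver_mem e⟩, fun _ => h⟩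
    · exact ⟨fun _ => 1, fun _ => 1, 0, fun e => ⟨lorentz.one_mem, lorentz.one_mem⟩,
        fun h => absurd h hv⟩
  choose hor ver K hmem hstar using star
  have emem : ∀ u v, edgeFrame hor ver u v ∈ lorentz := by
    intro u v
    rw [edgeFrame]
    split_ifs <;> first | exact (hmem _ _).1 | exact (hmem _ _).2
  obtain ⟨F, hF, hF'⟩ := exists_potential hS (h := connection hor ver) (H := lorentz)
    (fun u v => by
      rw [connection]
      split_ifs
      · exact emem _ _
      · exact lorentz.inv_mem (emem _ _))
    (fun u v h => connection_mul_connection hor ver h)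
    (fun s hs a b c d ha hb hc hd hab hbc had hdc =>
      -- The star relations at the two even corners of a square involve mutually inverse
      -- transitions, which cancel around the square.
      connection_flat (fun v hv d hd => by
        have h1 := (hstar v hv).eq d hd
        have h2 := (hstar _ (nbr_mem_evenVerts hv hd)).eq _ (neg_mem_nbrDirs_nbr.2 hd)
        beta_reduce at h2
        rw [nbr_neg, transition_neg hq0 hq1, Prod.snd_neg, Prod.fst_neg] at h2
        rw [h1, h2]
        group) hs ha hb hc hd hab hbc had hdc)
  -- Frames at even vertices have no geometric meaning; they only place the stars relative to each
  -- other.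
  refine ⟨F, fun v => act (F v) (K v), hF, fun v hv d => ⟨fun h => ?_, fun h => ?_⟩⟩
  · rw [hF' _ _ h, connection, if_pos hv.2, edgeFrame_horNbr, act_mul, (hstar v hv).act_hor]
  · rw [hF' _ _ h, connection, if_pos hv.2, edgeFrame_verNbr, act_mul, (hstar v hv).act_ver]

end RingPattern
end
noncomputable section

namespace RingPattern

open Real Matrix

/-! ### Rings with a given uniformizing variable -/

lemma one_sub_tanh_sq (x : ℝ) : 1 - tanh x ^ 2 = (1 / cosh x) ^ 2 := by
  have := cosh_sq x
  have h := (cosh_pos x).ne'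
  rw [tanh_eq_sinh_div_cosh]
  field_simp
  linarith

theorem HypRing.HasParameter.exists_isUniformizedBy {q : ℝ} (hq0 : 0 < q) (hq1 : q ≤ 1)
    {ρ : HypRing} (h : ρ.HasParameter q) : ∃ γ, ρ.IsUniformizedBy q γ := by
  cases ρ with
  | proper k hk r R hR hr =>
    obtain ⟨h1, h2⟩ := h
    have hcr := cosh_pos r
    have hcR := cosh_pos R
    have ht := abs_lt.1 ((sq_lt_one_iff_abs_lt_one _).1 (tanh_sq_lt_one r))
    -- This amplitude gives `cn γ = tanh r` and `sn γ = 1 / cosh r`. If `q = 1`, then `r = R > 0`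
    -- keeps it below `π / 2`, within the range of the Gudermann function.
    obtain ⟨γ, hγ, ham⟩ := exists_am_eq (φ := arccos (tanh r)) hq0.le hq1 (arccos_nonneg _)
      (arccos_le_pi _) (fun hq => arccos_lt_pi_div_two.2 (by
        rw [h2 hq, tanh_eq_sinh_div_cosh]
        exact div_pos (sinh_pos_iff.2 hR) hcR))
    have hcn : cn q γ = tanh r := by rw [cn, ham, cos_arccos ht.1.le ht.2.le]
    have hsn : sn q γ = 1 / cosh r := by
      rw [sn, ham, sin_arccos, one_sub_tanh_sq, sqrt_sq (by positivity)]
    refine ⟨γ, hγ, ?_, ?_, ?_⟩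
    · rw [hsn, h1]
      field_simp
    · have htR : 0 ≤ tanh R := by
        rw [tanh_eq_sinh_div_cosh]
        exact (div_pos (sinh_pos_iff.2 hR) hcR).le
      have e : 1 - q ^ 2 * sn q γ ^ 2 = tanh R ^ 2 := by
        have e1 : q ^ 2 * sn q γ ^ 2 = (1 / cosh R) ^ 2 := by
          rw [hsn, h1]
          field_simp
        rw [e1, ← one_sub_tanh_sq]
        ring
      rw [dn, e, sqrt_sq htR]
    · rw [hcn, hsn, tanh_eq_sinh_div_cosh]
      field_simp
  | ideal k hk a A ha hA s =>
    obtain ⟨h1, h2⟩ := h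
    rcases Int.units_eq_one_or s with rfl | rfl
    · obtain ⟨γ, hγ, ham⟩ := exists_am_eq (φ := 0) hq0.le hq1 le_rfl pi_pos.le
        (fun _ => by positivity)
      exact ⟨γ, hγ, h1, by simp [sn, ham], by simp [cn, ham]⟩
    · obtain ⟨γ, hγ, ham⟩ := exists_am_eq (φ := π) hq0.le hq1 pi_pos.le le_rfl
        (fun hq => absurd (h2 hq) (by decide))
      exact ⟨γ, hγ, h1, by simp [sn, ham], by simp [cn, ham]⟩

/-- The ring with the variable `γ` and a given scaled center. -/
lemma exists_ring {q γ : ℝ} (hq0 : 0 < q) (hq1 : q ≤ 1) (hγ : γ ∈ gammaInterval q) {K : Mink}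
    (hK : mink K K = -sn q γ ^ 2) (hK0 : 0 < K 0) :
    ∃ ρ : HypRing, ρ.IsUniformizedBy q γ ∧ ∃ l : ℝ, 0 < l ∧ ρ.center = l • K ∧
      ρ.inner = ⟨l • K, l⟩ ∧ ρ.outer = ⟨l • K, l / q⟩ := by
  have hc := cn_sq q γ
  rcases (sn_nonneg_of_mem hq0.le hq1 hγ).lt_or_eq with hs | hs
  · have hd := dn_pos hq0.le hq1 γ
    have hd2 := dn_sq hq0.le hq1 γ
    have hr : cosh (arsinh (cn q γ / sn q γ)) = 1 / sn q γ := by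
      rw [cosh_arsinh, show 1 + (cn q γ / sn q γ) ^ 2 = (1 / sn q γ) ^ 2 by
        field_simp; linarith, sqrt_sq (by positivity)]
    have hR : cosh (arsinh (dn q γ / (q * sn q γ))) = 1 / (q * sn q γ) := by
      rw [cosh_arsinh, show 1 + (dn q γ / (q * sn q γ)) ^ 2 = (1 / (q * sn q γ)) ^ 2 by
        field_simp; linarith, sqrt_sq (by positivity)]
    have hR0 : 0 < arsinh (dn q γ / (q * sn q γ)) := arsinh_pos_iff.2 (by positivity)
    have hle : |arsinh (cn q γ / sn q γ)| ≤ arsinh (dn q γ / (q * sn q γ)) := by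
      rw [← abs_of_pos hR0, ← cosh_le_cosh, hr, hR]
      apply one_div_le_one_div_of_le (by positivity)
      nlinarith
    have hk : (1 / sn q γ) • K ∈ hypPlane := by
      refine ⟨?_, ?_⟩
      · rw [mink_smul_left, mink_smul_right, hK]
        field_simp
      · simp only [Pi.smul_apply, smul_eq_mul]
        positivity
    refine ⟨.proper _ hk _ _ hR0 hle, ⟨hγ, hR, ?_, sinh_arsinh _⟩, 1 / sn q γ, by positivity,
      rfl, ?_, ?_⟩
    · rw [tanh_eq_sinh_div_cosh, hR, sinh_arsinh]
      field_simp
    · rw [HypRing.inner, hr]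
    · rw [HypRing.outer, hR]
      congr 1
      field_simp
  · have hk : K ∈ idealPoints := ⟨by rw [hK, ← hs]; simp, hK0⟩
    have hA : 1 ≤ 1 / q := by rwa [le_div_iff₀ hq0, one_mul]
    obtain ⟨s, hs'⟩ : ∃ s : ℤˣ, cn q γ = ((s : ℤ) : ℝ) := by
      rw [← hs] at hc
      rcases sq_eq_one_iff.1 (show cn q γ ^ 2 = 1 by rw [hc]; norm_num) with h | h
      · exact ⟨1, by simp [h]⟩
      · exact ⟨-1, by simp [h]⟩
    refine ⟨.ideal K hk 1 (1 / q) one_pos hA s, ⟨hγ, by field_simp, hs.symm, hs'⟩, 1, one_pos,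
      by simp [HypRing.center], by simp [HypRing.inner], by simp [HypRing.outer]⟩

/-! ### Existence of ring patterns -/

lemma act_future {A : SpecialLinearGroup (Fin 3) ℝ} (hA : A ∈ lorentz) {n : Mink}
    (hn : mink n n ≤ 0) (h0 : 0 < n 0) : 0 < act A n 0 := by
  have h1 : act A⁻¹ ![1, 0, 0] ∈ hypPlane :=
    (lorentz.inv_mem hA).2 _ ⟨by simp [mink], by simp⟩
  have h2 := mink_neg_of_future h1 hn h0
  rw [← hA.1, act_act_inv] at h2
  simpa [mink] using h2

lemma exists_cell_mem {S : Set (ℤ × ℤ)} {v : ℤ × ℤ} (hv : v ∈ verts S) :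
    ∃ d, d ∈ nbrDirs S v := by
  obtain ⟨s, hs, h⟩ := hv
  obtain ⟨d, rfl⟩ := exists_cell_eq h
  exact ⟨d, mem_nbrDirs.2 hs⟩

/-- The orientation of the triangle formed by the center of a ring and its touching points. -/
lemma det3_touching {q γ γ' ε δ : ℝ} (hq0 : 0 < q) (hq1 : q ≤ 1) (hε : ε = 1 ∨ ε = -1)
    (hδ : δ = 1 ∨ δ = -1) {A A' : SpecialLinearGroup (Fin 3) ℝ} (hA : A ∈ lorentz)
    (hA' : A' ∈ lorentz) {k k' : Mink} (h1 : act A (horVec q γ ε) = k)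
    (h2 : act A (verVec q γ' (-δ)) = k') (h3 : act A' (verVec q γ δ) = k)
    (h4 : act A' (horVec q γ' (-ε)) = k') :
    sign (ε * δ * det3 k (act A ![1, 0, 0]) (act A' ![1, 0, 0])) = sign (cn q γ) := by
  have hε2 : ε ^ 2 = 1 := by rcases hε with rfl | rfl <;> norm_num
  have hδ2 : δ ^ 2 = 1 := by rcases hδ with rfl | rfl <;> norm_num
  have hδ' : -δ = 1 ∨ -δ = -1 := by rcases hδ with rfl | rfl <;> simp
  have e := det3_expand k k' (act A ![1, 0, 0]) (act A' ![1, 0, 0])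
  have kk : mink k k = -sn q γ ^ 2 := by rw [← h1, hA.1, mink_horVec_self q γ hε]
  have kk' : mink k' k' = -sn q γ' ^ 2 := by rw [← h2, hA.1, mink_verVec_self hq0 hq1 γ' hδ']
  have cross : mink k k' = -(1 / q) := by rw [← h1, ← h2, hA.1, mink_horVec_verVec]
  have pk : mink (act A ![1, 0, 0]) k = -1 := by rw [← h1, hA.1]; simp [mink, horVec]
  have pk' : mink (act A ![1, 0, 0]) k' = -(1 / q) := by
    rw [← h2, hA.1]; simp [mink, verVec]
  have pk2 : mink (act A' ![1, 0, 0]) k = -(1 / q) := by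
    rw [← h3, hA'.1]; simp [mink, verVec]
  have pk2' : mink (act A' ![1, 0, 0]) k' = -1 := by rw [← h4, hA'.1]; simp [mink, horVec]
  have d1 : det3 k k' (act A ![1, 0, 0]) = -(ε * δ * cn q γ * dn q γ' / q) := by
    rw [← h1, ← h2, det3_act, det3_eq]
    simp [horVec, verVec]
    ring
  have d2 : det3 k k' (act A' ![1, 0, 0]) = ε * δ * dn q γ * cn q γ' / q := by
    rw [← h3, ← h4, det3_act, det3_eq]
    simp [horVec, verVec]
    ring
  rw [kk, kk', cross, pk, pk', pk2, pk2', d1, d2] at e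
  have hD := addDenom_pos hq0.le hq1 γ γ'
  have hP := dn_mul_dn_add_pos hq0.le hq1 γ γ'
  have hd := dn_pos hq0.le hq1 γ
  have c2 := cn_sq q γ
  have dd := dn_sq hq0.le hq1 γ
  set X := det3 k (act A ![1, 0, 0]) (act A' ![1, 0, 0])
  -- The frames give the heights with their signs, so the bracket multiplying `cn γ` is strictly
  -- positive by `dn_mul_dn_add_pos`.
  have key : q * (1 - q ^ 2 * sn q γ ^ 2 * sn q γ' ^ 2) * (ε * δ * X) =
      (dn q γ * (dn q γ * dn q γ' + q * cn q γ * cn q γ')) * cn q γ := by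
    field_simp at e
    linear_combination ε * δ * e +
      (q * (1 - sn q γ ^ 2) * dn q γ * cn q γ' + (1 - q ^ 2 * sn q γ ^ 2) * cn q γ * dn q γ') *
        (δ ^ 2 * hε2 + hδ2) - q * dn q γ * cn q γ' * c2 - cn q γ * dn q γ' * dd
  rw [← sign_mul_of_pos (mul_pos hq0 hD), key, sign_mul_of_pos (mul_pos hd hP)]

theorem exists_isRingPattern {S : Set (ℤ × ℤ)} (hS : IsSimplyConnected S) {q : ℝ} (hq0 : 0 < q)
    (hq1 : q ≤ 1) {γ : ℤ × ℤ → ℝ} (hγ : ∀ v ∈ evenVerts S, γ v ∈ gammaInterval q)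
    (hsum : ∀ v ∈ internalVerts S, gammaSum S q γ v = 2 * π) :
    ∃ (ring : ℤ × ℤ → HypRing) (pt : ℤ × ℤ → Mink), IsRingPattern S ring pt ∧
      ∀ v ∈ evenVerts S, (ring v).IsUniformizedBy q (γ v) := by
  obtain ⟨F, K, hF, hFK⟩ := exists_frames hS hq0 hq1 hγ hsum
  have hor : ∀ v ∈ evenVerts S, ∀ d ∈ nbrDirs S v,
      act (F (horNbr v d)) (horVec q (γ v) ((d.1 : ℤ) : ℝ)) = K v := fun v hv d hd =>
    (hFK v hv d).1 (adj_horNbr (mem_nbrDirs.1 hd))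
  have ver : ∀ v ∈ evenVerts S, ∀ d ∈ nbrDirs S v,
      act (F (verNbr v d)) (verVec q (γ v) ((d.2 : ℤ) : ℝ)) = K v := fun v hv d hd =>
    (hFK v hv d).2 (adj_verNbr (mem_nbrDirs.1 hd))
  have hor' : ∀ v ∈ evenVerts S, ∀ d ∈ nbrDirs S v,
      act (F (verNbr v d)) (horVec q (γ (nbr v d)) (-((d.1 : ℤ) : ℝ))) = K (nbr v d) := by
    intro v hv d hd
    have := hor _ (nbr_mem_evenVerts hv hd) _ (neg_mem_nbrDirs_nbr.2 hd)
    rw [horNbr_nbr_neg] at this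
    simpa using this
  have ver' : ∀ v ∈ evenVerts S, ∀ d ∈ nbrDirs S v,
      act (F (horNbr v d)) (verVec q (γ (nbr v d)) (-((d.2 : ℤ) : ℝ))) = K (nbr v d) := by
    intro v hv d hd
    have := ver _ (nbr_mem_evenVerts hv hd) _ (neg_mem_nbrDirs_nbr.2 hd)
    rw [verNbr_nbr_neg] at this
    simpa using this
  have hring : ∀ v, ∃ ρ : HypRing, v ∈ evenVerts S → ρ.IsUniformizedBy q (γ v) ∧
      ∃ l : ℝ, 0 < l ∧ ρ.center = l • K v ∧ ρ.inner = ⟨l • K v, l⟩ ∧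
        ρ.outer = ⟨l • K v, l / q⟩ := by
    intro v
    by_cases hv : v ∈ evenVerts S
    · obtain ⟨d, hd⟩ := exists_cell_mem hv.1
      have h1 := hor v hv d hd
      have h2 := mink_horVec_self q (γ v) (units_cast_eq d.1)
      obtain ⟨ρ, h⟩ := exists_ring hq0 hq1 (hγ v hv) (K := K v) (by rw [← h1, (hF _).1, h2])
        (by
          rw [← h1]
          exact act_future (hF _) (by rw [h2]; nlinarith [sq_nonneg (sn q (γ v))])
            (by simp [horVec]))
      exact ⟨ρ, fun _ => h⟩
    -- An arbitrary ring at the vertices outside the pattern.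
    · exact ⟨.ideal ![1, 1, 0] ⟨by simp [mink], by simp⟩ 1 1 one_pos le_rfl 1,
        fun h => absurd h hv⟩
  choose ring hring using hring
  have hu : ∀ v ∈ evenVerts S, (ring v).IsUniformizedBy q (γ v) := fun v hv => (hring v hv).1
  have base : (![1, 0, 0] : Mink) ∈ hypPlane := ⟨by simp [mink], by simp⟩
  have hpt : ∀ w, act (F w) ![1, 0, 0] ∈ hypPlane := fun w => (hF w).2 _ base
  have pk : ∀ v ∈ evenVerts S, ∀ d, (skeleton S).Adj v (horNbr v d) →
      mink (act (F (horNbr v d)) ![1, 0, 0]) (K v) = -1 := by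
    intro v hv d h
    rw [← (hFK v hv d).1 h, (hF _).1]
    simp [mink, horVec]
  have pk' : ∀ v ∈ evenVerts S, ∀ d, (skeleton S).Adj v (verNbr v d) →
      mink (act (F (verNbr v d)) ![1, 0, 0]) (K v) = -(1 / q) := by
    intro v hv d h
    rw [← (hFK v hv d).2 h, (hF _).1]
    simp [mink, verVec]
  have inner : ∀ v ∈ evenVerts S, ∀ d, (skeleton S).Adj v (horNbr v d) →
      act (F (horNbr v d)) ![1, 0, 0] ∈ (ring v).inner.points := by
    intro v hv d h
    obtain ⟨-, l, hl, -, h1, -⟩ := hring v hv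
    rw [h1]
    refine ⟨hpt _, ?_⟩
    rw [mink_smul_right, pk v hv d h]
    ring
  have outer : ∀ v ∈ evenVerts S, ∀ d, (skeleton S).Adj v (verNbr v d) →
      act (F (verNbr v d)) ![1, 0, 0] ∈ (ring v).outer.points := by
    intro v hv d h
    obtain ⟨-, l, hl, -, -, h1⟩ := hring v hv
    rw [h1]
    refine ⟨hpt _, ?_⟩
    rw [mink_smul_right, pk' v hv d h]
    ring
  have inner_normal : ∀ v ∈ evenVerts S, ∀ d, (skeleton S).Adj v (horNbr v d) →
      ∃ t : ℝ, 0 ≤ t ∧ (ring v).orientation • (ring v).inner.normal (act (F (horNbr v d)) ![1, 0, 0]) =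
        (t * (d.1 : ℤ)) • act (F (horNbr v d)) ![0, -1, 0] := by
    intro v hv d h
    have ho := (scaledCenter_spec (γ := γ) hq0 (hu v hv)).2.2
    obtain ⟨-, l, hl, -, h1, -⟩ := hring v hv
    -- Weighting the normal with the orientation replaces `cn γ` by its absolute value, so its
    -- direction on the frame axis depends only on the side `d.1`. If `r = 0` the factor vanishes.
    refine ⟨l * (sign (cn q (γ v)) * cn q (γ v)), mul_nonneg hl.le (sign_mul_nonneg _), ?_⟩
    rw [h1, Cycle.normal, mink_smul_right, pk v hv d h, ho]
    simp only
    rw [← (hFK v hv d).1 h, ← act_smul, ← act_smul, ← act_add, ← act_smul, ← act_smul]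
    congr 1
    ext i
    fin_cases i <;> simp [horVec]
    ring
  have outer_normal : ∀ v ∈ evenVerts S, ∀ d, (skeleton S).Adj v (verNbr v d) →
      ∃ t : ℝ, 0 ≤ t ∧ (ring v).outer.normal (act (F (verNbr v d)) ![1, 0, 0]) =
        (t * (d.2 : ℤ)) • act (F (verNbr v d)) ![0, 0, -1] := by
    intro v hv d h
    obtain ⟨-, l, hl, -, -, h1⟩ := hring v hv
    have hd := dn_pos hq0.le hq1 (γ v)
    refine ⟨l * (dn q (γ v) / q), by positivity, ?_⟩
    rw [h1, Cycle.normal, mink_smul_right, pk' v hv d h]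
    simp only
    rw [← (hFK v hv d).2 h, ← act_smul, ← act_smul, ← act_add, ← act_smul]
    congr 1
    ext i
    fin_cases i <;> simp [verVec]
    ring
  have mem_even : ∀ {u v}, (skeleton S).Adj u v → u ∈ oddVerts S → v ∈ evenVerts S := by
    intro u v h hu
    obtain ⟨s, hs, -, hv⟩ := h.2
    refine ⟨⟨s, hs, hv⟩, ?_⟩
    have := even_iff_not_even_of_adj h
    have h2 := Int.not_even_iff_odd.2 hu.2
    tauto
  have ray : ∀ (x : Mink) {s t : ℝ}, 0 ≤ s → 0 ≤ t → SameRay ℝ (s • x) (t • x) :=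
    fun x s t hs ht => ((SameRay.refl x).nonneg_smul_left hs).nonneg_smul_right ht
  -- The touching points are the origins of the frames at the odd vertices. Rings on opposite sides
  -- have normals along the same axis with opposite signs, which is the touching condition.
  refine ⟨ring, fun w => act (F w) ![1, 0, 0], ⟨fun w _ => hpt w, ?_, ?_, ?_, ?_, ?_, ?_⟩, hu⟩
  · intro v hv d hd
    have hv' := nbr_mem_evenVerts hv hd
    refine ⟨⟨_, outer v hv d (adj_verNbr (mem_nbrDirs.1 hd)), ?_⟩, ?_⟩
    · rw [← horNbr_nbr_neg]
      exact inner _ hv' _ (adj_horNbr (mem_nbrDirs.1 (neg_mem_nbrDirs_nbr.2 hd)))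
    -- Orthogonality holds at every common point, since it depends only on the two levels and on the
    -- product of the centers.
    · rintro x ⟨⟨hx, h1⟩, -, h2⟩
      obtain ⟨-, l, hl, -, -, e⟩ := hring v hv
      obtain ⟨-, l', hl', -, e', -⟩ := hring _ hv'
      have cross : mink (K v) (K (nbr v d)) = -(1 / q) := by
        rw [← hor v hv d hd, ← ver' v hv d hd, (hF _).1, mink_horVec_verVec]
      rw [e] at h1 ⊢
      rw [e'] at h2 ⊢
      simp only [Cycle.normal, mink_smul_left, mink_smul_right, mink_add_left, mink_add_right,
        hx.1, cross, mink_comm (K v) x] at h1 h2 ⊢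
      field_simp at h1 h2 ⊢
      linear_combination l * l' * (h2 - mink x (K (nbr v d)) * h1)
  · exact fun v hv d hd => inner v hv d (adj_horNbr (mem_nbrDirs.1 hd))
  · exact fun v hv d hd => outer v hv d (adj_verNbr (mem_nbrDirs.1 hd))
  · intro m n hw hl hr
    have e1 : horNbr (m - 1, n) (1, 1) = (m, n) := by simp [horNbr]
    have e2 : horNbr (m + 1, n) (-1, 1) = (m, n) := by simp [horNbr]
    have v1 := mem_even hl hw
    have v2 := mem_even hr hw
    have a1 : (skeleton S).Adj (m - 1, n) (horNbr (m - 1, n) (1, 1)) := e1 ▸ hl.symm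
    have a2 : (skeleton S).Adj (m + 1, n) (horNbr (m + 1, n) (-1, 1)) := e2 ▸ hr.symm
    have i1 := inner _ v1 _ a1
    have i2 := inner _ v2 _ a2
    obtain ⟨s, hs, n1⟩ := inner_normal _ v1 _ a1
    obtain ⟨t, ht, n2⟩ := inner_normal _ v2 _ a2
    rw [e1] at i1 n1
    rw [e2] at i2 n2
    refine ⟨i1, i2, ?_⟩
    rw [n1, n2]
    simpa using ray _ hs ht
  · intro m n hw hl hr
    have e1 : verNbr (m, n - 1) (1, 1) = (m, n) := by simp [verNbr]
    have e2 : verNbr (m, n + 1) (1, -1) = (m, n) := by simp [verNbr]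
    have v1 := mem_even hl hw
    have v2 := mem_even hr hw
    have a1 : (skeleton S).Adj (m, n - 1) (verNbr (m, n - 1) (1, 1)) := e1 ▸ hl.symm
    have a2 : (skeleton S).Adj (m, n + 1) (verNbr (m, n + 1) (1, -1)) := e2 ▸ hr.symm
    have i1 := outer _ v1 _ a1
    have i2 := outer _ v2 _ a2
    obtain ⟨s, hs, n1⟩ := outer_normal _ v1 _ a1
    obtain ⟨t, ht, n2⟩ := outer_normal _ v2 _ a2
    rw [e1] at i1 n1
    rw [e2] at i2 n2
    refine ⟨i1, i2, ?_⟩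
    rw [n1, n2]
    simpa using ray _ hs ht
  · intro v hv d hd
    have ho := (scaledCenter_spec (γ := γ) hq0 (hu v hv)).2.2
    obtain ⟨-, l, hl, hc, -, -⟩ := hring v hv
    rw [ho, hc, det3_smul_left, mul_left_comm, sign_mul_of_pos hl, ← det3_touching hq0 hq1
      (units_cast_eq d.1) (units_cast_eq d.2) (hF _) (hF _) (hor v hv d hd) (ver' v hv d hd)
      (ver v hv d hd) (hor' v hv d hd)]
    push_cast
    rfl

end RingPattern
end
/-- Let `S` be a simply connected set of lattice squares and `0 < q ≤ 1`. The rings of an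
orthogonal ring pattern with parameter `q` have uniformizing variables `γ ∈ [0, 2K]`; values `γ`
are the uniformizing variables of such a pattern if and only if they lie in `[0, 2K]` and satisfy
the equations at the internal vertices; and the boundary variables of a pattern satisfy the
equations that involve the total angle. -/
theorem mainTheorem3 (S : Set (ℤ × ℤ)) (hS : RingPattern.IsSimplyConnected S)
    (q : ℝ) (hq0 : 0 < q) (hq1 : q ≤ 1) :
    (∀ (ring : ℤ × ℤ → RingPattern.HypRing) (pt : ℤ × ℤ → RingPattern.Mink),
      RingPattern.IsRingPattern S ring pt →
      (∀ v ∈ RingPattern.evenVerts S, (ring v).HasParameter q) →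
      ∃ γ : ℤ × ℤ → ℝ, ∀ v ∈ RingPattern.evenVerts S, (ring v).IsUniformizedBy q (γ v)) ∧
    (∀ γ : ℤ × ℤ → ℝ,
      (∃ (ring : ℤ × ℤ → RingPattern.HypRing) (pt : ℤ × ℤ → RingPattern.Mink),
        RingPattern.IsRingPattern S ring pt ∧
        ∀ v ∈ RingPattern.evenVerts S, (ring v).IsUniformizedBy q (γ v)) ↔
      (∀ v ∈ RingPattern.evenVerts S, γ v ∈ RingPattern.gammaInterval q) ∧
        ∀ v ∈ RingPattern.internalVerts S, RingPattern.gammaSum S q γ v = 2 * Real.pi) ∧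
    (∀ (γ : ℤ × ℤ → ℝ) (ring : ℤ × ℤ → RingPattern.HypRing) (pt : ℤ × ℤ → RingPattern.Mink),
      RingPattern.IsRingPattern S ring pt →
      (∀ v ∈ RingPattern.evenVerts S, (ring v).IsUniformizedBy q (γ v)) →
      ∀ v ∈ RingPattern.boundaryVerts S,
        (0 < (ring v).innerRadius →
          RingPattern.gammaSum S q γ v = RingPattern.totalAngle S ring pt v) ∧
        ((ring v).innerRadius < 0 →
          RingPattern.gammaSum S q γ v =
            RingPattern.totalAngle S ring pt v + Real.pi * RingPattern.valence S v)) := by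
  refine ⟨fun ring pt hp hq => ?_, fun γ => ⟨?_, fun h => ?_⟩, fun γ ring pt hp hu v hv =>
    RingPattern.gammaSum_eq_totalAngle hq0 hq1 hp hu hv.1⟩
  · have h : ∀ v, ∃ x, v ∈ RingPattern.evenVerts S → (ring v).IsUniformizedBy q x := by
      intro v
      by_cases hv : v ∈ RingPattern.evenVerts S
      · obtain ⟨x, hx⟩ := (hq v hv).exists_isUniformizedBy hq0 hq1
        exact ⟨x, fun _ => hx⟩
      · exact ⟨0, fun h => absurd h hv⟩
    choose γ hγ using h
    exact ⟨γ, hγ⟩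
  · rintro ⟨ring, pt, hp, hu⟩
    exact ⟨fun v hv => (hu v hv).mem,
      fun v hv => RingPattern.gammaSum_of_internal hq0 hq1 hp hu hv⟩
  · exact RingPattern.exists_isRingPattern hS hq0 hq1 h.1 h.2
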